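/- For a finite complex Borel measure $\mu$ on $\mathbb R$ let $\|\mu\|_1$ denote its total variation. For $F:\mathbb R\to\mathbb C$ we write $\widehat F=\mu$ if $F(x)=\frac1{2\pi}\int_{\mathbb R} e^{ix\xi}\,d\mu(\xi)$ for all $x\in\mathbb R$, and we say that $\widehat F$ is a finite measure if such a $\mu$ exists. Call $\chi\in C^\infty(\mathbb R)$ real-valued with $\chi=1$ on $|x|<1$ and $\chi=0$ on $|x|>2$ a cutoff. The improper integral $\int_0^\infty f(\lambda)\,d\lambda$ means $\lim_{R\to\infty}\int_0^\infty\chi(\lambda/R)f(\lambda)\,d\lambda$, required to exist with the same value for every cutoff $\chi$. The Hilbert transform is $Hf(\lambda)=\frac1\pi\,\mathrm{p.v.}\!\int\frac{f(\eta)}{\lambda-\eta}\,d\eta$, where the principal value is taken at $\eta=\lambda$ and the integral is improper at infinity in the same sense: $Hf(\lambda)=\lim_{R\to\infty}\lim_{\epsilon\downarrow0}\frac1\pi\int_{|\lambda-\eta|>\epsilon}\chi(\eta/R)\frac{f(\eta)}{\lambda-\eta}\,d\eta$. **Lemma.** There is an absolute constant $C$ such that the following holds. Let $F_s,F_a,G_a:\mathbb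 R\to\mathbb C$ be differentiable, with $F_s$ even and $F_a,G_a$ odd, and suppose that $\widehat{F_s},\widehat{F_s'},\widehat{F_a},\widehat{F_a'},\widehat{G_a},\widehat{G_a'}$ are finite measures. Then, for all real $t\ne s$, the improper integral below exists and $$\left|\int_0^\infty e^{i(t-s)\lambda}F_s(\sqrt\lambda)\,G_a(\sqrt\lambda)\,d\lambda\right|\le C|t-s|^{-3/2}\left(\|\widehat{F_s}\|_1\|\widehat{G_a'}\|_1+\|\widehat{F_s'}\|_1\|\widehat{G_a}\|_1\right);$$ moreover $H\big(e^{-is\eta}\chi_{[0,\infty)}(\eta)\,G_a(\sqrt\eta)\big)(\lambda)$ exists for every $\lambda>0$, the improper integral below exists, and $$\left|\int_0^\infty e^{it\lambda}F_a(\sqrt\lambda)\,H\big(e^{-is\eta}\chi_{[0,\infty)}(\eta)\,G_a(\sqrt\eta)\big)(\lambda)\,d\lambda\right|\le C|t-s|^{-3/2}\left(\|\widehat{F_a}\|_1\|\widehat{G_a'}\|_1+\|\widehat{F_a'}\|_1\|\widehat{G_a}\|_1\right).$$ -/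

import Mathlib

open MeasureTheory Set Filter Topology
open scoped ContDiff

noncomputable section

/-- The finite complex measure `μ` is the Fourier transform of `F : ℝ → ℂ`, with the convention
`F̂(ξ) = ∫ e^{-i x ξ} F(x) dx`: that is, `F` is the inverse Fourier transform of `μ`,
`F(x) = (2π)⁻¹ ∫ e^{i x ξ} dμ(ξ)`. -/
def HasFourierMeasure (F : ℝ → ℂ) (μ : ComplexMeasure ℝ) : Prop :=
  ∀ x : ℝ, F x = (2 * (Real.pi : ℂ))⁻¹ *
    μ.integral (fun ξ : ℝ => Complex.exp (Complex.I * ((x * ξ : ℝ) : ℂ)))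
      (ContinuousLinearMap.mul ℝ ℂ)

/-- The total variation norm of a complex measure on the line. -/
def totalVariationNorm (μ : ComplexMeasure ℝ) : ℝ :=
  (μ.variation univ).toReal

/-- Smooth cutoff functions: `χ = 1` on `|x| < 1` and `χ = 0` on `|x| > 2`. -/
structure IsSmoothCutoff (χ : ℝ → ℝ) : Prop where
  contDiff : ContDiff ℝ ∞ χ
  eq_one : ∀ x : ℝ, |x| < 1 → χ x = 1
  eq_zero : ∀ x : ℝ, 2 < |x| → χ x = 0

/-- The improper integral of `f` over `(0, ∞)` exists and equals `I`, in the sense that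
`∫₀^∞ χ(l / R) f(l) dl → I` as `R → ∞`, for every smooth cutoff function `χ`. -/
def HasImproperIntegral (f : ℝ → ℂ) (I : ℂ) : Prop :=
  ∀ χ : ℝ → ℝ, IsSmoothCutoff χ →
    (∀ R : ℝ, 0 < R → IntegrableOn (fun l : ℝ => (χ (l / R) : ℂ) * f l) (Ioi 0)) ∧
    Tendsto (fun R : ℝ => ∫ l in Ioi (0 : ℝ), (χ (l / R) : ℂ) * f l) atTop (𝓝 I)

/-- The principal value `π⁻¹ p.v. ∫ f(y) / (x - y) dy` exists and equals `L`. -/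
def HasPrincipalValue (f : ℝ → ℂ) (x : ℝ) (L : ℂ) : Prop :=
  Tendsto (fun ε : ℝ => ((Real.pi : ℂ))⁻¹ * ∫ y in {y : ℝ | ε < |x - y|}, f y / ((x - y : ℝ) : ℂ))
    (𝓝[>] 0) (𝓝 L)

/-- The Hilbert transform `π⁻¹ p.v. ∫ f(y) / (x - y) dy` of the locally integrable function `f`
exists at the point `x` and equals `L`; the integral is a principal value at `y = x` and is improper
at infinity, where it is computed with smooth cutoff functions. -/
def HasHilbertTransformAt (f : ℝ → ℂ) (x : ℝ) (L : ℂ) : Prop :=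
  LocallyIntegrable f ∧
  ∀ χ : ℝ → ℝ, IsSmoothCutoff χ →
    ∃ p : ℝ → ℂ,
      (∀ R : ℝ, 0 < R → HasPrincipalValue (fun y : ℝ => (χ (y / R) : ℂ) * f y) x (p R)) ∧
      Tendsto p atTop (𝓝 L)

end

/-! ### Square roots of complex numbers in the right half plane -/

/-! Put `τ = t - s`. The substitution `λ = x²` turns each integral into `∫₀^∞ 2x e^{iτx²} K(x) dx`
with `K` odd, that is, into `∫ x e^{iτx²} K(x) dx` over the line. Integration by parts produces
`-1/(2iτ)` and leaves `∫ e^{iτx²} K'(x) dx`. In the first estimate `K = F_s G_a` is a superposition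
of plane waves `e^{i(ξ+ζ)x}`. Differentiation multiplies the weight by `i(ξ+ζ)`, which yields the
two products of norms, and each Fresnel integral `∫ e^{iτx²+iax} dx` has modulus `√(π/|τ|)`.
Together this gives `|τ|^{-3/2}`.

For the Hilbert transform, `η = y²` and the oddness of `G_a` give the principal value of `e^{-isy²}
G_a(y)/(x-y)` over the whole line (`hasPrincipalValue_sq`). For one wave `e^{iζy}`, folding about
`x` leaves `∫₀^∞ e^{-isu²} sin((2sx-ζ)u)/u du = (π/2) Q(2sx-ζ)`, where `Q = gaussErf (is)` is
bounded uniformly in `s` (`norm_gaussErf_le`). So the transform is `e^{-isλ} P(√λ)` with `P` an even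
superposition of the functions `i e^{iζx} Q(2sx-ζ)`; the phases combine to `e^{iτλ}`, and `K = F_a
P` is odd.

Two facts make the plane wave argument work for this `K`. When the derivative falls on `Q`,
completing the square leaves `e^{isx²}` times an even function of `ζ`, which integrates to zero
against the odd spectral density of `G_a`. And `∫ e^{iτx²+iax} Q(2sx-b) dx` is a Fresnel factor
times an error function of parameter `i(s+s²/τ)`, so it is again `O(|τ|^{-1/2})` uniformly in `s`
(`IsFourierPair.integral_mul_chirp_mul_gaussErf`). Both estimates come from
`exists_hasImproperIntegral_erfWave`, the first with `s = 0`.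

The cutoff `χ(λ/R)` becomes `g(rx)` with `g(u) = χ(u²)` and `r = R^{-1/2}`. By Parseval it only
averages over the frequencies `a + rk` with an even integrable density of total mass `g(0) = 1`, and
`r → 0` is harmless. Evenness matters because the error function of parameter `0` is the sign, which
jumps.

Finally, `HasFourierMeasure.exists_hasSpectralDensity` replaces the complex measures by densities
with a finite first moment, turning total variations into `L¹` norms. -/

lemma cpow_half_sq (z : ℂ) : (z ^ (1 / 2 : ℂ)) ^ 2 = z := by
  have := Complex.cpow_nat_inv_pow z (n := 2) two_ne_zero
  rw [one_div]
  exact_mod_cast this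

lemma norm_cpow_half (z : ℂ) : ‖z ^ (1 / 2 : ℂ)‖ = √‖z‖ := by
  rw [eq_comm, Real.sqrt_eq_iff_eq_sq (norm_nonneg _) (norm_nonneg _), ← norm_pow, cpow_half_sq]

lemma re_cpow_half_pos {z : ℂ} (hz : z ≠ 0) (h : 0 ≤ z.re) : 0 < (z ^ (1 / 2 : ℂ)).re := by
  rw [Complex.cpow_def_of_ne_zero hz, Complex.exp_re]
  apply mul_pos (Real.exp_pos _)
  have h1 := Complex.abs_arg_le_pi_div_two_iff.2 h
  rw [abs_le] at h1
  have h2 : (Complex.log z * (1 / 2)).im = z.arg / 2 := by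
    simp [Complex.mul_im, Complex.log_im]; ring
  rw [h2]
  apply Real.cos_pos_of_mem_Ioo
  constructor <;> linarith [Real.pi_pos]

lemma abs_im_cpow_half_le {z : ℂ} (h : 0 ≤ z.re) :
    (z ^ (1 / 2 : ℂ)).im ^ 2 ≤ (z ^ (1 / 2 : ℂ)).re ^ 2 := by
  have := congrArg Complex.re (cpow_half_sq z)
  rw [sq, Complex.mul_re] at this
  nlinarith

lemma abs_im_cpow_half_lt {z : ℂ} (h : 0 < z.re) :
    (z ^ (1 / 2 : ℂ)).im ^ 2 < (z ^ (1 / 2 : ℂ)).re ^ 2 := by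
  have := congrArg Complex.re (cpow_half_sq z)
  rw [sq, Complex.mul_re] at this
  nlinarith

/-- The principal square root is multiplicative on the right half plane. -/
lemma re_cpow_half_mul_pos {z w : ℂ} (hz : 0 < z.re) (hw : w ≠ 0) (hw' : 0 ≤ w.re) :
    0 < (z ^ (1 / 2 : ℂ) * w ^ (1 / 2 : ℂ)).re := by
  have hz0 : z ≠ 0 := by rintro rfl; simp at hz
  have h1 := re_cpow_half_pos hz0 hz.le
  have h2 := re_cpow_half_pos hw hw'
  have h3 := sq_lt_sq.1 (abs_im_cpow_half_lt hz)
  have h4 := sq_le_sq.1 (abs_im_cpow_half_le hw')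
  rw [abs_of_pos h1] at h3
  rw [abs_of_pos h2] at h4
  rw [Complex.mul_re, sub_pos]
  calc _ ≤ |(z ^ (1 / 2 : ℂ)).im| * |(w ^ (1 / 2 : ℂ)).im| := by
        rw [← abs_mul]; exact le_abs_self _
    _ < _ := mul_lt_mul_of_lt_of_le_of_nonneg_of_pos h3 h4 (abs_nonneg _) h2

lemma eq_of_sq_eq_of_re_pos {z w : ℂ} (h : z ^ 2 = w ^ 2) (hz : 0 < z.re) (hw : 0 < w.re) :
    z = w := by
  rcases sq_eq_sq_iff_eq_or_eq_neg.1 h with h | h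
  · exact h
  · rw [h, Complex.neg_re] at hz; linarith

/-- Gaussian prefactors appear as products of principal roots. In each product one root has argument
below `π/4` and the other at most `π/4` in modulus, so both products lie in the open right half
plane, where a square determines its root. -/
lemma cpow_half_mul_eq {z w z' w' : ℂ} (h : z * w = z' * w') (hz : 0 < z.re) (hw : w ≠ 0)
    (hw0 : 0 ≤ w.re) (hz' : 0 < z'.re) (hw' : w' ≠ 0) (hw0' : 0 ≤ w'.re) :
    z ^ (1 / 2 : ℂ) * w ^ (1 / 2 : ℂ) = z' ^ (1 / 2 : ℂ) * w' ^ (1 / 2 : ℂ) := by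
  apply eq_of_sq_eq_of_re_pos _ (re_cpow_half_mul_pos hz hw hw0) (re_cpow_half_mul_pos hz' hw' hw0')
  simp only [mul_pow, cpow_half_sq, h]

lemma re_inv_nonneg {z : ℂ} (h : 0 ≤ z.re) : 0 ≤ (z⁻¹).re := by
  rw [Complex.inv_re]; exact div_nonneg h (Complex.normSq_nonneg _)

lemma re_inv_pos {z : ℂ} (h : 0 < z.re) : 0 < (z⁻¹).re := by
  rw [Complex.inv_re]
  exact div_pos h (Complex.normSq_pos.2 (by rintro rfl; simp at h))

lemma re_pi_div_nonneg {z : ℂ} (h : 0 ≤ z.re) : 0 ≤ ((Real.pi : ℂ) / z).re := by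
  rw [div_eq_mul_inv, Complex.re_ofReal_mul]
  exact mul_nonneg Real.pi_pos.le (re_inv_nonneg h)

lemma re_pi_div_pos {z : ℂ} (h : 0 < z.re) : 0 < ((Real.pi : ℂ) / z).re := by
  rw [div_eq_mul_inv, Complex.re_ofReal_mul]
  exact mul_pos Real.pi_pos (re_inv_pos h)

/-! ### Incomplete Gaussian integrals -/

lemma norm_cexp_neg_mul_sq_le_one {z : ℂ} (hz : 0 ≤ z.re) (w : ℝ) :
    ‖Complex.exp (-z * (w : ℂ) ^ 2)‖ ≤ 1 := by
  rw [norm_cexp_neg_mul_sq]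
  apply Real.exp_le_one_iff.2
  nlinarith [sq_nonneg w]

/-- Up to `c = |z|^{-1/2}` the integrand is at most `1`; beyond `c`, integration by parts against
`1/(2zw)` leaves three terms of size at most `c/2`. Only `|z|` enters, so the bound persists on the
imaginary axis, where the integrand does not decay. -/
lemma norm_integral_cexp_neg_mul_sq_le_of_pos {z : ℂ} (hz : 0 ≤ z.re) (hz0 : z ≠ 0) {b : ℝ}
    (hb : 0 ≤ b) :
    ‖∫ w in (0 : ℝ)..b, Complex.exp (-z * (w : ℂ) ^ 2)‖ ≤ 3 / √‖z‖ := by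
  have hn : 0 < ‖z‖ := norm_pos_iff.2 hz0
  set c : ℝ := 1 / √‖z‖ with hc
  have hs : 0 < √‖z‖ := Real.sqrt_pos.2 hn
  have hcp : 0 < c := by positivity
  have hcz : ‖z‖ * c = √‖z‖ := by
    rw [hc, mul_one_div, div_eq_iff hs.ne', Real.mul_self_sqrt hn.le]
  have hint : ∀ a b : ℝ, IntervalIntegrable (fun w : ℝ => Complex.exp (-z * (w : ℂ) ^ 2))
      volume a b := fun a b => (by fun_prop : Continuous _).intervalIntegrable _ _
  have hsmall : ∀ b, 0 ≤ b → ‖∫ w in (0 : ℝ)..b, Complex.exp (-z * (w : ℂ) ^ 2)‖ ≤ b := by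
    intro b hb
    have := intervalIntegral.norm_integral_le_of_norm_le_const (a := 0) (b := b) (C := 1)
      (f := fun w : ℝ => Complex.exp (-z * (w : ℂ) ^ 2))
      (fun x _ => norm_cexp_neg_mul_sq_le_one hz x)
    simpa [abs_of_nonneg hb] using this
  rcases le_total b c with hbc | hbc
  · calc _ ≤ b := hsmall b hb
      _ ≤ c := hbc
      _ ≤ _ := by rw [hc]; gcongr; norm_num
  · rw [← intervalIntegral.integral_add_adjacent_intervals (hint 0 c) (hint c b)]
    have hderiv : ∀ x ∈ uIcc c b, HasDerivAt
        (fun w : ℝ => -Complex.exp (-z * (w : ℂ) ^ 2) / (2 * z * w))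
        (Complex.exp (-z * (x : ℂ) ^ 2) + Complex.exp (-z * (x : ℂ) ^ 2) / (2 * z * x ^ 2)) x := by
      intro x hx
      rw [uIcc_of_le hbc] at hx
      have hx0 : (x : ℂ) ≠ 0 := by exact_mod_cast (hcp.trans_le hx.1).ne'
      have h1 : HasDerivAt (fun w : ℝ => (w : ℂ)) 1 x := Complex.ofRealCLM.hasDerivAt
      have h2 := ((((h1.pow 2).const_mul (-z)).cexp).neg).div (h1.const_mul (2 * z))
        (by simp [hz0, hx0])
      convert! h2 using 1
      simp only [Pi.pow_apply, Pi.neg_apply]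
      field_simp
      ring
    have hc2 : ContinuousOn (fun x : ℝ => Complex.exp (-z * (x : ℂ) ^ 2) / (2 * z * x ^ 2))
        (uIcc c b) := by
      apply ContinuousOn.div (by fun_prop) (by fun_prop)
      intro x hx
      rw [uIcc_of_le hbc] at hx
      have hx0 : (x : ℂ) ≠ 0 := by exact_mod_cast (hcp.trans_le hx.1).ne'
      simp [hz0, hx0]
    have key := intervalIntegral.integral_eq_sub_of_hasDerivAt hderiv
      ((hint c b).add hc2.intervalIntegrable)
    rw [intervalIntegral.integral_add (hint c b) hc2.intervalIntegrable] at key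
    have hb1 : ∀ x : ℝ, 0 < x →
        ‖-Complex.exp (-z * (x : ℂ) ^ 2) / (2 * z * x)‖ ≤ 1 / (2 * ‖z‖ * x) := by
      intro x hx
      rw [norm_div, norm_neg, norm_mul, norm_mul, Complex.norm_real, Real.norm_of_nonneg hx.le,
        Complex.norm_two]
      gcongr
      exact norm_cexp_neg_mul_sq_le_one hz x
    have hb2 : ‖∫ x in c..b, Complex.exp (-z * (x : ℂ) ^ 2) / (2 * z * x ^ 2)‖ ≤
        1 / (2 * ‖z‖ * c) := by
      have hd : ∀ x ∈ uIcc c b, HasDerivAt (fun x : ℝ => -(1 / (2 * ‖z‖)) * x⁻¹)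
          (1 / (2 * ‖z‖) * (1 / x ^ 2)) x := by
        intro x hx
        rw [uIcc_of_le hbc] at hx
        have hx0 : x ≠ 0 := (hcp.trans_le hx.1).ne'
        have := (hasDerivAt_inv hx0).const_mul (-(1 / (2 * ‖z‖)))
        convert! this using 1
        field_simp
      have hi : IntervalIntegrable (fun x : ℝ => 1 / (2 * ‖z‖) * (1 / x ^ 2)) volume c b := by
        apply ContinuousOn.intervalIntegrable
        apply ContinuousOn.mul continuousOn_const
        apply ContinuousOn.div (by fun_prop) (by fun_prop)
        intro x hx
        rw [uIcc_of_le hbc] at hx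
        have hx0 : x ≠ 0 := (hcp.trans_le hx.1).ne'
        positivity
      have h1 := intervalIntegral.norm_integral_le_of_norm_le hbc
        (f := fun x : ℝ => Complex.exp (-z * (x : ℂ) ^ 2) / (2 * z * x ^ 2))
        (Eventually.of_forall fun x hx => ?_) hi
      · refine h1.trans ?_
        rw [intervalIntegral.integral_eq_sub_of_hasDerivAt hd hi]
        have : 0 ≤ 1 / (2 * ‖z‖) * b⁻¹ := by positivity
        have h3 : 1 / (2 * ‖z‖ * c) = 1 / (2 * ‖z‖) * c⁻¹ := by field_simp
        rw [h3]; linarith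
      · have hx0 : 0 < x := hcp.trans hx.1
        rw [norm_div, norm_mul, norm_mul, norm_pow, Complex.norm_real, Real.norm_of_nonneg hx0.le,
          Complex.norm_two, one_div_mul_one_div]
        gcongr
        exact norm_cexp_neg_mul_sq_le_one hz x
    have hb3 : 1 / (2 * ‖z‖ * b) ≤ 1 / (2 * ‖z‖ * c) := by gcongr
    have hb4 : 1 / (2 * ‖z‖ * c) = c / 2 := by
      rw [mul_assoc, hcz, hc]; field_simp
    have e : ∫ x in c..b, Complex.exp (-z * (x : ℂ) ^ 2) =
        -Complex.exp (-z * (b : ℂ) ^ 2) / (2 * z * b) - -Complex.exp (-z * (c : ℂ) ^ 2) / (2 * z * c)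
        - ∫ x in c..b, Complex.exp (-z * (x : ℂ) ^ 2) / (2 * z * x ^ 2) := by
      rw [← key]; ring
    have h5 : ‖∫ x in c..b, Complex.exp (-z * (x : ℂ) ^ 2)‖ ≤ c / 2 + c / 2 + c / 2 := by
      rw [e]
      refine (norm_sub_le _ _).trans (add_le_add ((norm_sub_le _ _).trans (add_le_add ?_ ?_)) ?_)
      · exact (hb1 b (hcp.trans_le hbc)).trans (hb3.trans hb4.le)
      · exact (hb1 c hcp).trans hb4.le
      · exact hb2.trans hb4.le
    have h6 : 3 / √‖z‖ = 3 * c := by rw [hc]; ring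
    rw [h6]
    refine (norm_add_le _ _).trans ?_
    linarith [hsmall c hcp.le]

lemma integral_cexp_neg_mul_sq_neg (z : ℂ) (b : ℝ) :
    ∫ w in (0 : ℝ)..(-b), Complex.exp (-z * (w : ℂ) ^ 2) =
      -∫ w in (0 : ℝ)..b, Complex.exp (-z * (w : ℂ) ^ 2) := by
  have := intervalIntegral.integral_comp_neg (a := 0) (b := b)
    (fun w : ℝ => Complex.exp (-z * (w : ℂ) ^ 2))
  simp only [Complex.ofReal_neg, neg_sq, neg_zero] at this
  rw [this, intervalIntegral.integral_symm]

lemma norm_integral_cexp_neg_mul_sq_le {z : ℂ} (hz : 0 ≤ z.re) (hz0 : z ≠ 0) (b : ℝ) :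
    ‖∫ w in (0 : ℝ)..b, Complex.exp (-z * (w : ℂ) ^ 2)‖ ≤ 3 / √‖z‖ := by
  rcases le_total 0 b with hb | hb
  · exact norm_integral_cexp_neg_mul_sq_le_of_pos hz hz0 hb
  · have := norm_integral_cexp_neg_mul_sq_le_of_pos hz hz0 (neg_nonneg.2 hb)
    rwa [integral_cexp_neg_mul_sq_neg, norm_neg] at this

/-! ### The error function with complex parameter -/

/-- The error function `(π p)^{-1/2} ∫₀ᵇ exp (-w² / 4p) dw`, which for `p = 0` is the sign of `b`. -/
noncomputable def gaussErf (p : ℂ) (b : ℝ) : ℂ :=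
  if p = 0 then ((Real.sign b : ℝ) : ℂ) else
    (Real.pi : ℂ)⁻¹ * (Real.pi / p) ^ (1 / 2 : ℂ) *
      ∫ w in (0 : ℝ)..b, Complex.exp (-(1 / (4 * p)) * (w : ℂ) ^ 2)

/-- The derivative of `gaussErf` for `p ≠ 0`. -/
noncomputable def gaussErfDeriv (p : ℂ) (b : ℝ) : ℂ :=
  (Real.pi : ℂ)⁻¹ * (Real.pi / p) ^ (1 / 2 : ℂ) * Complex.exp (-(1 / (4 * p)) * (b : ℂ) ^ 2)

lemma gaussErf_zero_left (b : ℝ) : gaussErf 0 b = ((Real.sign b : ℝ) : ℂ) := if_pos rfl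

lemma gaussErf_of_ne {p : ℂ} (hp : p ≠ 0) (b : ℝ) :
    gaussErf p b = (Real.pi : ℂ)⁻¹ * (Real.pi / p) ^ (1 / 2 : ℂ) *
      ∫ w in (0 : ℝ)..b, Complex.exp (-(1 / (4 * p)) * (w : ℂ) ^ 2) := if_neg hp

lemma gaussErf_neg (p : ℂ) (b : ℝ) : gaussErf p (-b) = -gaussErf p b := by
  by_cases hp : p = 0
  · subst hp; simp [gaussErf_zero_left, Real.sign_neg]
  · rw [gaussErf_of_ne hp, gaussErf_of_ne hp, integral_cexp_neg_mul_sq_neg, mul_neg]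

lemma gaussErf_zero_right (p : ℂ) : gaussErf p 0 = 0 := by
  by_cases hp : p = 0
  · subst hp; simp [gaussErf_zero_left]
  · simp [gaussErf_of_ne hp]

lemma re_one_div_four_mul_nonneg {p : ℂ} (hp : 0 ≤ p.re) : 0 ≤ (1 / (4 * p)).re := by
  rw [one_div]; apply re_inv_nonneg; simpa using hp

lemma re_one_div_four_mul_pos {p : ℂ} (hp : 0 < p.re) : 0 < (1 / (4 * p)).re := by
  rw [one_div]; apply re_inv_pos; simpa using hp

/-- The prefactor `π⁻¹ √(π/|p|)` cancels the `|p|` in the bound `3 √(4|p|)` for the incomplete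
integral, leaving `6/√π`. Uniformity in `p` is what makes the final constant independent of `s`. -/
lemma norm_gaussErf_le {p : ℂ} (hp : 0 ≤ p.re) (b : ℝ) : ‖gaussErf p b‖ ≤ 6 := by
  by_cases h0 : p = 0
  · subst h0
    rw [gaussErf_zero_left, Complex.norm_real]
    rcases Real.sign_apply_eq b with h | h | h <;> rw [h] <;> norm_num
  · rw [gaussErf_of_ne h0, norm_mul, norm_mul, norm_cpow_half, norm_inv, Complex.norm_real,
      Real.norm_of_nonneg Real.pi_pos.le]
    have h1 := norm_integral_cexp_neg_mul_sq_le (re_one_div_four_mul_nonneg hp)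
      (by simpa using h0) b
    have hn : 0 < ‖p‖ := norm_pos_iff.2 h0
    have h2 : (3 : ℝ) / √‖1 / (4 * p)‖ = 3 * √(4 * ‖p‖) := by
      rw [norm_div, norm_mul, norm_one, Real.sqrt_div zero_le_one, Real.sqrt_one,
        div_div_eq_mul_div, div_one, Complex.norm_ofNat]
    rw [h2] at h1
    have h3 : √‖(Real.pi : ℂ) / p‖ = √Real.pi / √‖p‖ := by
      rw [norm_div, Real.sqrt_div (norm_nonneg _), Complex.norm_real,
        Real.norm_of_nonneg Real.pi_pos.le]
    have h4 : √(4 * ‖p‖) = 2 * √‖p‖ := by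
      rw [Real.sqrt_mul (by norm_num), show (4 : ℝ) = 2 ^ 2 by norm_num,
        Real.sqrt_sq (by norm_num)]
    have hs : 0 < √‖p‖ := Real.sqrt_pos.2 hn
    have hpi : √Real.pi ≤ Real.pi := by
      rw [Real.sqrt_le_left Real.pi_pos.le]; nlinarith [Real.pi_gt_three]
    rw [h3]
    calc _ ≤ Real.pi⁻¹ * (√Real.pi / √‖p‖) * (3 * √(4 * ‖p‖)) := by gcongr
      _ = 6 * (√Real.pi / Real.pi) := by rw [h4]; field_simp; ring
      _ ≤ 6 * 1 := by gcongr; exact div_le_one_of_le₀ hpi Real.pi_pos.le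
      _ = 6 := by ring

lemma hasDerivAt_gaussErf {p : ℂ} (hp : p ≠ 0) (b : ℝ) :
    HasDerivAt (gaussErf p) (gaussErfDeriv p b) b := by
  have hc : Continuous fun w : ℝ => Complex.exp (-(1 / (4 * p)) * (w : ℂ) ^ 2) := by fun_prop
  have := (hc.integral_hasStrictDerivAt 0 b).hasDerivAt.const_mul
    ((Real.pi : ℂ)⁻¹ * (Real.pi / p) ^ (1 / 2 : ℂ))
  exact this.congr_of_eventuallyEq (Eventually.of_forall fun x => gaussErf_of_ne hp x)

lemma continuous_gaussErf {p : ℂ} (hp : p ≠ 0) : Continuous (gaussErf p) :=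
  continuous_iff_continuousAt.2 fun b => (hasDerivAt_gaussErf hp b).continuousAt

lemma measurable_gaussErf (p : ℂ) : Measurable (gaussErf p) := by
  by_cases h0 : p = 0
  · subst h0
    have : gaussErf 0 = fun b => ((Real.sign b : ℝ) : ℂ) := funext gaussErf_zero_left
    rw [this]
    apply Complex.measurable_ofReal.comp
    unfold Real.sign
    exact Measurable.ite measurableSet_Iio measurable_const
      (Measurable.ite measurableSet_Ioi measurable_const measurable_const)
  · exact (continuous_gaussErf h0).measurable

lemma norm_gaussErfDeriv_le {p : ℂ} (hp : 0 ≤ p.re) (b : ℝ) :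
    ‖gaussErfDeriv p b‖ ≤ ‖(Real.pi : ℂ)⁻¹ * (Real.pi / p) ^ (1 / 2 : ℂ)‖ := by
  rw [gaussErfDeriv, norm_mul]
  exact mul_le_of_le_one_right (norm_nonneg _)
    (norm_cexp_neg_mul_sq_le_one (re_one_div_four_mul_nonneg hp) b)

lemma continuous_gaussErfDeriv (p : ℂ) : Continuous (gaussErfDeriv p) := by
  unfold gaussErfDeriv; fun_prop

/-- The prefactor in `gaussErf` is the reciprocal of the half-line Gaussian integral; the product of
the two roots involved is recognised by its square. -/
lemma tendsto_gaussErf_atTop {p : ℂ} (hp : 0 < p.re) :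
    Tendsto (gaussErf p) atTop (𝓝 1) := by
  have h0 : p ≠ 0 := by rintro rfl; simp at hp
  have hz := re_one_div_four_mul_pos hp
  have h1 := intervalIntegral_tendsto_integral_Ioi (0 : ℝ)
    (integrable_cexp_neg_mul_sq hz).integrableOn tendsto_id
  rw [integral_gaussian_complex_Ioi hz] at h1
  have h2 := h1.const_mul ((Real.pi : ℂ)⁻¹ * (Real.pi / p) ^ (1 / 2 : ℂ))
  have h3 : (Real.pi / p : ℂ) ^ (1 / 2 : ℂ) * (Real.pi / (1 / (4 * p))) ^ (1 / 2 : ℂ) =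
      2 * Real.pi := by
    have hne : (Real.pi / (1 / (4 * p)) : ℂ) ≠ 0 := by simp [h0, Real.pi_ne_zero]
    have hq := re_pi_div_pos hz
    apply eq_of_sq_eq_of_re_pos _ (re_cpow_half_mul_pos (re_pi_div_pos hp) hne hq.le)
    · simpa using Real.pi_pos
    · rw [mul_pow, cpow_half_sq, cpow_half_sq]; field_simp; ring
  have h4 : (Real.pi : ℂ)⁻¹ * (Real.pi / p) ^ (1 / 2 : ℂ) *
      ((Real.pi / (1 / (4 * p))) ^ (1 / 2 : ℂ) / 2) = 1 := by
    have hpi : (Real.pi : ℂ) ≠ 0 := by exact_mod_cast Real.pi_ne_zero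
    calc _ = (Real.pi : ℂ)⁻¹ * ((Real.pi / p : ℂ) ^ (1 / 2 : ℂ) *
        (Real.pi / (1 / (4 * p))) ^ (1 / 2 : ℂ)) / 2 := by ring
      _ = 1 := by rw [h3]; field_simp
  rw [h4] at h2
  exact h2.congr fun b => (gaussErf_of_ne h0 b).symm

lemma tendsto_gaussErf_atBot {p : ℂ} (hp : 0 < p.re) :
    Tendsto (gaussErf p) atBot (𝓝 (-1)) := by
  have := (tendsto_gaussErf_atTop hp).neg.comp tendsto_neg_atBot_atTop
  exact this.congr fun b => by simp [gaussErf_neg]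

/-- Scaling for real parameters. -/
lemma gaussErf_ofReal {δ : ℝ} (hδ : 0 < δ) (b : ℝ) : gaussErf δ b = gaussErf 1 (b / √δ) := by
  have hs : 0 < √δ := Real.sqrt_pos.2 hδ
  have hsc : (√δ : ℂ) ≠ 0 := by exact_mod_cast hs.ne'
  have hd : (δ : ℂ) ≠ 0 := by exact_mod_cast hδ.ne'
  have hsq : (√δ : ℂ) ^ 2 = δ := by exact_mod_cast Real.sq_sqrt hδ.le
  rw [gaussErf_of_ne hd, gaussErf_of_ne one_ne_zero]
  have h1 := intervalIntegral.integral_comp_div (a := 0) (b := b)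
    (fun w : ℝ => Complex.exp (-(1 / (4 * (1 : ℂ))) * (w : ℂ) ^ 2)) hs.ne'
  rw [zero_div] at h1
  have h2 : ∀ w : ℝ, Complex.exp (-(1 / (4 * (1 : ℂ))) * ((w / √δ : ℝ) : ℂ) ^ 2) =
      Complex.exp (-(1 / (4 * (δ : ℂ))) * (w : ℂ) ^ 2) := by
    intro w
    congr 1
    push_cast
    rw [div_pow, hsq]; field_simp
  simp only [h2] at h1
  rw [h1, Complex.real_smul, ← mul_assoc]
  congr 1
  rw [mul_assoc]
  congr 1
  have hp1 : 0 < ((Real.pi : ℂ) / δ).re := re_pi_div_pos (by simpa using hδ)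
  apply eq_of_sq_eq_of_re_pos
  · rw [mul_pow, cpow_half_sq, cpow_half_sq, hsq]; field_simp
  · rw [mul_comm, Complex.re_ofReal_mul]
    refine mul_pos hs (re_cpow_half_pos ?_ hp1.le)
    intro h; rw [h] at hp1; simp at hp1
  · apply re_cpow_half_pos <;> simp [Real.pi_ne_zero, Real.pi_pos.le]

/-- Continuity of the error function in the parameter from within the right half plane, on
horizontal lines. -/
lemma tendsto_gaussErf_param (σ b : ℝ) :
    Tendsto (fun δ : ℝ => gaussErf (δ + Complex.I * σ) b) (𝓝[>] 0)
      (𝓝 (gaussErf (Complex.I * σ) b)) := by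
  -- At `σ = 0` the parameter itself tends to `0`; scaling moves it into the argument `b/√δ`, which
  -- tends to `±∞` or stays `0`, and the sign function appears.
  by_cases hσ : σ = 0
  · subst hσ
    simp only [Complex.ofReal_zero, mul_zero, add_zero]
    have hev : (fun δ : ℝ => gaussErf 1 (b / √δ)) =ᶠ[𝓝[>] 0] fun δ : ℝ => gaussErf δ b := by
      filter_upwards [self_mem_nhdsWithin] with δ hδ
      exact (gaussErf_ofReal hδ b).symm
    refine Tendsto.congr' hev ?_
    have hinv : Tendsto (fun δ : ℝ => (√δ)⁻¹) (𝓝[>] 0) atTop := by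
      apply tendsto_inv_nhdsGT_zero.comp
      apply tendsto_nhdsWithin_of_tendsto_nhds_of_eventually_within
      · have : Tendsto Real.sqrt (𝓝 0) (𝓝 (√0)) := Real.continuous_sqrt.continuousAt
        rw [Real.sqrt_zero] at this
        exact this.mono_left nhdsWithin_le_nhds
      · filter_upwards [self_mem_nhdsWithin] with δ hδ
        exact Real.sqrt_pos.2 hδ
    have h1re : (0 : ℝ) < (1 : ℂ).re := by simp
    rcases lt_trichotomy b 0 with hb | hb | hb
    · rw [gaussErf_zero_left, Real.sign_of_neg hb]
      push_cast
      exact (tendsto_gaussErf_atBot h1re).comp (hinv.const_mul_atTop_of_neg hb)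
    · subst hb
      simp [gaussErf_zero_right]
    · rw [gaussErf_zero_left, Real.sign_of_pos hb]
      push_cast
      exact (tendsto_gaussErf_atTop h1re).comp (hinv.const_mul_atTop hb)
  · have hσ' : (Complex.I * σ : ℂ) ≠ 0 := by simp [hσ]
    have hcont : Tendsto (fun δ : ℝ => (δ + Complex.I * σ : ℂ)) (𝓝[>] 0) (𝓝 (Complex.I * σ)) := by
      have : Continuous fun δ : ℝ => (δ + Complex.I * σ : ℂ) := by fun_prop
      have := this.tendsto 0
      simp only [Complex.ofReal_zero, zero_add] at this
      exact this.mono_left nhdsWithin_le_nhds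
    have hne : ∀ᶠ δ : ℝ in 𝓝[>] 0, (δ + Complex.I * σ : ℂ) ≠ 0 :=
      Eventually.of_forall fun δ h => hσ (by simpa using congrArg Complex.im h)
    rw [gaussErf_of_ne hσ']
    refine Tendsto.congr' (hne.mono fun δ hδ => (gaussErf_of_ne hδ b).symm) ?_
    refine Tendsto.mul (tendsto_const_nhds.mul ?_) ?_
    · refine (Tendsto.div tendsto_const_nhds hcont hσ').cpow tendsto_const_nhds ?_
      -- The base `π/(iσ)` has nonzero imaginary part, so it avoids the branch cut of the root.
      right
      have : ((Real.pi : ℂ) / (Complex.I * σ)).im = -(Real.pi / σ) := by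
        rw [mul_comm, ← div_div, Complex.div_I]
        simp [← Complex.ofReal_div]
      rw [this]
      simp [hσ, Real.pi_ne_zero]
    · apply intervalIntegral.tendsto_integral_filter_of_dominated_convergence (fun _ => 1)
      · exact Eventually.of_forall fun δ => by fun_prop
      · filter_upwards [self_mem_nhdsWithin] with δ hδ
        refine Eventually.of_forall fun x _ => norm_cexp_neg_mul_sq_le_one
          (re_one_div_four_mul_nonneg ?_) x
        simpa using (le_of_lt hδ : (0 : ℝ) ≤ δ)
      · simp
      · refine Eventually.of_forall fun x _ => ?_
        refine (Complex.continuous_exp.tendsto _).comp ?_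
        refine Tendsto.mul_const _ (Tendsto.neg ?_)
        exact Tendsto.div tendsto_const_nhds (hcont.const_mul 4) (by simpa using hσ)

/-! ### Gaussian integrals with quadratic phases -/

/-- The function `x ↦ exp (i (τ x² + ξ x))`. -/
noncomputable def chirp (τ ξ x : ℝ) : ℂ := Complex.exp (Complex.I * ((τ * x ^ 2 + ξ * x : ℝ) : ℂ))

lemma norm_chirp (τ ξ x : ℝ) : ‖chirp τ ξ x‖ = 1 := Complex.norm_exp_I_mul_ofReal _

lemma chirp_mul_chirp (τ ξ τ' ξ' x : ℝ) :
    chirp τ ξ x * chirp τ' ξ' x = chirp (τ + τ') (ξ + ξ') x := by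
  simp only [chirp, ← Complex.exp_add]
  congr 1; push_cast; ring

lemma chirp_scale (k r x : ℝ) : chirp 0 k (r * x) = chirp 0 (r * k) x := by
  simp only [chirp]
  congr 1; push_cast; ring

lemma continuous_chirp (τ ξ : ℝ) : Continuous (chirp τ ξ) := by unfold chirp; fun_prop

/-- The Fourier transform of the Gaussian `exp (-a x²)`. -/
noncomputable def gaussFT (a : ℂ) (ξ : ℝ) : ℂ :=
  (Real.pi / a) ^ (1 / 2 : ℂ) * Complex.exp (-(1 / (4 * a)) * (ξ : ℂ) ^ 2)

lemma norm_gaussFT_le {a : ℂ} (ha : 0 ≤ a.re) (ξ : ℝ) :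
    ‖gaussFT a ξ‖ ≤ √(Real.pi / ‖a‖) := by
  rw [gaussFT, norm_mul, norm_cpow_half, norm_div, Complex.norm_real,
    Real.norm_of_nonneg Real.pi_pos.le]
  exact mul_le_of_le_one_right (Real.sqrt_nonneg _)
    (norm_cexp_neg_mul_sq_le_one (re_one_div_four_mul_nonneg ha) ξ)

lemma continuous_gaussFT (a : ℂ) : Continuous (gaussFT a) := by unfold gaussFT; fun_prop

lemma integral_chirp_mul_gaussian (τ ξ : ℝ) {ε : ℝ} (hε : 0 < ε) :
    ∫ x : ℝ, chirp τ ξ x * Complex.exp (-(ε : ℂ) * (x : ℂ) ^ 2) =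
      gaussFT (ε - Complex.I * τ) ξ := by
  have hb : (-(ε - Complex.I * τ) : ℂ).re < 0 := by simp [hε]
  have h := integral_cexp_quadratic hb (Complex.I * ξ) 0
  rw [neg_neg] at h
  rw [gaussFT]
  convert h using 1
  · congr 1; ext x
    rw [chirp, ← Complex.exp_add]
    congr 1; push_cast; ring
  · congr 2
    have hne : (ε - Complex.I * τ : ℂ) ≠ 0 := by
      intro h0; rw [h0] at hb; simp at hb
    rw [mul_pow, Complex.I_sq]
    field_simp
    ring

/-- Completing the square in disguise: `N = τp + is²` is the common numerator of the quadratic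
coefficient `iN/p` and of the shifted parameter `N/τ = p + is²/τ`. -/
lemma gaussian_exponent_identity {p τ s i ζ ξ : ℂ} (hp : p ≠ 0) (hτ : τ ≠ 0) (hi : i ^ 2 = -1)
    (hN : τ * p + i * s ^ 2 ≠ 0) :
    -ζ ^ 2 / (4 * p) - (i * ξ + s * ζ / p) ^ 2 / (4 * (i * (τ * p + i * s ^ 2) / p)) =
      -(1 / (4 * -(i * τ))) * ξ ^ 2 +
        -(1 / (4 * ((τ * p + i * s ^ 2) / τ))) * (-(ξ * s / τ) - ζ) ^ 2 := by
  have hi0 : i ≠ 0 := by rintro rfl; norm_num at hi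
  obtain ⟨N, hNe⟩ : ∃ N, N = τ * p + i * s ^ 2 := ⟨_, rfl⟩
  rw [← hNe] at hN ⊢
  field_simp
  rw [hNe]
  linear_combination (-(τ * ζ ^ 2 * s ^ 2 + τ * ξ ^ 2 * p ^ 2)) * hi

/-- Both factors are Gaussian in `x`, so the integral is explicit. Regrouping exponent and roots
separates a Fresnel factor in `ξ` from a Gaussian in `ζ`; the whole effect of the chirp on the error
function is the parameter shift by `is²/τ`. -/
lemma integral_chirp_mul_gaussErfDeriv {p : ℂ} (hp : 0 < p.re) {τ s : ℝ} (hτ : τ ≠ 0)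
    (hs : s ≠ 0) (ξ ζ : ℝ) :
    ∫ x : ℝ, chirp τ ξ x * gaussErfDeriv p (2 * s * x - ζ) =
      gaussFT (-(Complex.I * τ)) ξ *
        gaussErfDeriv (p + Complex.I * (s ^ 2 / τ : ℝ)) (-(ξ * s / τ) - ζ) := by
  have hp0 : p ≠ 0 := by rintro rfl; simp at hp
  have hb : (Complex.I * τ - s ^ 2 / p : ℂ).re < 0 := by
    have : (s ^ 2 / p : ℂ).re = s ^ 2 * (p⁻¹).re := by
      rw [div_eq_mul_inv, ← Complex.ofReal_pow, Complex.re_ofReal_mul]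
    rw [Complex.sub_re, this]
    have := mul_pos (pow_pos (abs_pos.2 hs) 2) (re_inv_pos hp)
    rw [sq_abs] at this
    simp only [Complex.mul_re, Complex.I_re, Complex.I_im, Complex.ofReal_re, Complex.ofReal_im]
    linarith
  have hτ' : (τ : ℂ) ≠ 0 := by exact_mod_cast hτ
  have hp' : 0 < (p + Complex.I * (s ^ 2 / τ : ℝ) : ℂ).re := by
    rw [Complex.add_re, Complex.mul_re, Complex.I_im, Complex.ofReal_im, Complex.I_re, zero_mul,
      mul_zero, sub_zero, add_zero]
    exact hp
  have hp'0 : (p + Complex.I * (s ^ 2 / τ : ℝ) : ℂ) ≠ 0 := by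
    intro h; rw [h] at hp'; simp at hp'
  have hbne : (Complex.I * τ - s ^ 2 / p : ℂ) ≠ 0 := by
    intro h; rw [h] at hb; simp at hb
  have hN : (τ * p + Complex.I * s ^ 2 : ℂ) ≠ 0 := by
    intro h; apply hp'0
    push_cast
    field_simp
    rw [mul_comm p, h, mul_zero]
  have hbe : (Complex.I * τ - s ^ 2 / p : ℂ) = Complex.I * (τ * p + Complex.I * s ^ 2) / p := by
    field_simp
    linear_combination (-(s : ℂ) ^ 2) * Complex.I_sq
  have hpe : (p + Complex.I * (s ^ 2 / τ : ℝ) : ℂ) = (τ * p + Complex.I * s ^ 2) / τ := by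
    push_cast; field_simp
  have h := integral_cexp_quadratic hb (Complex.I * ξ + s * ζ / p) (-(ζ : ℂ) ^ 2 / (4 * p))
  have h1 : ∀ x : ℝ, chirp τ ξ x * gaussErfDeriv p (2 * s * x - ζ) =
      (Real.pi : ℂ)⁻¹ * (Real.pi / p) ^ (1 / 2 : ℂ) *
        Complex.exp ((Complex.I * τ - s ^ 2 / p) * x ^ 2 + (Complex.I * ξ + s * ζ / p) * x +
          -(ζ : ℂ) ^ 2 / (4 * p)) := by
    intro x
    rw [chirp, gaussErfDeriv, mul_left_comm, ← Complex.exp_add]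
    congr 2; push_cast; field_simp; ring
  simp only [h1]
  rw [integral_const_mul, h, gaussFT, gaussErfDeriv]
  have hroot : (Real.pi / p : ℂ) ^ (1 / 2 : ℂ) *
      (Real.pi / -(Complex.I * τ - s ^ 2 / p)) ^ (1 / 2 : ℂ) =
      (Real.pi / (p + Complex.I * (s ^ 2 / τ : ℝ)) : ℂ) ^ (1 / 2 : ℂ) *
        (Real.pi / -(Complex.I * τ)) ^ (1 / 2 : ℂ) := by
    have hpi : (Real.pi : ℂ) ≠ 0 := by exact_mod_cast Real.pi_ne_zero
    apply cpow_half_mul_eq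
    · rw [hbe, hpe]
      field_simp
    · exact re_pi_div_pos hp
    · exact div_ne_zero hpi (neg_ne_zero.2 hbne)
    · apply re_pi_div_nonneg; rw [Complex.neg_re]; linarith
    · exact re_pi_div_pos hp'
    · simp [hpi, hτ]
    · apply re_pi_div_nonneg; simp
  have hexp : (-(ζ : ℂ) ^ 2 / (4 * p) - (Complex.I * ξ + s * ζ / p) ^ 2 /
      (4 * (Complex.I * τ - s ^ 2 / p))) =
      -(1 / (4 * -(Complex.I * τ))) * (ξ : ℂ) ^ 2 +
      -(1 / (4 * (p + Complex.I * (s ^ 2 / τ : ℝ)))) * ((-(ξ * s / τ) - ζ : ℝ) : ℂ) ^ 2 := by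
    rw [hbe, hpe]
    push_cast
    exact gaussian_exponent_identity hp0 hτ' Complex.I_sq hN
  rw [hexp, Complex.exp_add]
  linear_combination (Real.pi : ℂ)⁻¹ * Complex.exp (-(1 / (4 * -(Complex.I * τ))) * (ξ : ℂ) ^ 2) *
    Complex.exp (-(1 / (4 * (p + Complex.I * (s ^ 2 / τ : ℝ)))) * ((-(ξ * s / τ) - ζ : ℝ) : ℂ) ^ 2)
    * hroot

/-! ### Functions with integrable Fourier transform -/

/-- `g` is the integrable inverse Fourier transform of the integrable function `γ`. -/
structure IsFourierPair (g γ : ℝ → ℂ) : Prop where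
  integrable : Integrable g
  integrable_density : Integrable γ
  eq_integral : ∀ x, g x = ∫ k, γ k * chirp 0 k x

namespace IsFourierPair

variable {g γ : ℝ → ℂ}

lemma integrable_comp (h : IsFourierPair g γ) {r : ℝ} (hr : r ≠ 0) :
    Integrable fun x => g (r * x) := h.integrable.comp_mul_left' hr

lemma integral_comp_mul (h : IsFourierPair g γ) (r : ℝ) {ψ : ℝ → ℂ} (hψ : Integrable ψ) :
    ∫ x, g (r * x) * ψ x = ∫ k, γ k * ∫ x, chirp 0 (r * k) x * ψ x := by
  have hint : Integrable (Function.uncurry fun x k => γ k * (chirp 0 (r * k) x * ψ x))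
      ((volume : Measure ℝ).prod volume) := by
    have h1 := (hψ.mul_prod h.integrable_density).bdd_mul (c := 1)
      (f := fun z : ℝ × ℝ => chirp 0 (r * z.2) z.1)
      ((by unfold chirp; fun_prop : Continuous _).aestronglyMeasurable)
      (Eventually.of_forall fun z => (norm_chirp _ _ _).le)
    refine h1.congr (Eventually.of_forall fun z => ?_)
    simp only [Function.uncurry]; ring
  calc ∫ x, g (r * x) * ψ x = ∫ x, ∫ k, γ k * (chirp 0 (r * k) x * ψ x) := by
        congr 1; ext x
        rw [h.eq_integral, ← integral_mul_const]
        simp only [chirp_scale, mul_assoc]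
    _ = ∫ k, ∫ x, γ k * (chirp 0 (r * k) x * ψ x) := integral_integral_swap hint
    _ = _ := by simp only [integral_const_mul]

end IsFourierPair

/-! ### Boundary values of Gaussian Fourier transforms -/

lemma tendsto_gaussFT_param {τ : ℝ} (hτ : τ ≠ 0) (ξ : ℝ) :
    Tendsto (fun ε : ℝ => gaussFT (ε - Complex.I * τ) ξ) (𝓝[>] 0)
      (𝓝 (gaussFT (-(Complex.I * τ)) ξ)) := by
  have hne : (-(Complex.I * τ) : ℂ) ≠ 0 := by simp [hτ]
  have hcont : Tendsto (fun ε : ℝ => (ε - Complex.I * τ : ℂ)) (𝓝[>] 0)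
      (𝓝 (-(Complex.I * τ))) := by
    have : Continuous fun ε : ℝ => (ε - Complex.I * τ : ℂ) := by fun_prop
    have := this.tendsto 0
    simp only [Complex.ofReal_zero, zero_sub] at this
    exact this.mono_left nhdsWithin_le_nhds
  refine Tendsto.mul ?_ ((Complex.continuous_exp.tendsto _).comp ?_)
  · refine (Tendsto.div tendsto_const_nhds hcont hne).cpow tendsto_const_nhds ?_
    right
    have : ((Real.pi : ℂ) / -(Complex.I * τ)).im = Real.pi / τ := by
      rw [div_neg, mul_comm, ← div_div, Complex.div_I]
      simp [← Complex.ofReal_div]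
    rw [this]
    simp [hτ, Real.pi_ne_zero]
  · refine Tendsto.mul_const _ (Tendsto.neg ?_)
    exact Tendsto.div tendsto_const_nhds (hcont.const_mul 4) (by simpa using hτ)

/-- Since `|ε - iτ| ≥ |τ|`, the bound does not depend on `ε` and serves as the dominating constant
for `ε → 0`. -/
lemma norm_gaussFT_le_of_im {τ : ℝ} (hτ : τ ≠ 0) {ε : ℝ} (hε : 0 ≤ ε) (ξ : ℝ) :
    ‖gaussFT (ε - Complex.I * τ) ξ‖ ≤ √(Real.pi / |τ|) := by
  refine (norm_gaussFT_le (by simpa using hε) ξ).trans ?_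
  apply Real.sqrt_le_sqrt
  have h : |τ| ≤ ‖(ε - Complex.I * τ : ℂ)‖ := by
    have := Complex.abs_im_le_norm (ε - Complex.I * τ : ℂ)
    simpa using this
  have : 0 < |τ| := abs_pos.2 hτ
  have := Real.pi_pos
  gcongr

lemma norm_gaussFT_neg_I_mul_le {τ : ℝ} (hτ : τ ≠ 0) (ξ : ℝ) :
    ‖gaussFT (-(Complex.I * τ)) ξ‖ ≤ √(Real.pi / |τ|) := by
  have := norm_gaussFT_le_of_im hτ le_rfl ξ
  simpa using this

lemma integrable_chirp_mul_gaussian (τ ξ : ℝ) {ε : ℝ} (hε : 0 < ε) :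
    Integrable fun x : ℝ => chirp τ ξ x * Complex.exp (-(ε : ℂ) * (x : ℂ) ^ 2) :=
  (integrable_cexp_neg_mul_sq (b := ε) (by simpa using hε)).bdd_mul
    (continuous_chirp τ ξ).aestronglyMeasurable (Eventually.of_forall fun x => (norm_chirp _ _ _).le)

lemma tendsto_cexp_neg_mul_sq (x : ℝ) :
    Tendsto (fun ε : ℝ => Complex.exp (-(ε : ℂ) * (x : ℂ) ^ 2)) (𝓝[>] 0) (𝓝 1) := by
  have : Continuous fun ε : ℝ => Complex.exp (-(ε : ℂ) * (x : ℂ) ^ 2) := by fun_prop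
  have := this.tendsto 0
  simp only [Complex.ofReal_zero, neg_zero, zero_mul, Complex.exp_zero] at this
  exact this.mono_left nhdsWithin_le_nhds

/-! ### Integrals against error functions -/

lemma integrable_mul_gaussErf {φ : ℝ → ℂ} (hφ : Integrable φ) {p : ℂ} (hp : 0 ≤ p.re) {c : ℝ → ℝ}
    (hc : Measurable c) : Integrable fun x => φ x * gaussErf p (c x) := by
  have := hφ.bdd_mul (f := fun x => gaussErf p (c x)) (c := 6)
    ((measurable_gaussErf p).comp hc).aestronglyMeasurable
    (Eventually.of_forall fun x => norm_gaussErf_le hp _)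
  simpa only [mul_comm] using this

/-- Differentiation in the shift `ζ` replaces the error function by a Gaussian, for which explicit
integrals are available. -/
lemma hasDerivAt_integral_mul_gaussErf {φ : ℝ → ℂ} (hφ : Integrable φ) {p : ℂ} (hp : 0 < p.re)
    {c : ℝ → ℝ} (hc : Measurable c) (ζ : ℝ) :
    HasDerivAt (fun ζ => ∫ x, φ x * gaussErf p (c x - ζ))
      (-∫ x, φ x * gaussErfDeriv p (c x - ζ)) ζ := by
  have hp0 : p ≠ 0 := by rintro rfl; simp at hp
  have h := hasDerivAt_integral_of_dominated_loc_of_deriv_le (μ := volume) (x₀ := ζ) (s := univ)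
    (F := fun ζ x => φ x * gaussErf p (c x - ζ))
    (F' := fun ζ x => φ x * (-gaussErfDeriv p (c x - ζ)))
    (bound := fun x => ‖φ x‖ * ‖(Real.pi : ℂ)⁻¹ * (Real.pi / p) ^ (1 / 2 : ℂ)‖) univ_mem
    (Eventually.of_forall fun ζ =>
      (integrable_mul_gaussErf hφ hp.le (hc.sub_const ζ)).aestronglyMeasurable)
    (integrable_mul_gaussErf hφ hp.le (hc.sub_const ζ))
    (hφ.aestronglyMeasurable.mul
      ((continuous_gaussErfDeriv p).measurable.comp (hc.sub_const ζ)).neg.aestronglyMeasurable)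
    (Eventually.of_forall fun x ζ _ => by
      rw [norm_mul, norm_neg]
      gcongr
      exact norm_gaussErfDeriv_le hp.le _)
    (hφ.norm.mul_const _)
    (Eventually.of_forall fun x ζ _ => by
      have h1 : HasDerivAt (fun ζ : ℝ => c x - ζ) (-1) ζ := by
        simpa using (hasDerivAt_id ζ).const_sub (c x)
      have h2 := ((hasDerivAt_gaussErf hp0 (c x - ζ)).scomp ζ h1).const_mul (φ x)
      convert! h2 using 1
      simp)
  have h3 := h.2
  simp only [mul_neg, integral_neg] at h3
  exact h3

/-- The argument tends to `-∞` and the error function to `-1`; this fixes the constant left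
undetermined by differentiating in `ζ`. -/
lemma tendsto_integral_mul_gaussErf_atTop {φ : ℝ → ℂ} (hφ : Integrable φ) {p : ℂ} (hp : 0 < p.re)
    {c : ℝ → ℝ} (hc : Measurable c) :
    Tendsto (fun ζ => ∫ x, φ x * gaussErf p (c x - ζ)) atTop (𝓝 (-∫ x, φ x)) := by
  rw [← integral_neg]
  apply tendsto_integral_filter_of_dominated_convergence (fun x => ‖φ x‖ * 6)
  · exact Eventually.of_forall fun ζ =>
      (integrable_mul_gaussErf hφ hp.le (hc.sub_const ζ)).aestronglyMeasurable
  · refine Eventually.of_forall fun ζ => Eventually.of_forall fun x => ?_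
    rw [norm_mul]
    gcongr
    exact norm_gaussErf_le hp.le _
  · exact hφ.norm.mul_const _
  · refine Eventually.of_forall fun x => ?_
    have h1 : Tendsto (fun ζ : ℝ => c x - ζ) atTop atBot :=
      tendsto_atBot_add_const_left _ _ tendsto_neg_atTop_atBot
    have := ((tendsto_gaussErf_atBot hp).comp h1).const_mul (φ x)
    simpa using this

lemma tendsto_integral_mul_gaussErf_param {φ : ℝ → ℂ} (hφ : Integrable φ) (σ : ℝ) {c : ℝ → ℝ}
    (hc : Measurable c) :
    Tendsto (fun δ : ℝ => ∫ x, φ x * gaussErf (δ + Complex.I * σ) (c x)) (𝓝[>] 0)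
      (𝓝 (∫ x, φ x * gaussErf (Complex.I * σ) (c x))) := by
  have hre : ∀ δ : ℝ, δ ∈ Ioi (0 : ℝ) → 0 ≤ (δ + Complex.I * σ : ℂ).re := by
    intro δ hδ; simpa using (le_of_lt hδ : (0 : ℝ) ≤ δ)
  apply tendsto_integral_filter_of_dominated_convergence (fun x => ‖φ x‖ * 6)
  · filter_upwards [self_mem_nhdsWithin] with δ hδ
    exact (integrable_mul_gaussErf hφ (hre δ hδ) hc).aestronglyMeasurable
  · filter_upwards [self_mem_nhdsWithin] with δ hδ
    refine Eventually.of_forall fun x => ?_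
    rw [norm_mul]
    gcongr
    exact norm_gaussErf_le (hre δ hδ) _
  · exact hφ.norm.mul_const _
  · exact Eventually.of_forall fun x => (tendsto_gaussErf_param σ (c x)).const_mul _

namespace IsFourierPair

variable {g γ : ℝ → ℂ}

lemma integrable_density_mul_gaussFT (h : IsFourierPair g γ) {τ : ℝ} (hτ : τ ≠ 0) (r ξ : ℝ) :
    Integrable fun k => γ k * gaussFT (-(Complex.I * τ)) (ξ + r * k) := by
  have := h.integrable_density.bdd_mul (c := √(Real.pi / |τ|))
    (f := fun k => gaussFT (-(Complex.I * τ)) (ξ + r * k))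
    ((continuous_gaussFT _).comp (by fun_prop)).aestronglyMeasurable
    (Eventually.of_forall fun k => norm_gaussFT_neg_I_mul_le hτ _)
  simpa only [mul_comm] using this

lemma integrable_comp_mul_chirp (h : IsFourierPair g γ) {r : ℝ} (hr : r ≠ 0) (τ ξ : ℝ) :
    Integrable fun x => g (r * x) * chirp τ ξ x := by
  have := (h.integrable_comp hr).bdd_mul (f := chirp τ ξ) (c := 1)
    (continuous_chirp τ ξ).aestronglyMeasurable (Eventually.of_forall fun x => (norm_chirp _ _ _).le)
  simpa only [mul_comm] using this

/-- Parseval's identity for a quadratic phase. -/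
lemma integral_mul_chirp (h : IsFourierPair g γ) {r : ℝ} (hr : r ≠ 0) {τ : ℝ} (hτ : τ ≠ 0)
    (ξ : ℝ) :
    ∫ x, g (r * x) * chirp τ ξ x = ∫ k, γ k * gaussFT (-(Complex.I * τ)) (ξ + r * k) := by
  -- The chirp alone is not integrable, so Fubini is applied to the damped chirp and then `ε → 0` on
  -- both sides.
  have hreg : ∀ ε : ℝ, 0 < ε →
      ∫ x, g (r * x) * (chirp τ ξ x * Complex.exp (-(ε : ℂ) * (x : ℂ) ^ 2)) =
        ∫ k, γ k * gaussFT (ε - Complex.I * τ) (ξ + r * k) := by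
    intro ε hε
    rw [h.integral_comp_mul r (integrable_chirp_mul_gaussian τ ξ hε)]
    congr 1; ext k
    rw [← integral_chirp_mul_gaussian τ (ξ + r * k) hε]
    congr 2; ext x
    rw [← mul_assoc, chirp_mul_chirp, zero_add, add_comm]
  have hL : Tendsto (fun ε : ℝ =>
      ∫ x, g (r * x) * (chirp τ ξ x * Complex.exp (-(ε : ℂ) * (x : ℂ) ^ 2))) (𝓝[>] 0)
      (𝓝 (∫ x, g (r * x) * chirp τ ξ x)) := by
    apply tendsto_integral_filter_of_dominated_convergence (fun x => ‖g (r * x)‖)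
    · exact Eventually.of_forall fun ε => (h.integrable_comp hr).aestronglyMeasurable.mul
        ((continuous_chirp τ ξ).mul (by fun_prop)).aestronglyMeasurable
    · filter_upwards [self_mem_nhdsWithin] with ε hε
      refine Eventually.of_forall fun x => ?_
      rw [norm_mul, norm_mul, norm_chirp, one_mul]
      apply mul_le_of_le_one_right (norm_nonneg _)
      exact norm_cexp_neg_mul_sq_le_one (by simpa using (le_of_lt hε : (0 : ℝ) ≤ ε)) x
    · exact (h.integrable_comp hr).norm
    · refine Eventually.of_forall fun x => ?_
      have := ((tendsto_cexp_neg_mul_sq x).const_mul (chirp τ ξ x)).const_mul (g (r * x))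
      simpa using this
  have hR : Tendsto (fun ε : ℝ => ∫ k, γ k * gaussFT (ε - Complex.I * τ) (ξ + r * k)) (𝓝[>] 0)
      (𝓝 (∫ k, γ k * gaussFT (-(Complex.I * τ)) (ξ + r * k))) := by
    apply tendsto_integral_filter_of_dominated_convergence (fun k => ‖γ k‖ * √(Real.pi / |τ|))
    · exact Eventually.of_forall fun ε => h.integrable_density.aestronglyMeasurable.mul
        ((continuous_gaussFT _).comp (by fun_prop)).aestronglyMeasurable
    · filter_upwards [self_mem_nhdsWithin] with ε hε
      refine Eventually.of_forall fun x => ?_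
      rw [norm_mul]
      gcongr
      exact norm_gaussFT_le_of_im hτ (le_of_lt hε) _
    · exact h.integrable_density.norm.mul_const _
    · exact Eventually.of_forall fun k => (tendsto_gaussFT_param hτ _).const_mul _
  refine tendsto_nhds_unique hL (hR.congr' ?_)
  filter_upwards [self_mem_nhdsWithin] with ε hε
  exact (hreg ε hε).symm

/-- As functions of `ζ` both sides have the same derivative, by the Gaussian formula for
`gaussErfDeriv`. Their difference is constant, and it tends to `0` as `ζ → ∞` by Parseval for the
chirp alone. -/
lemma integral_mul_chirp_mul_gaussErf_of_re_pos (h : IsFourierPair g γ) {r : ℝ} (hr : r ≠ 0)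
    {τ s : ℝ} (hτ : τ ≠ 0) (hs : s ≠ 0) {p : ℂ} (hp : 0 < p.re) (ξ ζ : ℝ) :
    ∫ x, g (r * x) * chirp τ ξ x * gaussErf p (2 * s * x - ζ) =
      ∫ k, γ k * gaussFT (-(Complex.I * τ)) (ξ + r * k) *
        gaussErf (p + Complex.I * (s ^ 2 / τ : ℝ)) (-((ξ + r * k) * s / τ) - ζ) := by
  set p' : ℂ := p + Complex.I * (s ^ 2 / τ : ℝ) with hp'
  have hp'r : 0 < p'.re := by
    rw [hp', Complex.add_re, Complex.mul_re, Complex.I_im, Complex.ofReal_im, Complex.I_re,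
      zero_mul,
      mul_zero, sub_zero, add_zero]
    exact hp
  have hp0 : p ≠ 0 := by rintro rfl; simp at hp
  have h1 := h.integrable_comp_mul_chirp hr τ ξ
  have h2 := h.integrable_density_mul_gaussFT hτ r ξ
  have hm1 : Measurable fun x : ℝ => 2 * s * x := by fun_prop
  have hm2 : Measurable fun k : ℝ => -((ξ + r * k) * s / τ) := by fun_prop
  have hψ : ∀ ζ, Integrable fun x => chirp τ ξ x * gaussErfDeriv p (2 * s * x - ζ) := by
    intro ζ
    have hz := re_one_div_four_mul_pos hp
    have h3 := (((integrable_cexp_neg_mul_sq hz).comp_sub_right ζ).comp_mul_left'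
      (mul_ne_zero two_ne_zero hs)).const_mul ((Real.pi : ℂ)⁻¹ * (Real.pi / p) ^ (1 / 2 : ℂ))
    exact h3.bdd_mul (continuous_chirp τ ξ).aestronglyMeasurable
      (Eventually.of_forall fun x => (norm_chirp _ _ _).le)
  have hderiv : ∀ ζ, ∫ x, g (r * x) * chirp τ ξ x * gaussErfDeriv p (2 * s * x - ζ) =
      ∫ k, γ k * gaussFT (-(Complex.I * τ)) (ξ + r * k) *
        gaussErfDeriv p' (-((ξ + r * k) * s / τ) - ζ) := by
    intro ζ
    simp only [mul_assoc (g _), mul_assoc (γ _)]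
    rw [h.integral_comp_mul r (hψ ζ)]
    congr 1; ext k
    have := integral_chirp_mul_gaussErfDeriv hp hτ hs (ξ + r * k) ζ
    rw [← this]
    congr 2; ext x
    rw [← mul_assoc, chirp_mul_chirp, zero_add, add_comm (r * k)]
  set D : ℝ → ℂ := fun ζ => (∫ x, g (r * x) * chirp τ ξ x * gaussErf p (2 * s * x - ζ)) -
      ∫ k, γ k * gaussFT (-(Complex.I * τ)) (ξ + r * k) *
        gaussErf p' (-((ξ + r * k) * s / τ) - ζ) with hD
  have hD' : ∀ ζ, HasDerivAt D 0 ζ := by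
    intro ζ
    have := (hasDerivAt_integral_mul_gaussErf h1 hp hm1 ζ).sub
      (hasDerivAt_integral_mul_gaussErf h2 hp'r hm2 ζ)
    rw [hderiv ζ, sub_self] at this
    exact this
  have hconst : ∀ x y, D x = D y := is_const_of_deriv_eq_zero
    (fun ζ => (hD' ζ).differentiableAt) (fun ζ => (hD' ζ).deriv)
  have hlim : Tendsto D atTop (𝓝 0) := by
    have := (tendsto_integral_mul_gaussErf_atTop h1 hp hm1).sub
      (tendsto_integral_mul_gaussErf_atTop h2 hp'r hm2)
    rwa [h.integral_mul_chirp hr hτ, sub_self] at this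
  have : D ζ = 0 := tendsto_nhds_unique
    (tendsto_const_nhds.congr fun y => hconst ζ y) hlim
  exact sub_eq_zero.1 this

/-- Parseval's identity for a quadratic phase times an error function of imaginary parameter. -/
lemma integral_mul_chirp_mul_gaussErf (h : IsFourierPair g γ) {r : ℝ} (hr : r ≠ 0)
    {τ : ℝ} (hτ : τ ≠ 0) (s ξ ζ : ℝ) :
    ∫ x, g (r * x) * chirp τ ξ x * gaussErf (Complex.I * s) (2 * s * x - ζ) =
      ∫ k, γ k * gaussFT (-(Complex.I * τ)) (ξ + r * k) *
        gaussErf (Complex.I * (s + s ^ 2 / τ : ℝ)) (-((ξ + r * k) * s / τ) - ζ) := by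
  -- For `s = 0` the error factor is the same constant on both sides. Otherwise the imaginary
  -- parameter is approached through `δ + is`, `δ ↓ 0`.
  by_cases hs : s = 0
  · subst hs
    have := h.integral_mul_chirp hr hτ ξ
    simp only [mul_zero, zero_mul, zero_div, neg_zero, zero_sub, Complex.ofReal_zero,
      integral_mul_const, ne_eq, OfNat.ofNat_ne_zero, not_false_eq_true, zero_pow, add_zero]
    rw [this]
  · have hL := tendsto_integral_mul_gaussErf_param (h.integrable_comp_mul_chirp hr τ ξ) s
      (c := fun x => 2 * s * x - ζ) (by fun_prop)
    have hR := tendsto_integral_mul_gaussErf_param (h.integrable_density_mul_gaussFT hτ r ξ)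
      (s + s ^ 2 / τ) (c := fun k => -((ξ + r * k) * s / τ) - ζ) (by fun_prop)
    refine tendsto_nhds_unique hL (hR.congr' ?_)
    filter_upwards [self_mem_nhdsWithin] with δ hδ
    have hre : 0 < (δ + Complex.I * s : ℂ).re := by simpa using hδ
    rw [h.integral_mul_chirp_mul_gaussErf_of_re_pos hr hτ hs hre ξ ζ]
    congr 1; ext k; congr 2
    push_cast; ring

end IsFourierPair

lemma re_I_mul_ofReal (x : ℝ) : (Complex.I * x : ℂ).re = 0 := by
  rw [Complex.mul_re, Complex.I_re, Complex.ofReal_im, zero_mul, mul_zero, sub_zero]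

lemma norm_gaussErf_I_mul_le (σ b : ℝ) : ‖gaussErf (Complex.I * σ) b‖ ≤ 6 :=
  norm_gaussErf_le (re_I_mul_ofReal σ).ge b

/-! ### Limits of averages against even kernels -/

/-- Continuity suffices except at `p = 0`, `b = 0`, where the error function is the sign. There
oddness leaves `A u - A (-u)` times a bounded factor, which tends to the value `0` prescribed by
`sign 0 = 0`. -/
lemma tendsto_symm_mul_gaussErf {A : ℝ → ℂ} (hA : Continuous A) (p : ℂ) (b c : ℝ) :
    Tendsto (fun u : ℝ => A u * gaussErf p (b + u * c) + A (-u) * gaussErf p (b + -u * c)) (𝓝 0)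
      (𝓝 (2 * (A 0 * gaussErf p b))) := by
  have hAt : Tendsto A (𝓝 0) (𝓝 (A 0)) := hA.tendsto 0
  have hAn : Tendsto (fun u => A (-u)) (𝓝 0) (𝓝 (A 0)) := by
    have := (hA.comp continuous_neg).tendsto 0
    simpa [Function.comp_def] using this
  by_cases hcase : p = 0 ∧ b = 0
  · obtain ⟨rfl, rfl⟩ := hcase
    simp only [gaussErf_zero_right, mul_zero]
    have h1 : Tendsto (fun u => ‖A u - A (-u)‖ * 6) (𝓝 0) (𝓝 0) := by
      have := ((hAt.sub hAn).norm).mul_const 6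
      simpa using this
    refine squeeze_zero_norm (fun u => ?_) h1
    rw [zero_add, zero_add, neg_mul, gaussErf_neg, mul_neg, ← sub_eq_add_neg, ← sub_mul, norm_mul]
    gcongr
    exact norm_gaussErf_le (by simp) _
  · have hc : ContinuousAt (gaussErf p) b := by
      by_cases hp : p = 0
      · have hb : b ≠ 0 := fun hb => hcase ⟨hp, hb⟩
        subst hp
        have hs : (fun y : ℝ => ((Real.sign y : ℝ) : ℂ)) =ᶠ[𝓝 b] fun _ => ((Real.sign b : ℝ) : ℂ) := by
          rcases lt_or_gt_of_ne hb with hb | hb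
          · filter_upwards [Iio_mem_nhds hb] with y hy
            rw [Real.sign_of_neg hb, Real.sign_of_neg hy]
          · filter_upwards [Ioi_mem_nhds hb] with y hy
            rw [Real.sign_of_pos hb, Real.sign_of_pos hy]
        have : gaussErf 0 = fun y : ℝ => ((Real.sign y : ℝ) : ℂ) := funext gaussErf_zero_left
        rw [this]
        exact continuousAt_const.congr hs.symm
      · exact (continuous_gaussErf hp).continuousAt
    have e1 : Tendsto (fun u : ℝ => b + u * c) (𝓝 0) (𝓝 b) := by
      have : Continuous fun u : ℝ => b + u * c := by fun_prop
      simpa using this.tendsto 0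
    have e2 : Tendsto (fun u : ℝ => b + -u * c) (𝓝 0) (𝓝 b) := by
      have : Continuous fun u : ℝ => b + -u * c := by fun_prop
      simpa using this.tendsto 0
    have := (hAt.mul (hc.tendsto.comp e1)).add (hAn.mul (hc.tendsto.comp e2))
    rw [two_mul]
    exact this

/-- Evenness of `γ` allows `J` to be replaced by its symmetrization, so `J` may jump at `0` as long
as its value there is the mean of the one-sided behaviour. -/
lemma tendsto_integral_even_mul {γ : ℝ → ℂ} (hγ : Integrable γ) (heven : ∀ k, γ (-k) = γ k)
    {J : ℝ → ℂ} (hJ : Measurable J) {C : ℝ} (hC : ∀ u, ‖J u‖ ≤ C)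
    (hsymm : Tendsto (fun u => J u + J (-u)) (𝓝 0) (𝓝 (2 * J 0))) :
    Tendsto (fun r : ℝ => ∫ k, γ k * J (r * k)) (𝓝 0) (𝓝 ((∫ k, γ k) * J 0)) := by
  have hint : ∀ r : ℝ, Integrable fun k => γ k * J (r * k) := by
    intro r
    have := hγ.bdd_mul (f := fun k => J (r * k)) (c := C)
      (hJ.comp (by fun_prop)).aestronglyMeasurable (Eventually.of_forall fun k => hC _)
    simpa only [mul_comm (γ _)] using this
  have heq : ∀ r : ℝ, ∫ k, γ k * J (r * k) =
      ∫ k, 2⁻¹ * (γ k * (J (r * k) + J (-(r * k)))) := by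
    intro r
    have h1 : ∫ k, γ k * J (-(r * k)) = ∫ k, γ k * J (r * k) := by
      rw [← integral_neg_eq_self]
      simp only [heven, mul_neg, neg_neg]
    have h2 := hint (-r)
    simp only [neg_mul] at h2
    simp only [mul_add]
    rw [integral_add ((hint r).const_mul _) (h2.const_mul _), integral_const_mul,
      integral_const_mul, h1]
    ring
  simp only [heq]
  have hfin : (∫ k, γ k) * J 0 = ∫ k, 2⁻¹ * (γ k * (2 * J 0)) := by
    rw [integral_const_mul, integral_mul_const]; ring
  rw [hfin]
  apply tendsto_integral_filter_of_dominated_convergence (fun k => ‖γ k‖ * C)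
  · refine Eventually.of_forall fun r => ?_
    have h2 := hint (-r)
    simp only [neg_mul] at h2
    simp only [mul_add]
    exact (((hint r).const_mul _).add (h2.const_mul _)).aestronglyMeasurable
  · refine Eventually.of_forall fun r => Eventually.of_forall fun k => ?_
    rw [norm_mul, norm_mul, norm_inv, Complex.norm_two]
    have : ‖J (r * k) + J (-(r * k))‖ ≤ C + C := (norm_add_le _ _).trans (add_le_add (hC _) (hC _))
    calc _ ≤ 2⁻¹ * (‖γ k‖ * (C + C)) := by gcongr
      _ = _ := by ring
  · exact hγ.norm.mul_const _
  · refine Eventually.of_forall fun k => ?_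
    have h0 : Tendsto (fun r : ℝ => r * k) (𝓝 0) (𝓝 0) := by
      have : Continuous fun r : ℝ => r * k := by fun_prop
      simpa using this.tendsto 0
    exact ((hsymm.comp h0).const_mul (γ k)).const_mul _

/-! ### Uniform bounds and limits for scaled cutoffs -/

namespace IsFourierPair

variable {g γ : ℝ → ℂ}

/-- The dispersive bound: on the frequency side every `k` contributes at most a Fresnel factor times
`6`, uniformly in the scale `r` and in `s`, `ξ`, `ζ`. -/
lemma norm_integral_mul_chirp_mul_gaussErf_le (h : IsFourierPair g γ) {r : ℝ} (hr : r ≠ 0)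
    {τ : ℝ} (hτ : τ ≠ 0) (s ξ ζ : ℝ) :
    ‖∫ x, g (r * x) * chirp τ ξ x * gaussErf (Complex.I * s) (2 * s * x - ζ)‖ ≤
      (∫ k, ‖γ k‖) * (√(Real.pi / |τ|) * 6) := by
  rw [h.integral_mul_chirp_mul_gaussErf hr hτ, ← integral_mul_const]
  refine norm_integral_le_of_norm_le (h.integrable_density.norm.mul_const _)
    (Eventually.of_forall fun k => ?_)
  rw [norm_mul, norm_mul, mul_assoc]
  gcongr
  · exact norm_gaussFT_neg_I_mul_le hτ _
  · exact norm_gaussErf_I_mul_le _ _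

/-- After Parseval the scale enters only through the frequency `ξ + rk`. Symmetrization in `k` is
needed when `s + s²/τ = 0`, where the transformed error function degenerates to the sign. -/
lemma tendsto_integral_mul_chirp_mul_gaussErf (h : IsFourierPair g γ)
    (heven : ∀ k, γ (-k) = γ k) {τ : ℝ} (hτ : τ ≠ 0) (s ξ ζ : ℝ) :
    Tendsto (fun r : ℝ =>
        ∫ x, g (r * x) * chirp τ ξ x * gaussErf (Complex.I * s) (2 * s * x - ζ)) (𝓝[≠] 0)
      (𝓝 ((∫ k, γ k) * (gaussFT (-(Complex.I * τ)) ξ *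
        gaussErf (Complex.I * (s + s ^ 2 / τ : ℝ)) (-(ξ * s / τ) - ζ)))) := by
  have hA : Continuous fun u : ℝ => gaussFT (-(Complex.I * τ)) (ξ + u) :=
    (continuous_gaussFT _).comp (by fun_prop)
  have h1 := tendsto_symm_mul_gaussErf hA (Complex.I * (s + s ^ 2 / τ : ℝ))
    (-(ξ * s / τ) - ζ) (-(s / τ))
  have h2 := tendsto_integral_even_mul h.integrable_density heven
    (J := fun u => gaussFT (-(Complex.I * τ)) (ξ + u) *
      gaussErf (Complex.I * (s + s ^ 2 / τ : ℝ)) (-(ξ * s / τ) - ζ + u * -(s / τ)))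
    (C := √(Real.pi / |τ|) * 6)
    (hA.measurable.mul ((measurable_gaussErf _).comp (by fun_prop)))
    (fun u => by
      rw [norm_mul]
      exact mul_le_mul (norm_gaussFT_neg_I_mul_le hτ _) (norm_gaussErf_I_mul_le _ _)
        (norm_nonneg _) (Real.sqrt_nonneg _))
    (by simpa only [zero_mul, add_zero] using h1)
  simp only [zero_mul, add_zero] at h2
  refine (h2.mono_left nhdsWithin_le_nhds).congr' ?_
  filter_upwards [self_mem_nhdsWithin] with r hr
  rw [h.integral_mul_chirp_mul_gaussErf hr hτ]
  congr 1; ext k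
  rw [mul_assoc (γ k)]
  congr 3; ring

end IsFourierPair

/-- Smooth compactly supported functions have integrable Fourier transforms. -/
lemma exists_isFourierPair {f : ℝ → ℂ} (hf : ContDiff ℝ ∞ f) (hc : HasCompactSupport f) :
    ∃ γ : ℝ → ℂ, IsFourierPair f γ ∧ Integrable fun k : ℝ => (k : ℂ) * γ k := by
  set φ := hc.toSchwartzMap hf with hφ
  have hφf : (φ : ℝ → ℂ) = f := rfl
  set ψ := FourierTransform.fourier φ with hψ
  have hinv : FourierTransformInv.fourierInv ψ = φ := by simp [hψ]
  have hx : ∀ x, f x = ∫ v, Complex.exp (((2 * Real.pi * (v * x) : ℝ) : ℂ) * Complex.I) * ψ v := by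
    intro x
    have h1 : f x = (FourierTransformInv.fourierInv ψ : SchwartzMap ℝ ℂ) x := by rw [hinv, ← hφf]
    rw [h1, SchwartzMap.fourierInv_coe, Real.fourierInv_eq']
    simp [mul_comm]
  have hpi : (2 * Real.pi)⁻¹ ≠ 0 := by positivity
  have hψi : Integrable fun v => ψ v := ψ.integrable
  have hψi' : Integrable fun v : ℝ => (v : ℂ) * ψ v := by
    have := ψ.integrable_pow_mul (volume : Measure ℝ) 1
    refine (integrable_norm_iff ?_).1 ?_
    · exact (Complex.continuous_ofReal.mul ψ.continuous).aestronglyMeasurable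
    · simpa using this
  -- The Schwartz Fourier transform uses the kernel `e^{2πivx}`; rescaling by `2π` passes to
  -- `e^{ikx}`.
  refine ⟨fun k => ((2 * Real.pi)⁻¹ : ℝ) * ψ ((2 * Real.pi)⁻¹ * k), ⟨?_, ?_, ?_⟩, ?_⟩
  · exact hf.continuous.integrable_of_hasCompactSupport hc
  · exact (hψi.comp_mul_left' hpi).const_mul _
  · intro x
    rw [hx]
    have := Measure.integral_comp_mul_left (fun v : ℝ =>
      Complex.exp (((2 * Real.pi * (v * x) : ℝ) : ℂ) * Complex.I) * ψ v) (2 * Real.pi)⁻¹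
    rw [inv_inv, abs_of_pos (by positivity : 0 < 2 * Real.pi), Complex.real_smul] at this
    have hc2 : (((2 * Real.pi)⁻¹ : ℝ) : ℂ) * ((2 * Real.pi : ℝ) : ℂ) = 1 := by
      rw [← Complex.ofReal_mul, inv_mul_cancel₀ (by positivity), Complex.ofReal_one]
    calc _ = (((2 * Real.pi)⁻¹ : ℝ) : ℂ) * (((2 * Real.pi : ℝ) : ℂ) *
          ∫ v, Complex.exp (((2 * Real.pi * (v * x) : ℝ) : ℂ) * Complex.I) * ψ v) := by
          rw [← mul_assoc, hc2, one_mul]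
      _ = _ := by
        rw [← this, ← integral_const_mul]
        congr 1; ext k
        have : Complex.exp (((2 * Real.pi * ((2 * Real.pi)⁻¹ * k * x) : ℝ) : ℂ) * Complex.I) =
            chirp 0 k x := by
          rw [chirp]
          congr 1
          have : 2 * Real.pi * ((2 * Real.pi)⁻¹ * k * x) = k * x := by
            field_simp
          rw [this]; push_cast; ring
        rw [this]; ring
  · have := (hψi'.comp_mul_left' hpi)
    refine this.congr (Eventually.of_forall fun k => ?_)
    simp only
    push_cast; ring

/-- An even function is represented equally well by the reflected density, hence by the average of
the two. -/
lemma IsFourierPair.even_average {g γ : ℝ → ℂ} (h : IsFourierPair g γ) (hg : ∀ x, g (-x) = g x) :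
    IsFourierPair g fun k => 2⁻¹ * (γ k + γ (-k)) := by
  refine ⟨h.integrable, (h.integrable_density.add h.integrable_density.comp_neg).const_mul _,
    fun x => ?_⟩
  have hch : ∀ k, chirp 0 (-k) x = chirp 0 k (-x) := fun k => by
    simp only [chirp]; congr 1; push_cast; ring
  have hi : ∀ (x : ℝ) (γ : ℝ → ℂ), Integrable γ → Integrable fun k => γ k * chirp 0 k x := by
    intro x γ hγ
    have := hγ.bdd_mul (f := fun k => chirp 0 k x) (c := 1)
      (by unfold chirp; fun_prop : Continuous _).aestronglyMeasurable
      (Eventually.of_forall fun k => (norm_chirp _ _ _).le)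
    simpa only [mul_comm] using this
  have h1 : ∫ k, γ (-k) * chirp 0 k x = g (-x) := by
    rw [h.eq_integral, ← integral_neg_eq_self]
    simp only [neg_neg, hch]
  simp only [mul_assoc, add_mul]
  rw [integral_const_mul, integral_add (hi x γ h.integrable_density)
    (hi x _ h.integrable_density.comp_neg), h1, ← h.eq_integral, hg]
  ring

lemma IsFourierPair.integral_density {g γ : ℝ → ℂ} (h : IsFourierPair g γ) : ∫ k, γ k = g 0 := by
  rw [h.eq_integral]
  simp [chirp]

/-! ### Superpositions of modulated error functions -/

/-- The function `x ↦ exp (i a x) Q (2 s x - b)`, where `Q` is the error function of parameter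
`i s`. -/
noncomputable def erfWave (s a b x : ℝ) : ℂ :=
  chirp 0 a x * gaussErf (Complex.I * s) (2 * s * x - b)

lemma norm_erfWave_le (s a b x : ℝ) : ‖erfWave s a b x‖ ≤ 6 := by
  rw [erfWave, norm_mul, norm_chirp, one_mul]
  exact norm_gaussErf_I_mul_le _ _

lemma hasDerivAt_chirp (a x : ℝ) : HasDerivAt (chirp 0 a) (Complex.I * a * chirp 0 a x) x := by
  have h1 : HasDerivAt (fun w : ℝ => (w : ℂ)) 1 x := Complex.ofRealCLM.hasDerivAt
  have h2 := (h1.const_mul (Complex.I * a)).cexp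
  have e : ∀ y : ℝ, chirp 0 a y = Complex.exp (Complex.I * a * y) := fun y => by
    rw [chirp]; congr 1; push_cast; ring
  rw [e x]
  refine HasDerivAt.congr_of_eventuallyEq ?_ (Eventually.of_forall e)
  convert! h2 using 1
  ring

lemma hasDerivAt_erfWave (s a b x : ℝ) :
    HasDerivAt (erfWave s a b) (Complex.I * a * erfWave s a b x +
      chirp 0 a x * (2 * s * gaussErfDeriv (Complex.I * s) (2 * s * x - b))) x := by
  have hQ : HasDerivAt (fun x : ℝ => gaussErf (Complex.I * s) (2 * s * x - b))
      (2 * s * gaussErfDeriv (Complex.I * s) (2 * s * x - b)) x := by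
    by_cases hs : s = 0
    · subst hs
      simpa using hasDerivAt_const x (gaussErf 0 (-b))
    · have h0 : (Complex.I * s : ℂ) ≠ 0 := by simp [hs]
      have h1 : HasDerivAt (fun x : ℝ => 2 * s * x - b) (2 * s) x := by
        simpa using ((hasDerivAt_id x).const_mul (2 * s)).sub_const b
      have := (hasDerivAt_gaussErf h0 (2 * s * x - b)).scomp x h1
      convert! this using 1
      simp
  have := (hasDerivAt_chirp a x).mul hQ
  convert! this using 1
  rw [erfWave]; ring

lemma continuous_erfWave (s a b : ℝ) : Continuous (erfWave s a b) :=
  continuous_iff_continuousAt.2 fun x => (hasDerivAt_erfWave s a b x).continuousAt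

lemma measurable_erfWave (s : ℝ) :
    Measurable fun z : ℝ × ℝ × ℝ => erfWave s z.2.1 z.2.2 z.1 := by
  apply Measurable.mul
  · exact (by unfold chirp; fun_prop :
      Continuous fun z : ℝ × ℝ × ℝ => chirp 0 z.2.1 z.1).measurable
  · exact (measurable_gaussErf _).comp (by fun_prop)

section superposition

variable {X : Type*} [MeasurableSpace X] {M : Measure X} {a b : X → ℝ} {W : X → ℂ}

lemma integrable_erfWave_mul (ha : Measurable a) (hb : Measurable b) (hW : Integrable W M)
    (s x : ℝ) : Integrable (fun w => erfWave s (a w) (b w) x * W w) M :=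
  hW.bdd_mul (c := 6)
    ((measurable_erfWave s).comp (measurable_const.prodMk (ha.prodMk hb))).aestronglyMeasurable
    (Eventually.of_forall fun _ => norm_erfWave_le _ _ _ _)

lemma continuous_integral_erfWave_mul (ha : Measurable a) (hb : Measurable b)
    (hW : Integrable W M) (s : ℝ) : Continuous fun x => ∫ w, erfWave s (a w) (b w) x * W w ∂M := by
  apply continuous_of_dominated (bound := fun w => 6 * ‖W w‖)
  · exact fun x => (integrable_erfWave_mul ha hb hW s x).aestronglyMeasurable
  · intro x
    refine Eventually.of_forall fun w => ?_
    rw [norm_mul]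
    gcongr
    exact norm_erfWave_le _ _ _ _
  · exact hW.norm.const_mul _
  · exact Eventually.of_forall fun w => (continuous_erfWave _ _ _).mul continuous_const

/-- `hzero` says that the terms in which the error function is differentiated cancel in the
superposition. The surviving terms have the original form with weight `i a W`, so a derivative costs
one moment of the frequency and no power of `s`. -/
lemma hasDerivAt_integral_erfWave_mul (ha : Measurable a) (hb : Measurable b)
    (hW : Integrable W M) (haW : Integrable (fun w => (a w : ℂ) * W w) M) {s : ℝ}
    (hzero : ∀ x : ℝ, ∫ w, chirp 0 (a w) x *
      (2 * s * gaussErfDeriv (Complex.I * s) (2 * s * x - b w)) * W w ∂M = 0) (x : ℝ) :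
    HasDerivAt (fun x => ∫ w, erfWave s (a w) (b w) x * W w ∂M)
      (∫ w, erfWave s (a w) (b w) x * (Complex.I * (a w * W w)) ∂M) x := by
  set c : ℝ := ‖(Real.pi : ℂ)⁻¹ * (Real.pi / (Complex.I * s)) ^ (1 / 2 : ℂ)‖ with hc
  have hm : ∀ x, AEStronglyMeasurable (fun w => chirp 0 (a w) x *
      (2 * s * gaussErfDeriv (Complex.I * s) (2 * s * x - b w)) * W w) M := by
    intro x
    refine AEStronglyMeasurable.mul ?_ hW.aestronglyMeasurable
    apply Measurable.aestronglyMeasurable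
    apply Measurable.mul
    · exact (by unfold chirp; fun_prop : Continuous fun u : ℝ => chirp 0 u x).measurable.comp ha
    · exact measurable_const.mul
        ((continuous_gaussErfDeriv _).measurable.comp (measurable_const.sub hb))
  have hbd : ∀ x w, ‖chirp 0 (a w) x *
      (2 * s * gaussErfDeriv (Complex.I * s) (2 * s * x - b w)) * W w‖ ≤ 2 * |s| * c * ‖W w‖ := by
    intro x w
    rw [norm_mul, norm_mul, norm_chirp, one_mul, norm_mul, norm_mul, Complex.norm_two,
      Complex.norm_real, Real.norm_eq_abs]
    gcongr
    exact norm_gaussErfDeriv_le (re_I_mul_ofReal s).ge _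
  have hi1 := integrable_erfWave_mul ha hb (haW.const_mul Complex.I) s
  have hi2 : ∀ x, Integrable (fun w => chirp 0 (a w) x *
      (2 * s * gaussErfDeriv (Complex.I * s) (2 * s * x - b w)) * W w) M := fun x =>
    (hW.norm.const_mul (2 * |s| * c)).mono' (hm x) (Eventually.of_forall fun w => hbd x w)
  have h := hasDerivAt_integral_of_dominated_loc_of_deriv_le (μ := M) (x₀ := x) (s := univ)
    (F := fun x w => erfWave s (a w) (b w) x * W w)
    (F' := fun x w => erfWave s (a w) (b w) x * (Complex.I * (a w * W w)) + chirp 0 (a w) x *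
      (2 * s * gaussErfDeriv (Complex.I * s) (2 * s * x - b w)) * W w)
    (bound := fun w => 6 * ‖(a w : ℂ) * W w‖ + 2 * |s| * c * ‖W w‖) univ_mem
    (Eventually.of_forall fun x => (integrable_erfWave_mul ha hb hW s x).aestronglyMeasurable)
    (integrable_erfWave_mul ha hb hW s x)
    ((hi1 x).add (hi2 x)).aestronglyMeasurable
    (Eventually.of_forall fun w x _ => by
      refine (norm_add_le _ _).trans (add_le_add ?_ (hbd x w))
      rw [norm_mul, norm_mul Complex.I, Complex.norm_I, one_mul]
      gcongr
      exact norm_erfWave_le _ _ _ _)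
    ((haW.norm.const_mul _).add (hW.norm.const_mul _))
    (Eventually.of_forall fun w x _ => by
      have := (hasDerivAt_erfWave s (a w) (b w) x).mul_const (W w)
      convert! this using 1
      ring)
  have h2 := h.2
  rw [integral_add (hi1 x) (hi2 x), hzero x, add_zero] at h2
  exact h2

variable [SFinite M]

lemma IsFourierPair.integral_mul_integral_erfWave {g γ : ℝ → ℂ} (h : IsFourierPair g γ) {r : ℝ}
    (hr : r ≠ 0) (ha : Measurable a) (hb : Measurable b) (hW : Integrable W M) (s τ : ℝ) :
    ∫ x, g (r * x) * chirp τ 0 x * ∫ w, erfWave s (a w) (b w) x * W w ∂M =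
      ∫ w, (∫ x, g (r * x) * chirp τ (a w) x * gaussErf (Complex.I * s) (2 * s * x - b w)) *
        W w ∂M := by
  have hch : ∀ x w, chirp τ 0 x * erfWave s (a w) (b w) x =
      chirp τ (a w) x * gaussErf (Complex.I * s) (2 * s * x - b w) := by
    intro x w
    rw [erfWave, ← mul_assoc, chirp_mul_chirp, add_zero, zero_add]
  have hint : Integrable (Function.uncurry fun x w =>
      g (r * x) * chirp τ 0 x * (erfWave s (a w) (b w) x * W w)) (volume.prod M) := by
    have h1 := (h.integrable_comp_mul_chirp hr τ 0).mul_prod hW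
    have h2 := h1.bdd_mul (f := fun z : ℝ × X => erfWave s (a z.2) (b z.2) z.1) (c := 6)
      ((measurable_erfWave s).comp (measurable_fst.prodMk
        ((ha.comp measurable_snd).prodMk (hb.comp measurable_snd)))).aestronglyMeasurable
      (Eventually.of_forall fun _ => norm_erfWave_le _ _ _ _)
    refine h2.congr (Eventually.of_forall fun z => ?_)
    simp only [Function.uncurry]; ring
  simp only [← integral_const_mul]
  rw [integral_integral_swap hint]
  congr 1; ext w
  rw [← integral_mul_const]
  congr 1; ext x
  linear_combination (g (r * x) * W w) * hch x w

lemma IsFourierPair.norm_integral_mul_integral_erfWave_le {g γ : ℝ → ℂ} (h : IsFourierPair g γ)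
    {r : ℝ} (hr : r ≠ 0) (ha : Measurable a) (hb : Measurable b) (hW : Integrable W M) (s : ℝ)
    {τ : ℝ} (hτ : τ ≠ 0) :
    ‖∫ x, g (r * x) * chirp τ 0 x * ∫ w, erfWave s (a w) (b w) x * W w ∂M‖ ≤
      (∫ k, ‖γ k‖) * (√(Real.pi / |τ|) * 6) * ∫ w, ‖W w‖ ∂M := by
  rw [h.integral_mul_integral_erfWave hr ha hb hW, ← integral_const_mul]
  refine norm_integral_le_of_norm_le (hW.norm.const_mul _) (Eventually.of_forall fun w => ?_)
  rw [norm_mul]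
  gcongr
  exact h.norm_integral_mul_chirp_mul_gaussErf_le hr hτ _ _ _

lemma IsFourierPair.tendsto_integral_mul_integral_erfWave {g γ : ℝ → ℂ} (h : IsFourierPair g γ)
    (heven : ∀ k, γ (-k) = γ k) (ha : Measurable a) (hb : Measurable b)
    (hW : Integrable W M) (s : ℝ) {τ : ℝ} (hτ : τ ≠ 0) :
    Tendsto (fun r : ℝ => ∫ x, g (r * x) * chirp τ 0 x * ∫ w, erfWave s (a w) (b w) x * W w ∂M)
      (𝓝[≠] 0) (𝓝 (∫ w, (∫ k, γ k) * (gaussFT (-(Complex.I * τ)) (a w) *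
        gaussErf (Complex.I * (s + s ^ 2 / τ : ℝ)) (-(a w * s / τ) - b w)) * W w ∂M)) := by
  have hev : (fun r : ℝ => ∫ w, (∫ x, g (r * x) * chirp τ (a w) x *
      gaussErf (Complex.I * s) (2 * s * x - b w)) * W w ∂M) =ᶠ[𝓝[≠] 0] fun r : ℝ =>
      ∫ x, g (r * x) * chirp τ 0 x * ∫ w, erfWave s (a w) (b w) x * W w ∂M := by
    filter_upwards [self_mem_nhdsWithin] with r hr
    rw [h.integral_mul_integral_erfWave hr ha hb hW]
  refine Tendsto.congr' hev ?_
  apply tendsto_integral_filter_of_dominated_convergence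
    (fun w => (∫ k, ‖γ k‖) * (√(Real.pi / |τ|) * 6) * ‖W w‖)
  · filter_upwards [self_mem_nhdsWithin] with r hr
    have hm : StronglyMeasurable fun w => ∫ x, g (r * x) * chirp τ (a w) x *
        gaussErf (Complex.I * s) (2 * s * x - b w) := by
      have hfun : ∀ w, ∫ x, g (r * x) * chirp τ (a w) x *
          gaussErf (Complex.I * s) (2 * s * x - b w) = ∫ k, γ k * gaussFT (-(Complex.I * τ))
            (a w + r * k) * gaussErf (Complex.I * (s + s ^ 2 / τ : ℝ))
            (-((a w + r * k) * s / τ) - b w) :=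
        fun w => h.integral_mul_chirp_mul_gaussErf hr hτ s (a w) (b w)
      simp only [hfun]
      -- A strongly measurable representative of `γ` makes the integrand jointly measurable in `(w,
      -- k)`.
      obtain ⟨γ', hγ', hγγ'⟩ := h.integrable_density.aestronglyMeasurable
      have e : ∀ w, ∫ k, γ k * gaussFT (-(Complex.I * τ))
            (a w + r * k) * gaussErf (Complex.I * (s + s ^ 2 / τ : ℝ))
            (-((a w + r * k) * s / τ) - b w) = ∫ k, γ' k * gaussFT (-(Complex.I * τ))
            (a w + r * k) * gaussErf (Complex.I * (s + s ^ 2 / τ : ℝ))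
            (-((a w + r * k) * s / τ) - b w) := by
        intro w
        apply integral_congr_ae
        filter_upwards [hγγ'] with k hk
        rw [hk]
      simp only [e]
      apply StronglyMeasurable.integral_prod_right
      apply Measurable.stronglyMeasurable
      refine Measurable.mul (Measurable.mul (hγ'.measurable.comp measurable_snd) ?_) ?_
      · exact (continuous_gaussFT _).measurable.comp (by fun_prop)
      · exact (measurable_gaussErf _).comp (by fun_prop)
    exact hm.aestronglyMeasurable.mul hW.aestronglyMeasurable
  · filter_upwards [self_mem_nhdsWithin] with r hr
    refine Eventually.of_forall fun w => ?_
    rw [norm_mul]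
    gcongr
    exact h.norm_integral_mul_chirp_mul_gaussErf_le hr hτ _ _ _
  · exact hW.norm.const_mul _
  · exact Eventually.of_forall fun w =>
      (h.tendsto_integral_mul_chirp_mul_gaussErf heven hτ s (a w) (b w)).mul_const _

end superposition

/-! ### Change of variables in improper integrals -/

lemma integral_Ioi_comp_sq (f : ℝ → ℂ) :
    ∫ l in Ioi (0 : ℝ), f l = ∫ x in Ioi (0 : ℝ), 2 * (x : ℂ) * f (x ^ 2) := by
  rw [← integral_comp_rpow_Ioi_of_pos (g := f) (p := 2) two_pos]
  apply setIntegral_congr_fun measurableSet_Ioi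
  intro x hx
  simp only
  rw [show (2 : ℝ) - 1 = 1 by norm_num, Real.rpow_one, Complex.real_smul, Real.rpow_two]
  push_cast; ring

lemma integral_eq_integral_Ioi_add_comp_neg {φ : ℝ → ℂ} (hφ : Integrable φ) :
    ∫ x, φ x = ∫ x in Ioi (0 : ℝ), (φ x + φ (-x)) := by
  rw [integral_add hφ.integrableOn hφ.comp_neg.integrableOn, integral_comp_neg_Ioi, neg_zero,
    add_comm, intervalIntegral.integral_Iic_add_Ioi hφ.integrableOn hφ.integrableOn]

/-! ### Smooth cutoffs -/

namespace IsSmoothCutoff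

variable {χ : ℝ → ℝ}

lemma contDiff_comp_sq (h : IsSmoothCutoff χ) : ContDiff ℝ ∞ fun u : ℝ => (χ (u ^ 2) : ℂ) :=
  Complex.ofRealCLM.contDiff.comp (h.contDiff.comp (contDiff_id.pow 2))

lemma comp_sq_eq_zero (h : IsSmoothCutoff χ) {u : ℝ} (hu : 2 < |u|) : (χ (u ^ 2) : ℂ) = 0 := by
  rw [h.eq_zero _ ?_, Complex.ofReal_zero]
  rw [abs_pow]; nlinarith

lemma hasCompactSupport_comp_sq (h : IsSmoothCutoff χ) :
    HasCompactSupport fun u : ℝ => (χ (u ^ 2) : ℂ) := by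
  apply HasCompactSupport.intro (isCompact_Icc (a := (-2 : ℝ)) (b := 2))
  intro u hu
  apply h.comp_sq_eq_zero
  by_contra hcon
  exact hu (abs_le.1 (not_lt.1 hcon))

end IsSmoothCutoff

lemma HasCompactSupport.comp_const_mul {g : ℝ → ℂ} (hg : HasCompactSupport g) {r : ℝ}
    (hr : r ≠ 0) : HasCompactSupport fun x => g (r * x) :=
  hg.comp_homeomorph (Homeomorph.mulLeft₀ r hr)

/-- Integration by parts against the quadratic phase `exp (i τ x²)`. -/
lemma integral_Ioi_chirp_sqrt {g K K' : ℝ → ℂ} (hg : ContDiff ℝ ∞ g) (hgc : HasCompactSupport g)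
    (hge : ∀ x, g (-x) = g x) (hK : ∀ x, HasDerivAt K (K' x) x) (hK' : Continuous K')
    (hKo : ∀ x, K (-x) = -K x) {τ r : ℝ} (hτ : τ ≠ 0) (hr : r ≠ 0) :
    ∫ x in Ioi (0 : ℝ), 2 * (x : ℂ) * (g (r * x) * (chirp τ 0 x * K x)) =
      -(1 / (2 * Complex.I * τ)) * ((∫ x, g (r * x) * chirp τ 0 x * K' x) +
        r * ∫ x, deriv g (r * x) * chirp τ 0 x * K x) := by
  have hKc : Continuous K := continuous_iff_continuousAt.2 fun x => (hK x).continuousAt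
  have hgr := hgc.comp_const_mul hr
  have hgd : Continuous (deriv g) := hg.continuous_deriv (by simp)
  have hgdr := hgc.deriv.comp_const_mul hr
  have hgcont := hg.continuous
  have hcc := continuous_chirp τ 0
  have hg' : ∀ x, HasDerivAt (fun x => g (r * x)) (r * deriv g (r * x)) x := by
    intro x
    have h1 : HasDerivAt (fun x : ℝ => r * x) r x := by
      simpa using (hasDerivAt_id x).const_mul r
    have := ((hg.differentiable (by simp)) (r * x)).hasDerivAt.scomp x h1
    simpa [Function.comp_def] using this
  have hch : ∀ x, HasDerivAt (chirp τ 0) (2 * Complex.I * τ * (x * chirp τ 0 x)) x := by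
    intro x
    have h1 : HasDerivAt (fun w : ℝ => (w : ℂ)) 1 x := Complex.ofRealCLM.hasDerivAt
    have h2 := ((h1.pow 2).const_mul (Complex.I * τ)).cexp
    have e : ∀ y : ℝ, chirp τ 0 y = Complex.exp (Complex.I * τ * (y : ℂ) ^ 2) := fun y => by
      rw [chirp]; congr 1; push_cast; ring
    rw [e x]
    refine HasDerivAt.congr_of_eventuallyEq ?_ (Eventually.of_forall e)
    convert! h2 using 1
    simp only [Pi.pow_apply]; push_cast; ring
  -- The factor `x` makes `2iτ x e^{iτx²}` an exact derivative, and the compact support of the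
  -- cutoff excludes boundary terms.
  have hparts := integral_mul_deriv_eq_deriv_mul_of_integrable
    (u := fun x => g (r * x) * K x) (v := chirp τ 0)
    (u' := fun x => r * deriv g (r * x) * K x + g (r * x) * K' x)
    (v' := fun x => 2 * Complex.I * τ * (x * chirp τ 0 x))
    (fun x _ => (hg' x).mul (hK x)) (fun x _ => hch x)
    ((by fun_prop : Continuous _).integrable_of_hasCompactSupport hgr.mul_right.mul_right)
    ((by fun_prop : Continuous _).integrable_of_hasCompactSupport
      ((hgdr.mul_left.mul_right.add hgr.mul_right).mul_right))
    ((by fun_prop : Continuous _).integrable_of_hasCompactSupport hgr.mul_right.mul_right)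
  have hi1 : Integrable fun x => g (r * x) * chirp τ 0 x * K' x :=
    (by fun_prop : Continuous _).integrable_of_hasCompactSupport hgr.mul_right.mul_right
  have hi2 : Integrable fun x => deriv g (r * x) * chirp τ 0 x * K x :=
    (by fun_prop : Continuous _).integrable_of_hasCompactSupport hgdr.mul_right.mul_right
  have hi3 : Integrable fun x : ℝ => (x : ℂ) * (g (r * x) * (chirp τ 0 x * K x)) :=
    (by fun_prop : Continuous _).integrable_of_hasCompactSupport hgr.mul_right.mul_left
  have hcodd : ∀ x, chirp τ 0 (-x) = chirp τ 0 x := fun x => by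
    simp only [chirp]; congr 1; push_cast; ring
  -- Oddness of `K` makes the integrand even; passing to the whole line removes the endpoint `0`
  -- before integrating by parts.
  have hhalf : ∫ x in Ioi (0 : ℝ), 2 * (x : ℂ) * (g (r * x) * (chirp τ 0 x * K x)) =
      ∫ x : ℝ, (x : ℂ) * (g (r * x) * (chirp τ 0 x * K x)) := by
    rw [integral_eq_integral_Ioi_add_comp_neg hi3]
    congr 1; ext x
    rw [mul_neg, hge, hcodd, hKo]
    push_cast; ring
  have hτ' : (τ : ℂ) ≠ 0 := by exact_mod_cast hτ
  have e1 : ∫ x : ℝ, g (r * x) * K x * (2 * Complex.I * τ * (x * chirp τ 0 x)) =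
      2 * Complex.I * τ * ∫ x : ℝ, (x : ℂ) * (g (r * x) * (chirp τ 0 x * K x)) := by
    rw [← integral_const_mul]; congr 1; ext x; ring
  have e2 : ∫ x : ℝ, (r * deriv g (r * x) * K x + g (r * x) * K' x) * chirp τ 0 x =
      (∫ x, g (r * x) * chirp τ 0 x * K' x) +
        r * ∫ x, deriv g (r * x) * chirp τ 0 x * K x := by
    rw [← integral_const_mul, ← integral_add hi1 (hi2.const_mul _)]
    congr 1; ext x; ring
  rw [e1, e2] at hparts
  rw [hhalf]
  rw [neg_mul, ← mul_neg, ← hparts]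
  field_simp [Complex.I_ne_zero]

lemma tendsto_inv_sqrt_atTop : Tendsto (fun R : ℝ => (√R)⁻¹) atTop (𝓝[≠] 0) := by
  apply tendsto_nhdsWithin_of_tendsto_nhds_of_eventually_within
  · exact tendsto_inv_atTop_zero.comp Real.tendsto_sqrt_atTop
  · filter_upwards [eventually_gt_atTop 0] with R hR
    exact inv_ne_zero (Real.sqrt_pos.2 hR).ne'

lemma IsSmoothCutoff.integrableOn_mul {χ : ℝ → ℝ} (h : IsSmoothCutoff χ) {f : ℝ → ℂ}
    (hf : Continuous f) {R : ℝ} (hR : 0 < R) :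
    IntegrableOn (fun l : ℝ => (χ (l / R) : ℂ) * f l) (Ioi 0) := by
  apply Integrable.integrableOn
  have hχ := h.contDiff.continuous
  apply Continuous.integrable_of_hasCompactSupport (by fun_prop)
  apply HasCompactSupport.mul_right
  apply HasCompactSupport.intro (isCompact_Icc (a := -(2 * R)) (b := 2 * R))
  intro l hl
  rw [h.eq_zero, Complex.ofReal_zero]
  rw [abs_div, abs_of_pos hR, lt_div_iff₀ hR]
  by_contra hcon
  exact hl (abs_le.1 (not_lt.1 hcon))

/-- The improper integral of `exp (i τ l) K (√l)` for an odd superposition `K` of modulated error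
functions whose derivative is such a superposition as well. -/
theorem exists_hasImproperIntegral_erfWave {X : Type*} [MeasurableSpace X] {M : Measure X}
    [SFinite M] {a b : X → ℝ} {W : X → ℂ} (ha : Measurable a) (hb : Measurable b)
    (hW : Integrable W M) (haW : Integrable (fun w => (a w : ℂ) * W w) M) {s τ : ℝ} (hτ : τ ≠ 0)
    (hzero : ∀ x : ℝ, ∫ w, chirp 0 (a w) x *
      (2 * s * gaussErfDeriv (Complex.I * s) (2 * s * x - b w)) * W w ∂M = 0)
    {K : ℝ → ℂ} (hKW : ∀ x, K x = ∫ w, erfWave s (a w) (b w) x * W w ∂M)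
    (hKo : ∀ x, K (-x) = -K x) :
    ∃ I : ℂ, HasImproperIntegral
        (fun l : ℝ => Complex.exp (Complex.I * ((τ * l : ℝ) : ℂ)) * K (√l)) I ∧
      ‖I‖ ≤ 3 * √Real.pi * |τ| ^ (-(3 / 2) : ℝ) * ∫ w, ‖(a w : ℂ) * W w‖ ∂M := by
  set K' : ℝ → ℂ := fun x => ∫ w, erfWave s (a w) (b w) x * (Complex.I * (a w * W w)) ∂M
  have hiW : Integrable (fun w => Complex.I * (a w * W w)) M := haW.const_mul _
  have hK : ∀ x, HasDerivAt K (K' x) x := fun x => by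
    have e : K = fun x => ∫ w, erfWave s (a w) (b w) x * W w ∂M := funext hKW
    rw [e]
    exact hasDerivAt_integral_erfWave_mul ha hb hW haW hzero x
  have hKc : Continuous K := continuous_iff_continuousAt.2 fun x => (hK x).continuousAt
  have hK' : Continuous K' := continuous_integral_erfWave_mul ha hb hiW s
  set J : ℂ := ∫ w, (gaussFT (-(Complex.I * τ)) (a w) *
    gaussErf (Complex.I * (s + s ^ 2 / τ : ℝ)) (-(a w * s / τ) - b w)) *
      (Complex.I * (a w * W w)) ∂M with hJ
  have habs : 0 < |τ| := abs_pos.2 hτ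
  -- `J` is the limit of `∫ g(rx) e^{iτx²} K'(x) dx` computed on the frequency side; the prefactor
  -- comes from the integration by parts.
  refine ⟨-(1 / (2 * Complex.I * τ)) * J, fun χ hχ => ⟨fun R hR => ?_, ?_⟩, ?_⟩
  · exact hχ.integrableOn_mul (f := fun l : ℝ =>
      Complex.exp (Complex.I * ((τ * l : ℝ) : ℂ)) * K (√l))
      ((by fun_prop : Continuous fun l : ℝ => Complex.exp (Complex.I * ((τ * l : ℝ) : ℂ))).mul
        (hKc.comp Real.continuous_sqrt)) hR
  · set g : ℝ → ℂ := fun u => (χ (u ^ 2) : ℂ) with hg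
    have hgs := hχ.contDiff_comp_sq
    have hgc := hχ.hasCompactSupport_comp_sq
    have hge : ∀ x, g (-x) = g x := fun x => by simp [hg]
    obtain ⟨γ, hγ, -⟩ := exists_isFourierPair hgs hgc
    obtain ⟨γ', hγ', -⟩ := exists_isFourierPair
      (contDiff_infty_iff_deriv.1 hgs).2 hgc.deriv
    have hγe := hγ.even_average hge
    have hg0 : ∫ k, 2⁻¹ * (γ k + γ (-k)) = 1 := by
      rw [hγe.integral_density]; simp [hχ.eq_one 0 (by simp)]
    have h1 := hγe.tendsto_integral_mul_integral_erfWave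
      (fun k => by simp [add_comm]) ha hb hiW s hτ
    rw [hg0] at h1
    simp only [one_mul] at h1
    -- The derivative of the cutoff carries a factor `r`, while the dispersive bound controls the
    -- remaining integral uniformly in `r`.
    have h2 : Tendsto (fun r : ℝ => (r : ℂ) * ∫ x, deriv g (r * x) * chirp τ 0 x * K x)
        (𝓝[≠] 0) (𝓝 0) := by
      have hb1 : Tendsto (fun r : ℝ => |r| * ((∫ k, ‖γ' k‖) * (√(Real.pi / |τ|) * 6) *
          ∫ w, ‖W w‖ ∂M)) (𝓝[≠] 0) (𝓝 0) := by
        have : Continuous fun r : ℝ => |r| * ((∫ k, ‖γ' k‖) * (√(Real.pi / |τ|) * 6) *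
          ∫ w, ‖W w‖ ∂M) := by fun_prop
        have := this.tendsto 0
        rw [abs_zero, zero_mul] at this
        exact this.mono_left nhdsWithin_le_nhds
      refine squeeze_zero_norm' ?_ hb1
      filter_upwards [self_mem_nhdsWithin] with r hr
      rw [norm_mul, Complex.norm_real, Real.norm_eq_abs]
      gcongr
      simp only [hKW]
      exact hγ'.norm_integral_mul_integral_erfWave_le hr ha hb hW s hτ
    have h3 := ((h1.add h2).const_mul (-(1 / (2 * Complex.I * τ)))).comp tendsto_inv_sqrt_atTop
    rw [add_zero] at h3
    refine h3.congr' ?_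
    filter_upwards [eventually_gt_atTop 0] with R hR
    have hr : (√R)⁻¹ ≠ 0 := inv_ne_zero (Real.sqrt_pos.2 hR).ne'
    have := integral_Ioi_chirp_sqrt hgs hgc hge hK hK' hKo hτ hr
    simp only [Function.comp]
    rw [← this]
    refine Eq.trans ?_ (integral_Ioi_comp_sq _).symm
    apply setIntegral_congr_fun measurableSet_Ioi
    intro x hx
    simp only
    rw [Real.sqrt_sq (le_of_lt hx)]
    congr 2
    · rw [mul_pow, inv_pow, Real.sq_sqrt hR.le]
      congr 2; ring
    · rw [chirp]; congr 3; push_cast; ring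
  · have hJn : ‖J‖ ≤ √(Real.pi / |τ|) * 6 * ∫ w, ‖(a w : ℂ) * W w‖ ∂M := by
      rw [hJ, ← integral_const_mul]
      refine norm_integral_le_of_norm_le (haW.norm.const_mul _) (Eventually.of_forall fun w => ?_)
      rw [norm_mul, norm_mul Complex.I, Complex.norm_I, one_mul, norm_mul]
      gcongr
      · exact norm_gaussFT_neg_I_mul_le hτ _
      · exact norm_gaussErf_I_mul_le _ _
    rw [norm_mul, norm_neg, norm_div, norm_one, norm_mul, norm_mul, Complex.norm_two,
      Complex.norm_I, Complex.norm_real, Real.norm_eq_abs]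
    have hpow : |τ| ^ (-(3 / 2) : ℝ) = (1 / |τ|) * (1 / √|τ|) := by
      rw [show (-(3 / 2) : ℝ) = -1 + -(1 / 2) by norm_num, Real.rpow_add habs, Real.rpow_neg_one,
        Real.rpow_neg habs.le, ← Real.sqrt_eq_rpow, one_div, one_div]
    -- Here `1/(2|τ|)` from the integration by parts, `√(π/|τ|)` from the Fresnel factor and `6`
    -- from the error function combine to `3 √π |τ|^{-3/2}`.
    calc _ ≤ 1 / (2 * 1 * |τ|) * (√(Real.pi / |τ|) * 6 * ∫ w, ‖(a w : ℂ) * W w‖ ∂M) := by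
          gcongr
      _ = _ := by
        rw [hpow, Real.sqrt_div Real.pi_pos.le]
        ring

/-! ### Complex measures with a density -/

lemma norm_chirp_zero_mul (x ξ : ℝ) (z : ℂ) : ‖chirp 0 ξ x * z‖ = ‖z‖ := by
  rw [norm_mul, norm_chirp, one_mul]

lemma chirp_zero_comm (x ξ : ℝ) : chirp 0 ξ x = chirp 0 x ξ := by
  simp only [chirp]; congr 3; ring

lemma integrable_chirp_zero_mul {m : Measure ℝ} {u : ℝ → ℂ} (hu : Integrable u m) (x : ℝ) :
    Integrable (fun ξ => chirp 0 ξ x * u ξ) m := by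
  simp only [chirp_zero_comm x]
  exact hu.bdd_mul (c := 1) (continuous_chirp 0 x).aestronglyMeasurable
    (Eventually.of_forall fun ξ => (norm_chirp _ _ _).le)

/-- The positive and negative parts of `u` define finite measures with the same characteristic
function, so they coincide. -/
lemma ae_eq_zero_of_forall_integral_chirp_real {m : Measure ℝ} [SFinite m] {u : ℝ → ℝ}
    (hu : Integrable u m) (h : ∀ x, ∫ ξ, chirp 0 ξ x * (u ξ : ℂ) ∂m = 0) : u =ᵐ[m] 0 := by
  have hum : AEMeasurable u m := hu.aemeasurable
  set P := m.withDensity fun ξ => ENNReal.ofReal (u ξ)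
  set N := m.withDensity fun ξ => ENNReal.ofReal (-u ξ)
  have hP : IsFiniteMeasure P := isFiniteMeasure_withDensity_ofReal hu.2
  have hN : IsFiniteMeasure N := isFiniteMeasure_withDensity_ofReal hu.neg.2
  have key : ∀ (v : ℝ → ℝ), Integrable v m → ∀ x : ℝ,
      charFun (m.withDensity fun ξ => ENNReal.ofReal (v ξ)) x =
        ∫ ξ, chirp 0 ξ x * ((max (v ξ) 0 : ℝ) : ℂ) ∂m := by
    intro v hv x
    rw [charFun_apply_real, integral_withDensity_eq_integral_toReal_smul₀
      hv.aemeasurable.ennreal_ofReal (Eventually.of_forall fun ξ => ENNReal.ofReal_lt_top)]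
    congr 1; ext ξ
    rw [ENNReal.toReal_ofReal', Complex.real_smul, chirp, mul_comm]
    congr 2; push_cast; ring
  have hPN : P = N := by
    apply Measure.ext_of_charFun
    ext x
    rw [key u hu x, key (fun ξ => -u ξ) hu.neg x, ← sub_eq_zero, ← integral_sub, ← h x]
    · congr 1; ext ξ
      rw [← mul_sub, ← Complex.ofReal_sub]
      congr 2
      rcases le_total 0 (u ξ) with h0 | h0
      · rw [max_eq_left h0, max_eq_right (by linarith), sub_zero]
      · rw [max_eq_right h0, max_eq_left (by linarith)]; ring
    · exact integrable_chirp_zero_mul hu.pos_part.ofReal x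
    · exact integrable_chirp_zero_mul hu.neg.pos_part.ofReal x
  have := (withDensity_eq_iff hum.ennreal_ofReal hum.neg.ennreal_ofReal
    (lt_of_le_of_lt (lintegral_mono fun x => Real.ofReal_le_enorm (u x)) hu.2).ne).1 hPN
  filter_upwards [this] with ξ hξ
  simp only [Pi.neg_apply, Pi.zero_apply] at hξ ⊢
  rcases le_total 0 (u ξ) with h0 | h0
  · rw [ENNReal.ofReal_of_nonpos (p := -u ξ) (by linarith), ENNReal.ofReal_eq_zero] at hξ
    exact le_antisymm hξ h0
  · rw [ENNReal.ofReal_of_nonpos h0, eq_comm, ENNReal.ofReal_eq_zero] at hξ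
    exact le_antisymm h0 (by linarith)

/-- A density is determined by its Fourier transform. -/
theorem ae_eq_zero_of_forall_integral_chirp {m : Measure ℝ} [SFinite m] {u : ℝ → ℂ}
    (hu : Integrable u m) (h : ∀ x, ∫ ξ, chirp 0 ξ x * u ξ ∂m = 0) : u =ᵐ[m] 0 := by
  have hu' : Integrable (fun ξ => (starRingEnd ℂ) (u ξ)) m :=
    Complex.conjCLE.toContinuousLinearMap.integrable_comp hu
  -- Conjugating the hypothesis at `-x` gives it for the conjugate density, hence for the real and
  -- imaginary parts separately.
  have h' : ∀ x, ∫ ξ, chirp 0 ξ x * (starRingEnd ℂ) (u ξ) ∂m = 0 := by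
    intro x
    have := congrArg (starRingEnd ℂ) (h (-x))
    rw [← integral_conj, map_zero] at this
    rw [← this]
    congr 1; ext ξ
    rw [map_mul, chirp, chirp, ← Complex.exp_conj, map_mul, Complex.conj_I, Complex.conj_ofReal]
    congr 2; push_cast; ring
  have hre := ae_eq_zero_of_forall_integral_chirp_real hu.re fun x => by
    have : ∀ ξ, chirp 0 ξ x * ((RCLike.re (u ξ) : ℝ) : ℂ) =
        2⁻¹ * (chirp 0 ξ x * u ξ + chirp 0 ξ x * (starRingEnd ℂ) (u ξ)) := fun ξ => by
      rw [← mul_add, Complex.add_conj]; simp; ring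
    simp only [this]
    rw [integral_const_mul, integral_add (integrable_chirp_zero_mul hu x)
      (integrable_chirp_zero_mul hu' x), h, h', add_zero, mul_zero]
  have him := ae_eq_zero_of_forall_integral_chirp_real hu.im fun x => by
    have : ∀ ξ, chirp 0 ξ x * ((RCLike.im (u ξ) : ℝ) : ℂ) =
        (2 * Complex.I)⁻¹ * (chirp 0 ξ x * u ξ - chirp 0 ξ x * (starRingEnd ℂ) (u ξ)) := fun ξ => by
      rw [← mul_sub, Complex.sub_conj]; field_simp; simp; ring
    simp only [this]
    rw [integral_const_mul, integral_sub (integrable_chirp_zero_mul hu x)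
      (integrable_chirp_zero_mul hu' x), h, h', sub_zero, mul_zero]
  filter_upwards [hre, him] with ξ h1 h2
  exact Complex.ext h1 h2

section
variable {X : Type*} [MeasurableSpace X]

lemma SimpleFunc.integral_withDensity_vectorMeasure {m : Measure X} {w : X → ℂ}
    (hw : Integrable w m) (f : SimpleFunc X ℂ) :
    (m.withDensityᵥ w).integral f (ContinuousLinearMap.mul ℝ ℂ) = ∫ x, f x * w x ∂m := by
  have hfin : IsFiniteMeasure (m.withDensityᵥ w).variation := by
    rw [Measure.variation_withDensityᵥ hw]
    exact isFiniteMeasure_withDensity hw.2.ne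
  induction f using SimpleFunc.induction with
  | const c hs =>
    rename_i s
    have e : ⇑(SimpleFunc.piecewise s hs (SimpleFunc.const X c) (SimpleFunc.const X 0)) =
        s.indicator fun _ => c := by
      classical
      rw [SimpleFunc.coe_piecewise]; ext x; by_cases hx : x ∈ s <;> simp [hx]
    rw [e, VectorMeasure.integral_indicator_const c hs, withDensityᵥ_apply hw hs,
      ContinuousLinearMap.mul_apply', ← integral_const_mul, ← integral_indicator hs]
    congr 1; ext x
    by_cases hx : x ∈ s <;> simp [hx]
  | add hd hf hg =>
    rename_i f g
    have hi : ∀ f : SimpleFunc X ℂ, Integrable (fun x => f x * w x) m := fun f => by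
      obtain ⟨C, hC⟩ := f.exists_forall_norm_le
      exact hw.bdd_mul (c := C) f.aestronglyMeasurable (Eventually.of_forall hC)
    rw [SimpleFunc.coe_add, VectorMeasure.integral_add
      (SimpleFunc.integrable_of_isFiniteMeasure f) (SimpleFunc.integrable_of_isFiniteMeasure g),
      hf, hg, ← integral_add (hi f) (hi g)]
    congr 1; ext x; simp [add_mul]

/-- Bounded simple approximations and dominated convergence on both sides; constants are dominating
functions for the vector measure because its variation is finite. -/
lemma integral_withDensity_vectorMeasure {m : Measure X} {w : X → ℂ} (hw : Integrable w m)
    {f : X → ℂ} (hf : StronglyMeasurable f) {c : ℝ} (hc : ∀ x, ‖f x‖ ≤ c) :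
    (m.withDensityᵥ w).integral f (ContinuousLinearMap.mul ℝ ℂ) = ∫ x, f x * w x ∂m := by
  have hfin : IsFiniteMeasure (m.withDensityᵥ w).variation := by
    rw [Measure.variation_withDensityᵥ hw]
    exact isFiniteMeasure_withDensity hw.2.ne
  by_cases hX : Nonempty X
  swap
  · have := not_nonempty_iff.1 hX
    rw [VectorMeasure.integral_of_isEmpty, integral_of_isEmpty]
  have hc0 : 0 ≤ c := (norm_nonneg _).trans (hc hX.some)
  have h1 := VectorMeasure.tendsto_integral_of_dominated_convergence
    (μ := m.withDensityᵥ w) (B := ContinuousLinearMap.mul ℝ ℂ) (f := f)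
    (fun _ => c) (fun n => (hf.approxBounded c n).aestronglyMeasurable)
    (integrable_const _) (fun n => Eventually.of_forall fun x => hf.norm_approxBounded_le hc0 n x)
    (Eventually.of_forall fun x => hf.tendsto_approxBounded_of_norm_le (hc x))
  have h2 : Tendsto (fun n => ∫ x, hf.approxBounded c n x * w x ∂m) atTop
      (𝓝 (∫ x, f x * w x ∂m)) := by
    apply tendsto_integral_of_dominated_convergence (fun x => c * ‖w x‖)
      (fun n => (hf.approxBounded c n).aestronglyMeasurable.mul hw.1) (hw.norm.const_mul c)
    · refine fun n => Eventually.of_forall fun x => ?_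
      rw [Pi.mul_apply, norm_mul]
      gcongr
      exact hf.norm_approxBounded_le hc0 n x
    · exact Eventually.of_forall fun x => (hf.tendsto_approxBounded_of_norm_le (hc x)).mul_const _
  refine tendsto_nhds_unique h1 (h2.congr fun n => ?_)
  exact (SimpleFunc.integral_withDensity_vectorMeasure hw _).symm

/-- A measure dominating a complex measure. -/
noncomputable def ComplexMeasure.dominating (ν : ComplexMeasure X) : Measure X :=
  (ComplexMeasure.re ν).totalVariation + (ComplexMeasure.im ν).totalVariation

instance (ν : ComplexMeasure X) : IsFiniteMeasure (ComplexMeasure.dominating ν) := by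
  unfold ComplexMeasure.dominating; infer_instance

/-- The Radon–Nikodym theorem for complex measures. -/
theorem exists_withDensity_eq (ν : ComplexMeasure X) {m : Measure X} [SigmaFinite m]
    (h : ComplexMeasure.dominating ν ≤ m) :
    ∃ w : X → ℂ, Measurable w ∧ Integrable w m ∧ m.withDensityᵥ w = ν := by
  have hac : ∀ σ : SignedMeasure X, σ.totalVariation ≤ m →
      σ ≪ᵥ m.toENNRealVectorMeasure := by
    intro σ hσ
    refine VectorMeasure.AbsolutelyContinuous.mk fun s hs h0 => ?_
    rw [Measure.toENNRealVectorMeasure_apply_measurable hs] at h0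
    have := (σ.enorm_le_totalVariation s).trans ((Measure.le_iff'.1 hσ s).trans h0.le)
    simpa using this
  have hr := hac (ComplexMeasure.re ν) (le_trans (Measure.le_add_right le_rfl) h)
  have hi := hac (ComplexMeasure.im ν) (le_trans (Measure.le_add_left le_rfl) h)
  set u := (ComplexMeasure.re ν).rnDeriv m
  set v := (ComplexMeasure.im ν).rnDeriv m
  have hu : Integrable u m := SignedMeasure.integrable_rnDeriv _ _
  have hv : Integrable v m := SignedMeasure.integrable_rnDeriv _ _
  have hw : Integrable (fun x => (u x : ℂ) + Complex.I * v x) m :=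
    hu.ofReal.add (hv.ofReal.const_mul _)
  refine ⟨fun x => (u x : ℂ) + Complex.I * v x, ?_, hw, ?_⟩
  · have h1 : Measurable u := SignedMeasure.measurable_rnDeriv _ _
    have h2 : Measurable v := SignedMeasure.measurable_rnDeriv _ _
    fun_prop
  · ext s hs
    rw [withDensityᵥ_apply hw hs, integral_add hu.ofReal.integrableOn.integrable
      (hv.ofReal.const_mul _).integrableOn.integrable, integral_const_mul]
    have e1 : ∫ x in s, u x ∂m = (ν s).re := by
      rw [← withDensityᵥ_apply hu hs, SignedMeasure.withDensityᵥ_rnDeriv_eq _ _ hr]; rfl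
    have e2 : ∫ x in s, v x ∂m = (ν s).im := by
      rw [← withDensityᵥ_apply hv hs, SignedMeasure.withDensityᵥ_rnDeriv_eq _ _ hi]; rfl
    have e1' : ∫ x in s, (u x : ℂ) ∂m = ((ν s).re : ℂ) := by rw [← e1]; exact integral_ofReal
    have e2' : ∫ x in s, (v x : ℂ) ∂m = ((ν s).im : ℂ) := by rw [← e2]; exact integral_ofReal
    rw [e1', e2', mul_comm, Complex.re_add_im]

end

/-! ### Functions whose Fourier transform is a finite measure -/

/-- `G` is a superposition of plane waves with the weight `w`, which has a finite first moment. -/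
structure HasSpectralDensity (G : ℝ → ℂ) (m : Measure ℝ) (w : ℝ → ℂ) : Prop where
  integrable : Integrable w m
  integrable_mul : Integrable (fun ξ : ℝ => (ξ : ℂ) * w ξ) m
  eq_integral : ∀ x, G x = ∫ ξ, chirp 0 ξ x * w ξ ∂m

/-- The factor `1/(2π)` of the inversion formula is absorbed into the density. Since the variation
of `m.withDensityᵥ w` has density `|w|`, the `L¹` norm does not depend on the choice of `m`. -/
theorem HasFourierMeasure.exists_density {G : ℝ → ℂ} {ν : ComplexMeasure ℝ}
    (hG : HasFourierMeasure G ν) {m : Measure ℝ} [SigmaFinite m]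
    (hm : ComplexMeasure.dominating ν ≤ m) :
    ∃ w : ℝ → ℂ, Measurable w ∧ Integrable w m ∧ (∀ x, G x = ∫ ξ, chirp 0 ξ x * w ξ ∂m) ∧
      ∫ ξ, ‖w ξ‖ ∂m = (2 * Real.pi)⁻¹ * totalVariationNorm ν := by
  obtain ⟨w, hwm, hw, hwν⟩ := exists_withDensity_eq ν hm
  refine ⟨fun ξ => (2 * (Real.pi : ℂ))⁻¹ * w ξ, hwm.const_mul _, hw.const_mul _, fun x => ?_, ?_⟩
  · rw [hG x, ← hwν, integral_withDensity_vectorMeasure hw (c := 1)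
      (Continuous.stronglyMeasurable (by fun_prop)), ← integral_const_mul]
    · congr 1; ext ξ
      rw [chirp]
      have : (0 * x ^ 2 + ξ * x : ℝ) = x * ξ := by ring
      rw [this]; ring
    · intro ξ
      rw [mul_comm, Complex.norm_exp_ofReal_mul_I]
  · have e : ‖(2 * (Real.pi : ℂ))⁻¹‖ = (2 * Real.pi)⁻¹ := by
      rw [norm_inv, norm_mul, Complex.norm_two, Complex.norm_real, Real.norm_eq_abs,
        abs_of_pos Real.pi_pos]
    simp only [norm_mul, e]
    rw [integral_const_mul, totalVariationNorm, ← hwν, Measure.variation_withDensityᵥ hw,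
      withDensity_apply _ MeasurableSet.univ, setLIntegral_univ,
      integral_norm_eq_lintegral_enorm hw.1]

/-- With `w`, `w'` the densities of `G`, `G'` over a common `m`, the point is that `iξ w = w'`
almost everywhere. Writing `G(x+h) - G(x) = ∫₀^h G'(x+r) dr` and using uniqueness gives `(e^{iξh} -
1) w = (∫₀^h e^{iξr} dr) w'` for each `h`; dividing by `h → 0` gives the relation. Hence `w` has a
first moment, with norm given by the measure of `G'`. -/
theorem HasFourierMeasure.exists_hasSpectralDensity {G : ℝ → ℂ} {ν ν' : ComplexMeasure ℝ}
    (hd : Differentiable ℝ G) (hG : HasFourierMeasure G ν) (hG' : HasFourierMeasure (deriv G) ν')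
    {m : Measure ℝ} [IsFiniteMeasure m] (hm : ComplexMeasure.dominating ν ≤ m)
    (hm' : ComplexMeasure.dominating ν' ≤ m) :
    ∃ w : ℝ → ℂ, HasSpectralDensity G m w ∧
      ∫ ξ, ‖w ξ‖ ∂m = (2 * Real.pi)⁻¹ * totalVariationNorm ν ∧
      ∫ ξ, ‖(ξ : ℂ) * w ξ‖ ∂m = (2 * Real.pi)⁻¹ * totalVariationNorm ν' := by
  obtain ⟨w, -, hw, hwG, hwn⟩ := hG.exists_density hm
  obtain ⟨w', -, hw', hwG', hwn'⟩ := hG'.exists_density hm'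
  have hcont : Continuous (deriv G) := by
    have : deriv G = fun x => ∫ ξ, chirp 0 ξ x * w' ξ ∂m := funext hwG'
    rw [this]
    refine continuous_of_dominated (bound := fun ξ => ‖w' ξ‖)
      (fun x => (integrable_chirp_zero_mul hw' x).1)
      (fun x => Eventually.of_forall fun ξ => (norm_chirp_zero_mul _ _ _).le) hw'.norm
      (Eventually.of_forall fun ξ => (continuous_chirp 0 ξ).mul continuous_const)
  have hjoint : Continuous fun p : ℝ × ℝ => chirp 0 p.2 p.1 := by
    unfold chirp; fun_prop
  have hφ : ∀ h ξ : ℝ, ‖∫ r in (0 : ℝ)..h, chirp 0 ξ r‖ ≤ |h| := fun h ξ => by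
    have := intervalIntegral.norm_integral_le_of_norm_le_const (a := 0) (b := h) (C := 1)
      (f := chirp 0 ξ) (fun r _ => (norm_chirp _ _ _).le)
    simpa using this
  have hφc : ∀ h : ℝ, Continuous fun ξ => ∫ r in (0 : ℝ)..h, chirp 0 ξ r := fun h =>
    intervalIntegral.continuous_parametric_intervalIntegral_of_continuous'
      (by unfold Function.uncurry chirp; fun_prop) _ _
  have hmain : ∀ h : ℝ, ∀ᵐ ξ ∂m, (chirp 0 ξ h - 1) * w ξ =
      (∫ r in (0 : ℝ)..h, chirp 0 ξ r) * w' ξ := by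
    intro h
    have hi1 : Integrable (fun ξ => (chirp 0 ξ h - 1) * w ξ) m := by
      have := (integrable_chirp_zero_mul hw h).sub hw
      refine this.congr (Eventually.of_forall fun ξ => ?_)
      simp only [Pi.sub_apply]; ring
    have hi2 : Integrable (fun ξ => (∫ r in (0 : ℝ)..h, chirp 0 ξ r) * w' ξ) m :=
      hw'.bdd_mul (c := |h|) (hφc h).aestronglyMeasurable (Eventually.of_forall (hφ h))
    have := ae_eq_zero_of_forall_integral_chirp (hi1.sub hi2) fun x => by
      have hadd : ∀ ξ r : ℝ, chirp 0 ξ x * chirp 0 ξ r = chirp 0 ξ (x + r) := fun ξ r => by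
        simp only [chirp]; rw [← Complex.exp_add]; congr 1; push_cast; ring
      have e1 : ∫ ξ, chirp 0 ξ x * ((chirp 0 ξ h - 1) * w ξ) ∂m = G (x + h) - G x := by
        rw [hwG, hwG, ← integral_sub (integrable_chirp_zero_mul hw _)
          (integrable_chirp_zero_mul hw _)]
        congr 1; ext ξ
        rw [← hadd]; ring
      have e2 : ∫ ξ, chirp 0 ξ x * ((∫ r in (0 : ℝ)..h, chirp 0 ξ r) * w' ξ) ∂m =
          ∫ r in (0 : ℝ)..h, deriv G (x + r) := by
        simp only [hwG']
        rw [intervalIntegral_integral_swap]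
        · congr 1; ext ξ
          rw [intervalIntegral.integral_mul_const]
          simp only [← hadd]
          rw [intervalIntegral.integral_const_mul]; ring
        · have : IsFiniteMeasure ((volume : Measure ℝ).restrict (uIoc 0 h)) := by
            unfold uIoc; infer_instance
          have hj : Continuous fun p : ℝ × ℝ => chirp 0 p.2 (x + p.1) :=
            hjoint.comp (f := fun p : ℝ × ℝ => (x + p.1, p.2)) (by fun_prop)
          exact (hw'.comp_snd ((volume : Measure ℝ).restrict (uIoc 0 h))).bdd_mul (c := 1)
            hj.aestronglyMeasurable (Eventually.of_forall fun p => (norm_chirp _ _ _).le)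
      have e3 : ∫ r in (0 : ℝ)..h, deriv G (x + r) = G (x + h) - G x := by
        rw [intervalIntegral.integral_comp_add_left, add_zero]
        exact intervalIntegral.integral_deriv_eq_sub (fun y _ => hd y)
          (hcont.intervalIntegrable _ _)
      simp only [Pi.sub_apply, mul_sub]
      rw [integral_sub (integrable_chirp_zero_mul hi1 x) (integrable_chirp_zero_mul hi2 x), e1, e2,
        e3, sub_self]
    filter_upwards [this] with ξ hξ
    exact sub_eq_zero.1 hξ
  have hrel : ∀ᵐ ξ ∂m, Complex.I * ξ * w ξ = w' ξ := by
    -- A countable sequence of increments, so that a single null set serves them all.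
    have := ae_all_iff.2 fun n : ℕ => hmain (1 / ((n : ℝ) + 1))
    filter_upwards [this] with ξ hξ
    have hlim : Tendsto (fun n : ℕ => (1 / ((n : ℝ) + 1))) atTop (𝓝[≠] 0) :=
      tendsto_nhdsWithin_of_tendsto_nhds_of_eventually_within _
        tendsto_one_div_add_atTop_nhds_zero_nat
        (Eventually.of_forall fun n => (by positivity : (1 / ((n : ℝ) + 1)) ≠ 0))
    have h1 : HasDerivAt (chirp 0 ξ) (Complex.I * ξ) 0 := by
      simpa [chirp] using hasDerivAt_chirp ξ 0
    have h2 : HasDerivAt (fun h => ∫ r in (0 : ℝ)..h, chirp 0 ξ r) 1 0 := by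
      have := intervalIntegral.integral_hasDerivAt_right
        ((continuous_chirp 0 ξ).intervalIntegrable 0 0)
        ((continuous_chirp 0 ξ).stronglyMeasurableAtFilter _ _) (continuous_chirp 0 ξ).continuousAt
      simpa [chirp] using this
    have t1 := (h1.tendsto_slope_zero.comp hlim).mul_const (w ξ)
    have t2 := (h2.tendsto_slope_zero.comp hlim).mul_const (w' ξ)
    rw [one_mul] at t2
    refine tendsto_nhds_unique t1 (t2.congr fun n => ?_)
    simp only [Function.comp, zero_add, intervalIntegral.integral_same, sub_zero, smul_mul_assoc]
    rw [← hξ n]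
    simp [chirp]
  have hmom : (fun ξ : ℝ => (ξ : ℂ) * w ξ) =ᵐ[m] fun ξ => -Complex.I * w' ξ := by
    filter_upwards [hrel] with ξ hξ
    rw [← hξ]; linear_combination ((ξ : ℂ) * w ξ) * Complex.I_sq
  refine ⟨w, ⟨hw, (hw'.const_mul _).congr hmom.symm, hwG⟩, hwn, ?_⟩
  rw [← hwn']
  apply integral_congr_ae
  filter_upwards [hmom] with ξ hξ
  rw [hξ]; simp

/-- Over a symmetric measure, oddness of `G` and uniqueness of densities give `w(-ξ) = -w(ξ)` almost
everywhere. -/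
theorem HasSpectralDensity.integral_comp_neg_mul {G : ℝ → ℂ} {m : Measure ℝ} [SFinite m]
    [m.IsNegInvariant] {w : ℝ → ℂ} (h : HasSpectralDensity G m w) (ho : Function.Odd G)
    (f : ℝ → ℂ) : ∫ ξ, f (-ξ) * w ξ ∂m = -∫ ξ, f ξ * w ξ ∂m := by
  have hneg : Integrable (fun ξ => w (-ξ)) m := h.integrable.comp_neg
  have := ae_eq_zero_of_forall_integral_chirp (hneg.add h.integrable) fun x => by
    have e : ∫ ξ, chirp 0 ξ x * w (-ξ) ∂m = G (-x) := by
      rw [h.eq_integral, ← integral_neg_eq_self]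
      congr 1; ext ξ
      rw [neg_neg]; congr 1
      simp only [chirp]; congr 3; ring
    simp only [Pi.add_apply, mul_add]
    rw [integral_add (integrable_chirp_zero_mul hneg x) (integrable_chirp_zero_mul h.integrable x),
      e, ← h.eq_integral, ho, neg_add_cancel]
  rw [← integral_neg_eq_self, ← integral_neg]
  apply integral_congr_ae
  filter_upwards [this] with ξ hξ
  simp only [Pi.add_apply, Pi.zero_apply] at hξ
  rw [neg_neg, eq_neg_of_add_eq_zero_left hξ, mul_neg]

theorem HasSpectralDensity.integral_even_mul {G : ℝ → ℂ} {m : Measure ℝ} [SFinite m]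
    [m.IsNegInvariant] {w : ℝ → ℂ} (h : HasSpectralDensity G m w) (ho : Function.Odd G)
    {f : ℝ → ℂ} (hf : ∀ ξ, f (-ξ) = f ξ) : ∫ ξ, f ξ * w ξ ∂m = 0 := by
  have := h.integral_comp_neg_mul ho f
  simp only [hf] at this
  exact self_eq_neg.1 this

instance (m : Measure ℝ) : (m + m.neg).IsNegInvariant where
  neg_eq_self := by
    rw [Measure.neg, Measure.map_add _ _ measurable_neg, ← Measure.neg, ← Measure.neg,
      Measure.neg_neg, add_comm]

/-- A function whose Fourier transform and whose derivative's Fourier transform are finite measures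
has a spectral density with respect to a finite symmetric measure. -/
theorem HasFourierMeasure.exists_symmetric_hasSpectralDensity {G : ℝ → ℂ} {ν ν' : ComplexMeasure ℝ}
    (hd : Differentiable ℝ G) (hG : HasFourierMeasure G ν) (hG' : HasFourierMeasure (deriv G) ν') :
    ∃ m : Measure ℝ, IsFiniteMeasure m ∧ m.IsNegInvariant ∧ ∃ w : ℝ → ℂ, HasSpectralDensity G m w ∧
      ∫ ξ, ‖w ξ‖ ∂m = (2 * Real.pi)⁻¹ * totalVariationNorm ν ∧
      ∫ ξ, ‖(ξ : ℂ) * w ξ‖ ∂m = (2 * Real.pi)⁻¹ * totalVariationNorm ν' := by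
  -- Any dominating finite measure will do, so it may be symmetrized without affecting the norms.
  set n := ComplexMeasure.dominating ν + ComplexMeasure.dominating ν'
  have hn : IsFiniteMeasure n.neg := by unfold Measure.neg; infer_instance
  refine ⟨n + n.neg, inferInstance, inferInstance, ?_⟩
  exact hG.exists_hasSpectralDensity hd hG'
    (Measure.le_add_right (Measure.le_add_right le_rfl))
    (Measure.le_add_right (Measure.le_add_left le_rfl))

/-! ### Products with a function that has a spectral density -/

lemma chirp_zero_add (ξ ζ x : ℝ) : chirp 0 (ξ + ζ) x = chirp 0 ξ x * chirp 0 ζ x := by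
  simp only [chirp]; rw [← Complex.exp_add]; congr 1; push_cast; ring

/-- The product lives on the product measure with frequency `ξ + ζ`, and the Leibniz rule becomes
`(ξ+ζ) v w = v (ζ w) + (ξ v) w`. The error function involves only `ζ`, so the cancellation `hzero`
is inherited from the second factor. -/
lemma HasSpectralDensity.exists_hasImproperIntegral_mul {F : ℝ → ℂ} {n m : Measure ℝ} [SFinite n]
    [SFinite m] {v w : ℝ → ℂ} (hF : HasSpectralDensity F n v) (hw : Integrable w m)
    (hζw : Integrable (fun ζ : ℝ => (ζ : ℂ) * w ζ) m) {b : ℝ → ℝ} (hb : Measurable b) {s τ : ℝ}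
    (hτ : τ ≠ 0)
    (hzero : ∀ x : ℝ, ∫ ζ, chirp 0 ζ x *
      (2 * s * gaussErfDeriv (Complex.I * s) (2 * s * x - b ζ)) * w ζ ∂m = 0)
    {P : ℝ → ℂ} (hP : ∀ x, P x = ∫ ζ, erfWave s ζ (b ζ) x * w ζ ∂m)
    (hodd : ∀ x, F (-x) * P (-x) = -(F x * P x)) :
    ∃ I : ℂ, HasImproperIntegral
        (fun l : ℝ => Complex.exp (Complex.I * ((τ * l : ℝ) : ℂ)) * (F (√l) * P (√l))) I ∧
      ‖I‖ ≤ 3 * √Real.pi * |τ| ^ (-(3 / 2) : ℝ) *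
        ((∫ ξ, ‖v ξ‖ ∂n) * (∫ ζ, ‖(ζ : ℂ) * w ζ‖ ∂m) +
          (∫ ξ, ‖(ξ : ℂ) * v ξ‖ ∂n) * ∫ ζ, ‖w ζ‖ ∂m) := by
  have hW : Integrable (fun p : ℝ × ℝ => v p.1 * w p.2) (n.prod m) := hF.integrable.mul_prod hw
  have h1 := hF.integrable.mul_prod hζw
  have h2 := hF.integrable_mul.mul_prod hw
  have e : (fun p : ℝ × ℝ => ((p.1 + p.2 : ℝ) : ℂ) * (v p.1 * w p.2)) =
      fun p => v p.1 * (p.2 * w p.2) + p.1 * v p.1 * w p.2 := by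
    ext p; push_cast; ring
  have haW : Integrable (fun p : ℝ × ℝ => ((p.1 + p.2 : ℝ) : ℂ) * (v p.1 * w p.2)) (n.prod m) := by
    rw [e]; exact h1.add h2
  obtain ⟨I, hI, hIn⟩ := exists_hasImproperIntegral_erfWave (M := n.prod m)
    (a := fun p : ℝ × ℝ => p.1 + p.2) (b := fun p => b p.2)
    (W := fun p => v p.1 * w p.2) (measurable_fst.add measurable_snd) (hb.comp measurable_snd) hW
    haW (s := s) hτ (fun x => by
      have : ∀ p : ℝ × ℝ, chirp 0 (p.1 + p.2) x *
          (2 * s * gaussErfDeriv (Complex.I * s) (2 * s * x - b p.2)) * (v p.1 * w p.2) =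
          (chirp 0 p.1 x * v p.1) * (chirp 0 p.2 x *
          (2 * s * gaussErfDeriv (Complex.I * s) (2 * s * x - b p.2)) * w p.2) := fun p => by
        rw [chirp_zero_add]; ring
      simp only [this]
      rw [integral_prod_mul (fun ξ => chirp 0 ξ x * v ξ) (fun ζ => chirp 0 ζ x *
          (2 * s * gaussErfDeriv (Complex.I * s) (2 * s * x - b ζ)) * w ζ), hzero, mul_zero])
    (K := fun x => F x * P x) (fun x => by
      have : ∀ p : ℝ × ℝ, erfWave s (p.1 + p.2) (b p.2) x * (v p.1 * w p.2) =
          (chirp 0 p.1 x * v p.1) * (erfWave s p.2 (b p.2) x * w p.2) := fun p => by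
        rw [erfWave, erfWave, chirp_zero_add]; ring
      simp only [this]
      rw [integral_prod_mul (fun ξ => chirp 0 ξ x * v ξ) (fun ζ => erfWave s ζ (b ζ) x * w ζ),
        hP, hF.eq_integral]) hodd
  refine ⟨I, hI, hIn.trans ?_⟩
  gcongr
  calc ∫ p : ℝ × ℝ, ‖((p.1 + p.2 : ℝ) : ℂ) * (v p.1 * w p.2)‖ ∂(n.prod m)
      ≤ ∫ p : ℝ × ℝ, (‖v p.1‖ * ‖(p.2 : ℂ) * w p.2‖ + ‖(p.1 : ℂ) * v p.1‖ * ‖w p.2‖)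
          ∂(n.prod m) := by
        refine integral_mono haW.norm ((hF.integrable.norm.mul_prod hζw.norm).add
          (hF.integrable_mul.norm.mul_prod hw.norm)) fun p => ?_
        have := congrFun e p
        simp only at this ⊢
        rw [this]
        refine (norm_add_le _ _).trans (le_of_eq ?_)
        simp only [norm_mul]
    _ = _ := by
        rw [integral_add (hF.integrable.norm.mul_prod hζw.norm)
          (hF.integrable_mul.norm.mul_prod hw.norm),
          integral_prod_mul (fun ξ => ‖v ξ‖) (fun ζ : ℝ => ‖(ζ : ℂ) * w ζ‖),
          integral_prod_mul (fun ξ : ℝ => ‖(ξ : ℂ) * v ξ‖) (fun ζ => ‖w ζ‖)]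

/-- The first estimate: a product of an even and an odd function. -/
theorem HasSpectralDensity.exists_hasImproperIntegral_even_mul_odd {F G : ℝ → ℂ} {n m : Measure ℝ}
    [SFinite n] [SFinite m] {v w : ℝ → ℂ} (hF : HasSpectralDensity F n v)
    (hG : HasSpectralDensity G m w) (hFe : Function.Even F) (hGo : Function.Odd G) {τ : ℝ}
    (hτ : τ ≠ 0) :
    ∃ I : ℂ, HasImproperIntegral
        (fun l : ℝ => Complex.exp (Complex.I * ((τ * l : ℝ) : ℂ)) * (F (√l) * G (√l))) I ∧
      ‖I‖ ≤ 3 * √Real.pi * |τ| ^ (-(3 / 2) : ℝ) *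
        ((∫ ξ, ‖v ξ‖ ∂n) * (∫ ζ, ‖(ζ : ℂ) * w ζ‖ ∂m) +
          (∫ ξ, ‖(ξ : ℂ) * v ξ‖ ∂n) * ∫ ζ, ‖w ζ‖ ∂m) := by
  -- With `s = 0` and `b = -1` the error function is `sign 1 = 1`, so only plane waves remain.
  refine hF.exists_hasImproperIntegral_mul hG.integrable hG.integrable_mul
    (b := fun _ => -1) measurable_const (s := 0) hτ (fun x => by simp) (fun x => ?_)
    (fun x => by rw [hFe, hGo, mul_neg])
  rw [hG.eq_integral]
  congr 1; ext ζ
  rw [erfWave]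
  simp [gaussErf_zero_left]

/-- The Hilbert transform of `η ↦ exp (-i s η) G (√η)` on the half-line is
`λ ↦ exp (-i s λ) erfSuperposition s m w (√λ)` when `G` has the spectral density `w`. -/
noncomputable def erfSuperposition (s : ℝ) (m : Measure ℝ) (w : ℝ → ℂ) (x : ℝ) : ℂ :=
  ∫ ζ, erfWave s ζ ζ x * (Complex.I * w ζ) ∂m

/-- Reflecting `x` amounts to reflecting `ζ` and changing the sign of the error function; the
oddness of `w` supplies a second sign. -/
lemma HasSpectralDensity.erfSuperposition_neg {G : ℝ → ℂ} {m : Measure ℝ} [SFinite m]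
    [m.IsNegInvariant] {w : ℝ → ℂ} (hG : HasSpectralDensity G m w) (hGo : Function.Odd G)
    (s x : ℝ) : erfSuperposition s m w (-x) = erfSuperposition s m w x := by
  have e : ∀ ζ y : ℝ, erfWave s ζ ζ y * (Complex.I * w ζ) = (Complex.I * erfWave s ζ ζ y) * w ζ :=
    fun ζ y => by ring
  unfold erfSuperposition
  simp only [e]
  have h := hG.integral_comp_neg_mul hGo fun ζ => Complex.I * erfWave s ζ ζ x
  rw [← neg_eq_iff_eq_neg, ← integral_neg] at h
  rw [← h]
  congr 1; ext ζ
  rw [← neg_mul]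
  congr 1
  rw [← mul_neg]
  congr 1
  rw [erfWave, erfWave, show 2 * s * -x - ζ = -(2 * s * x - -ζ) by ring, gaussErf_neg, mul_neg]
  congr 2
  simp only [chirp]; congr 3; ring

/-- The second estimate, for the Hilbert transform of a phase times an odd function. -/
theorem HasSpectralDensity.exists_hasImproperIntegral_odd_mul_erfSuperposition {F G : ℝ → ℂ}
    {n m : Measure ℝ} [SFinite n] [SFinite m] [m.IsNegInvariant] {v w : ℝ → ℂ}
    (hF : HasSpectralDensity F n v) (hG : HasSpectralDensity G m w) (hFo : Function.Odd F)
    (hGo : Function.Odd G) (s : ℝ) {τ : ℝ} (hτ : τ ≠ 0) :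
    ∃ I : ℂ, HasImproperIntegral (fun l : ℝ => Complex.exp (Complex.I * ((τ * l : ℝ) : ℂ)) *
        (F (√l) * erfSuperposition s m w (√l))) I ∧
      ‖I‖ ≤ 3 * √Real.pi * |τ| ^ (-(3 / 2) : ℝ) *
        ((∫ ξ, ‖v ξ‖ ∂n) * (∫ ζ, ‖(ζ : ℂ) * w ζ‖ ∂m) +
          (∫ ξ, ‖(ξ : ℂ) * v ξ‖ ∂n) * ∫ ζ, ‖w ζ‖ ∂m) := by
  have h := hF.exists_hasImproperIntegral_mul (m := m) (w := fun ζ => Complex.I * w ζ)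
    (hG.integrable.const_mul Complex.I)
    ((hG.integrable_mul.const_mul Complex.I).congr (Eventually.of_forall fun ζ => by
      simp only; ring))
    (b := fun ζ => ζ) measurable_id (s := s) hτ (fun x => ?_)
    (P := erfSuperposition s m w) (fun x => rfl)
    (fun x => by rw [hFo, hG.erfSuperposition_neg hGo, neg_mul])
  · simpa [norm_mul] using h
  · rcases eq_or_ne s 0 with rfl | hs
    · simp
    have hs' : (s : ℂ) ≠ 0 := by exact_mod_cast hs
    -- The cancellation: `e^{iζx} e^{i(2sx-ζ)²/(4s)} = e^{isx²} e^{iζ²/(4s)}`. The cross term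
    -- disappears exactly because wave and shift share the same `ζ`, and what remains is even in `ζ`
    -- against an odd density.
    have e : ∀ ζ : ℝ, chirp 0 ζ x * (2 * s * gaussErfDeriv (Complex.I * s) (2 * s * x - ζ)) *
        (Complex.I * w ζ) = (2 * s * Complex.I * gaussErfDeriv (Complex.I * s) 0 * chirp s 0 x) *
          (Complex.exp (Complex.I / (4 * s) * (ζ : ℂ) ^ 2) * w ζ) := by
      intro ζ
      have : chirp 0 ζ x * gaussErfDeriv (Complex.I * s) (2 * s * x - ζ) =
          gaussErfDeriv (Complex.I * s) 0 * chirp s 0 x *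
            Complex.exp (Complex.I / (4 * s) * (ζ : ℂ) ^ 2) := by
        simp only [gaussErfDeriv, chirp]
        have key : Complex.exp (Complex.I * ((0 * x ^ 2 + ζ * x : ℝ) : ℂ)) *
            Complex.exp (-(1 / (4 * (Complex.I * s))) * ((2 * s * x - ζ : ℝ) : ℂ) ^ 2) =
            Complex.exp (-(1 / (4 * (Complex.I * s))) * ((0 : ℝ) : ℂ) ^ 2) *
            Complex.exp (Complex.I * ((s * x ^ 2 + 0 * x : ℝ) : ℂ)) *
            Complex.exp (Complex.I / (4 * s) * (ζ : ℂ) ^ 2) := by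
          rw [← Complex.exp_add, ← Complex.exp_add, ← Complex.exp_add]
          congr 1
          have hI := Complex.I_ne_zero
          push_cast
          field_simp
          ring_nf
          simp only [Complex.I_sq]
          ring
        linear_combination ((Real.pi : ℂ)⁻¹ * (Real.pi / (Complex.I * s)) ^ (1 / 2 : ℂ)) * key
      linear_combination 2 * (s : ℂ) * Complex.I * w ζ * this
    simp only [e]
    rw [integral_const_mul, hG.integral_even_mul hGo (fun ζ => by simp), mul_zero]

/-! ### The kernel `sin (b u) / u` -/

lemma abs_sin_mul_div_le (b u : ℝ) : |Real.sin (b * u) / u| ≤ |b| := by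
  rcases eq_or_ne u 0 with rfl | hu
  · simp
  rw [abs_div, div_le_iff₀ (abs_pos.2 hu), ← abs_mul]
  exact Real.abs_sin_le_abs

lemma integral_Ioi_cexp_mul_cos {p : ℂ} (hp : 0 < p.re) (b : ℝ) :
    ∫ u in Ioi (0 : ℝ), Complex.exp (-p * (u : ℂ) ^ 2) * (Real.cos (b * u) : ℂ) =
      Real.pi / 2 * gaussErfDeriv p b := by
  have hint : ∀ c : ℂ, Integrable fun u : ℝ => Complex.exp (-p * (u : ℂ) ^ 2 + c * u) := fun c => by
    simpa using integrable_cexp_quadratic hp c 0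
  have h1 := integral_eq_integral_Ioi_add_comp_neg (hint (Complex.I * b))
  have h2 : ∀ u : ℝ, Complex.exp (-p * (u : ℂ) ^ 2 + Complex.I * b * u) +
      Complex.exp (-p * ((-u : ℝ) : ℂ) ^ 2 + Complex.I * b * ((-u : ℝ) : ℂ)) =
      2 * (Complex.exp (-p * (u : ℂ) ^ 2) * (Real.cos (b * u) : ℂ)) := by
    intro u
    rw [Complex.exp_add, Complex.exp_add, Complex.ofReal_cos, Complex.cos]
    push_cast
    rw [neg_sq, show Complex.I * b * -(u : ℂ) = -(b * u) * Complex.I by ring,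
      show Complex.I * b * (u : ℂ) = (b * u) * Complex.I by ring]
    ring
  simp only [h2] at h1
  rw [integral_const_mul] at h1
  have h3 := fourierIntegral_gaussian hp b
  have h4 : ∫ u : ℝ, Complex.exp (-p * (u : ℂ) ^ 2 + Complex.I * b * u) =
      (Real.pi / p) ^ (1 / 2 : ℂ) * Complex.exp (-(b : ℂ) ^ 2 / (4 * p)) := by
    rw [← h3]; congr 1; ext u; rw [← Complex.exp_add]; ring_nf
  have hpi : (Real.pi : ℂ) ≠ 0 := by exact_mod_cast Real.pi_ne_zero
  rw [h4] at h1
  rw [gaussErfDeriv, show -(1 / (4 * p)) * (b : ℂ) ^ 2 = -(b : ℂ) ^ 2 / (4 * p) by ring]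
  have h5 : ∫ u in Ioi (0 : ℝ), Complex.exp (-p * (u : ℂ) ^ 2) * (Real.cos (b * u) : ℂ) =
      2⁻¹ * ((Real.pi / p) ^ (1 / 2 : ℂ) * Complex.exp (-(b : ℂ) ^ 2 / (4 * p))) := by
    rw [h1]; ring
  rw [h5]
  field_simp

/-- Differentiation in `b` removes the singular factor `1/u` and gives a Gaussian cosine transform;
both sides vanish at `b = 0`. -/
lemma integral_Ioi_cexp_mul_sin_div {p : ℂ} (hp : 0 < p.re) (b : ℝ) :
    ∫ u in Ioi (0 : ℝ), Complex.exp (-p * (u : ℂ) ^ 2) * ((Real.sin (b * u) / u : ℝ) : ℂ) =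
      Real.pi / 2 * gaussErf p b := by
  have hp0 : p ≠ 0 := fun h => by simp [h] at hp
  have hE : Continuous fun u : ℝ => Complex.exp (-p * (u : ℂ) ^ 2) := by fun_prop
  have hEi : Integrable fun u : ℝ => Complex.exp (-p * (u : ℂ) ^ 2) := by
    simpa using integrable_cexp_quadratic hp 0 0
  have hm : ∀ b : ℝ, AEStronglyMeasurable (fun u : ℝ => Complex.exp (-p * (u : ℂ) ^ 2) *
      ((Real.sin (b * u) / u : ℝ) : ℂ)) (volume.restrict (Ioi 0)) := fun b =>
    (hE.measurable.mul (Complex.measurable_ofReal.comp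
      (((Real.continuous_sin.comp (continuous_const.mul continuous_id)).measurable).div
        measurable_id))).aestronglyMeasurable
  have hd : ∀ b : ℝ, HasDerivAt (fun b : ℝ => ∫ u in Ioi (0 : ℝ),
      Complex.exp (-p * (u : ℂ) ^ 2) * ((Real.sin (b * u) / u : ℝ) : ℂ))
      (Real.pi / 2 * gaussErfDeriv p b) b := by
    intro b
    rw [← integral_Ioi_cexp_mul_cos hp b]
    refine (hasDerivAt_integral_of_dominated_loc_of_deriv_le
      (F := fun (b u : ℝ) => Complex.exp (-p * (u : ℂ) ^ 2) * ((Real.sin (b * u) / u : ℝ) : ℂ))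
      (F' := fun (b u : ℝ) => Complex.exp (-p * (u : ℂ) ^ 2) * (Real.cos (b * u) : ℂ))
      (bound := fun u : ℝ => ‖Complex.exp (-p * (u : ℂ) ^ 2)‖)
      univ_mem (Eventually.of_forall hm) ?_ ?_ ?_ hEi.norm.integrableOn ?_).2
    · refine (hEi.norm.const_mul |b|).integrableOn.mono' (hm b) (Eventually.of_forall fun u => ?_)
      rw [norm_mul, mul_comm, Complex.norm_real, Real.norm_eq_abs]
      exact mul_le_mul_of_nonneg_right (abs_sin_mul_div_le b u) (norm_nonneg _)
    · exact (by fun_prop : Continuous _).aestronglyMeasurable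
    · refine Eventually.of_forall fun u b _ => ?_
      rw [norm_mul, Complex.norm_real, Real.norm_eq_abs]
      exact mul_le_of_le_one_right (norm_nonneg _) (Real.abs_cos_le_one _)
    · refine (ae_restrict_iff' measurableSet_Ioi).2 (Eventually.of_forall fun u hu b _ => ?_)
      have hu' : u ≠ 0 := (ne_of_gt hu)
      have h1 : HasDerivAt (fun b : ℝ => Real.sin (b * u) / u) (Real.cos (b * u)) b := by
        have := (((hasDerivAt_id b).mul_const u).sin).div_const u
        convert! this using 1
        simp [hu']
      exact (h1.ofReal_comp).const_mul _
  have hd2 : ∀ b : ℝ, HasDerivAt (fun b : ℝ => (∫ u in Ioi (0 : ℝ),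
      Complex.exp (-p * (u : ℂ) ^ 2) * ((Real.sin (b * u) / u : ℝ) : ℂ)) -
        Real.pi / 2 * gaussErf p b) 0 b := fun b => by
    have := (hd b).sub ((hasDerivAt_gaussErf hp0 b).const_mul (Real.pi / 2 : ℂ))
    rwa [sub_self] at this
  have := is_const_of_deriv_eq_zero (fun b => (hd2 b).differentiableAt)
    (fun b => (hd2 b).deriv) b 0
  simp only [gaussErf_zero_right] at this
  simpa [sub_eq_zero] using this

/-! ### Principal values of superpositions of chirps -/

section
variable {X : Type*} [MeasurableSpace X] {M : Measure X} [SFinite M] {b : X → ℝ} {W : X → ℂ}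

/-- The cross terms `e^{±2isxu}` of the squared phase join the linear phases `e^{∓ibu}` into a sine
of frequency `2sx - b`. -/
lemma chirp_sub_chirp (s b x u : ℝ) :
    chirp (-s) b (x - u) - chirp (-s) b (x + u) = 2 * Complex.I * chirp (-s) 0 x * chirp 0 b x *
      (Complex.exp (-(Complex.I * s) * (u : ℂ) ^ 2) * (Real.sin ((2 * s * x - b) * u) : ℂ)) := by
  rw [Complex.ofReal_sin, Complex.sin]
  have h1 : chirp (-s) b (x - u) = chirp (-s) 0 x * chirp 0 b x *
      Complex.exp (-(Complex.I * s) * (u : ℂ) ^ 2) *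
        Complex.exp (((((2 * s * x - b) * u : ℝ)) : ℂ) * Complex.I) := by
    simp only [chirp]
    rw [← Complex.exp_add, ← Complex.exp_add, ← Complex.exp_add]
    congr 1; push_cast; ring
  have h2 : chirp (-s) b (x + u) = chirp (-s) 0 x * chirp 0 b x *
      Complex.exp (-(Complex.I * s) * (u : ℂ) ^ 2) *
        Complex.exp (-((((2 * s * x - b) * u : ℝ)) : ℂ) * Complex.I) := by
    simp only [chirp]
    rw [← Complex.exp_add, ← Complex.exp_add, ← Complex.exp_add]
    congr 1; push_cast; ring
  rw [h1, h2]
  linear_combination (-(chirp (-s) 0 x * chirp 0 b x *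
      Complex.exp (-(Complex.I * s) * (u : ℂ) ^ 2)) *
      (Complex.exp (-((((2 * s * x - b) * u : ℝ)) : ℂ) * Complex.I) -
        Complex.exp (((((2 * s * x - b) * u : ℝ)) : ℂ) * Complex.I))) * Complex.I_sq

/-- The damping `δ` justifies Fubini: `|sin(cu)/u| ≤ |c|`, and the first moment of `W` makes this
bound integrable in `w`. -/
lemma integral_Ioi_gaussian_mul_symm_diff (hb : Measurable b) (hW : Integrable W M)
    (hbW : Integrable (fun w => (b w : ℂ) * W w) M) (s x : ℝ) {δ : ℝ} (hδ : 0 < δ) {k : ℝ → ℂ}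
    (hk : ∀ y, k y = ∫ w, chirp (-s) (b w) y * W w ∂M) :
    ∫ u in Ioi (0 : ℝ), Complex.exp (-(δ : ℂ) * (u : ℂ) ^ 2) * ((k (x - u) - k (x + u)) / u) =
      Real.pi * Complex.I * chirp (-s) 0 x *
        ∫ w, chirp 0 (b w) x * gaussErf (δ + Complex.I * s) (2 * s * x - b w) * W w ∂M := by
  have hki : ∀ y, Integrable (fun w => chirp (-s) (b w) y * W w) M := fun y => by
    have hm : Measurable fun w => chirp (-s) (b w) y := by unfold chirp; fun_prop
    exact hW.bdd_mul (c := 1) hm.aestronglyMeasurable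
      (Eventually.of_forall fun w => (norm_chirp _ _ _).le)
  set p : ℂ := δ + Complex.I * s with hp
  have hpre : 0 < p.re := by simpa [hp] using hδ
  set Ψ : ℝ → X → ℂ := fun u w => (Complex.exp (-p * (u : ℂ) ^ 2) *
    ((Real.sin ((2 * s * x - b w) * u) / u : ℝ) : ℂ)) * (chirp 0 (b w) x * W w) with hΨ
  have hpt : ∀ u : ℝ, Complex.exp (-(δ : ℂ) * (u : ℂ) ^ 2) * ((k (x - u) - k (x + u)) / u) =
      2 * Complex.I * chirp (-s) 0 x * ∫ w, Ψ u w ∂M := by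
    intro u
    rw [hk, hk, ← integral_sub (hki _) (hki _), ← integral_div, ← integral_const_mul,
      ← integral_const_mul]
    congr 1; ext w
    rw [← sub_mul, chirp_sub_chirp, hΨ]
    have : Complex.exp (-p * (u : ℂ) ^ 2) = Complex.exp (-(δ : ℂ) * (u : ℂ) ^ 2) *
        Complex.exp (-(Complex.I * s) * (u : ℂ) ^ 2) := by
      rw [← Complex.exp_add, hp]; congr 1; ring
    simp only [this]
    push_cast
    ring
  simp only [hpt]
  rw [integral_const_mul]
  have hint : Integrable (Function.uncurry Ψ) ((volume.restrict (Ioi 0)).prod M) := by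
    have h1 : Integrable (fun u : ℝ => ‖Complex.exp (-p * (u : ℂ) ^ 2)‖)
        (volume.restrict (Ioi 0)) := by
      have : Integrable fun u : ℝ => Complex.exp (-p * (u : ℂ) ^ 2) := by
        simpa using integrable_cexp_quadratic hpre 0 0
      exact this.norm.integrableOn
    have h2 : Integrable (fun w => ‖((2 * s * x : ℝ) : ℂ) * W w - b w * W w‖) M :=
      ((hW.const_mul _).sub hbW).norm
    refine (h1.mul_prod h2).mono' ?_ (Eventually.of_forall fun z => ?_)
    · have hc : Measurable fun z : ℝ × X => chirp 0 (b z.2) x := by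
        unfold chirp; fun_prop
      have hs : Measurable fun z : ℝ × X => (Complex.exp (-p * (z.1 : ℂ) ^ 2) *
          ((Real.sin ((2 * s * x - b z.2) * z.1) / z.1 : ℝ) : ℂ)) := by
        fun_prop
      exact hs.aestronglyMeasurable.mul (hc.aestronglyMeasurable.mul hW.1.comp_snd)
    · simp only [Function.uncurry, hΨ]
      rw [norm_mul, norm_mul, norm_chirp_zero_mul, mul_assoc, ← sub_mul, norm_mul,
        Complex.norm_real, ← Complex.ofReal_sub, Complex.norm_real]
      gcongr
      exact abs_sin_mul_div_le _ _
  rw [integral_integral_swap hint]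
  have hin : ∀ w, ∫ u in Ioi (0 : ℝ), Ψ u w =
      Real.pi / 2 * (chirp 0 (b w) x * gaussErf p (2 * s * x - b w) * W w) := by
    intro w
    simp only [hΨ]
    rw [integral_mul_const, integral_Ioi_cexp_mul_sin_div hpre]
    ring
  simp only [hin]
  rw [integral_const_mul]
  ring

/-- The symmetric form of the principal value of a superposition of chirps. -/
theorem integral_Ioi_symm_diff (hb : Measurable b) (hW : Integrable W M)
    (hbW : Integrable (fun w => (b w : ℂ) * W w) M) (s x : ℝ) {k : ℝ → ℂ}
    (hk : ∀ y, k y = ∫ w, chirp (-s) (b w) y * W w ∂M)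
    (hint : IntegrableOn (fun u : ℝ => (k (x - u) - k (x + u)) / u) (Ioi 0)) :
    ∫ u in Ioi (0 : ℝ), (k (x - u) - k (x + u)) / u =
      Real.pi * Complex.I * chirp (-s) 0 x * ∫ w, erfWave s (b w) (b w) x * W w ∂M := by
  have h1 : Tendsto (fun δ : ℝ => ∫ u in Ioi (0 : ℝ),
      Complex.exp (-(δ : ℂ) * (u : ℂ) ^ 2) * ((k (x - u) - k (x + u)) / u)) (𝓝[>] 0)
      (𝓝 (∫ u in Ioi (0 : ℝ), (k (x - u) - k (x + u)) / u)) := by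
    apply tendsto_integral_filter_of_dominated_convergence
      (fun u : ℝ => ‖(k (x - u) - k (x + u)) / u‖)
    · exact Eventually.of_forall fun δ => (by fun_prop : Continuous fun u : ℝ =>
        Complex.exp (-(δ : ℂ) * (u : ℂ) ^ 2)).aestronglyMeasurable.mul hint.1
    · filter_upwards [self_mem_nhdsWithin] with δ hδ
      refine Eventually.of_forall fun u => ?_
      rw [norm_mul, norm_cexp_neg_mul_sq, Complex.ofReal_re]
      refine mul_le_of_le_one_left (norm_nonneg _) (Real.exp_le_one_iff.2 ?_)
      have : (0 : ℝ) < δ := hδ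
      nlinarith [mul_nonneg this.le (sq_nonneg u)]
    · exact hint.norm
    · refine Eventually.of_forall fun u => ?_
      have : Continuous fun δ : ℝ =>
          Complex.exp (-(δ : ℂ) * (u : ℂ) ^ 2) * ((k (x - u) - k (x + u)) / u) := by fun_prop
      have := (this.tendsto 0).mono_left (nhdsWithin_le_nhds (s := Ioi 0))
      simpa using this
  have hcm : Measurable fun w => chirp 0 (b w) x := by
    unfold chirp; fun_prop
  have h2 : Tendsto (fun δ : ℝ => ∫ w, chirp 0 (b w) x *
      gaussErf (δ + Complex.I * s) (2 * s * x - b w) * W w ∂M) (𝓝[>] 0)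
      (𝓝 (∫ w, erfWave s (b w) (b w) x * W w ∂M)) := by
    apply tendsto_integral_filter_of_dominated_convergence (fun w => 6 * ‖W w‖)
    · refine Eventually.of_forall fun δ => (hcm.mul ((measurable_gaussErf _).comp
        (measurable_const.sub hb))).aestronglyMeasurable.mul hW.1
    · filter_upwards [self_mem_nhdsWithin] with δ hδ
      refine Eventually.of_forall fun w => ?_
      rw [norm_mul, norm_mul, norm_chirp, one_mul]
      gcongr
      refine norm_gaussErf_le ?_ _
      simpa using le_of_lt (show (0 : ℝ) < δ from hδ)
    · exact hW.norm.const_mul 6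
    · refine Eventually.of_forall fun w => ?_
      exact ((tendsto_gaussErf_param s (2 * s * x - b w)).const_mul _).mul_const _
  refine tendsto_nhds_unique h1 ((h2.const_mul (Real.pi * Complex.I * chirp (-s) 0 x)).congr' ?_)
  filter_upwards [self_mem_nhdsWithin] with δ hδ
  exact (integral_Ioi_gaussian_mul_symm_diff hb hW hbW s x hδ hk).symm

end

/-! ### Principal values after the substitution `η = y²` -/

lemma integrableOn_symm_diff_div {k : ℝ → ℂ} {L : NNReal} (hk : LipschitzWith L k)
    (hkc : HasCompactSupport k) (x : ℝ) :
    IntegrableOn (fun u : ℝ => (k (x - u) - k (x + u)) / u) (Ioi 0) := by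
  obtain ⟨A, hA⟩ := hkc.isCompact.isBounded.subset_closedBall 0
  have hzero : ∀ y, A < |y| → k y = 0 := fun y hy => by
    by_contra hne
    have := hA (subset_tsupport k hne)
    rw [mem_closedBall_zero_iff, Real.norm_eq_abs] at this
    linarith
  have hm : AEStronglyMeasurable (fun u : ℝ => (k (x - u) - k (x + u)) / u)
      (volume.restrict (Ioi 0)) := by
    have := hk.continuous.measurable
    exact Measurable.aestronglyMeasurable (by fun_prop)
  have hdom : Integrable ((Icc (0 : ℝ) (|A| + |x|)).indicator fun _ => 2 * (L : ℝ)) :=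
    (integrable_indicator_iff measurableSet_Icc).2 (integrableOn_const (by simp))
  refine hdom.integrableOn.mono' hm ((ae_restrict_iff' measurableSet_Ioi).2
    (Eventually.of_forall fun u hu => ?_))
  have hu0 : (0 : ℝ) < u := hu
  by_cases huA : u ≤ |A| + |x|
  · rw [indicator_of_mem (show u ∈ Icc (0 : ℝ) (|A| + |x|) from ⟨hu0.le, huA⟩), norm_div,
      Complex.norm_real, Real.norm_eq_abs, abs_of_pos hu0, div_le_iff₀ hu0]
    have := hk.dist_le_mul (x - u) (x + u)
    rw [dist_eq_norm, dist_eq_norm, Real.norm_eq_abs, show x - u - (x + u) = -(2 * u) by ring,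
      abs_neg, abs_of_pos (by linarith)] at this
    linarith
  · push Not at huA
    have h1 : k (x - u) = 0 := hzero _ (by
      have := abs_sub_abs_le_abs_sub u x
      rw [abs_sub_comm, abs_of_pos hu0] at this
      linarith [le_abs_self A])
    have h2 : k (x + u) = 0 := hzero _ (by
      have := abs_sub_abs_le_abs_sub u (-x)
      rw [sub_neg_eq_add, abs_neg, abs_of_pos hu0, add_comm] at this
      linarith [le_abs_self A])
    rw [h1, h2, sub_zero, zero_div, norm_zero]
    exact indicator_nonneg (fun _ _ => by positivity) _

section
variable {k : ℝ → ℂ} {x ε : ℝ}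

lemma integrableOn_div_of_lt_abs_sq_sub (hk : Continuous k) (hkc : HasCompactSupport k)
    (hε : 0 < ε) : IntegrableOn (fun y : ℝ => k y / ((x - y : ℝ) : ℂ)) {y | ε < |x ^ 2 - y ^ 2|} := by
  have hA : MeasurableSet {y : ℝ | ε < |x ^ 2 - y ^ 2|} :=
    measurableSet_lt measurable_const (by fun_prop)
  have hi : Integrable fun y : ℝ => k y * ((x + y : ℝ) : ℂ) :=
    (by fun_prop : Continuous _).integrable_of_hasCompactSupport hkc.mul_right
  refine (hi.norm.div_const ε).integrableOn.mono' ?_ ((ae_restrict_iff' hA).2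
    (Eventually.of_forall fun y hy => ?_))
  · have := hk.measurable
    exact Measurable.aestronglyMeasurable (by fun_prop)
  · have hy' : ε < |x ^ 2 - y ^ 2| := hy
    rw [show x ^ 2 - y ^ 2 = (x + y) * (x - y) by ring, abs_mul] at hy'
    have h0 : 0 < |x - y| := by
      by_contra hcon
      have : |x - y| = 0 := le_antisymm (not_lt.1 hcon) (abs_nonneg _)
      rw [this, mul_zero] at hy'
      linarith
    rw [norm_div, norm_mul, Complex.norm_real, Complex.norm_real, Real.norm_eq_abs,
      Real.norm_eq_abs, div_le_div_iff₀ h0 hε, mul_assoc]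
    gcongr

lemma integrableOn_div_of_lt_abs_sub (hk : Continuous k) (hkc : HasCompactSupport k)
    (hε : 0 < ε) : IntegrableOn (fun y : ℝ => k y / ((x - y : ℝ) : ℂ)) {y | ε < |x - y|} := by
  have hA : MeasurableSet {y : ℝ | ε < |x - y|} :=
    measurableSet_lt measurable_const (by fun_prop)
  have hi : Integrable k := hk.integrable_of_hasCompactSupport hkc
  refine (hi.norm.div_const ε).integrableOn.mono' ?_ ((ae_restrict_iff' hA).2
    (Eventually.of_forall fun y hy => ?_))
  · have := hk.measurable
    exact Measurable.aestronglyMeasurable (by fun_prop)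
  · have hy' : ε < |x - y| := hy
    rw [norm_div, Complex.norm_real, Real.norm_eq_abs]
    gcongr

/-- With `η = y²` the kernel becomes `2y/(x²-y²) = 1/(x-y) - 1/(x+y)`; by oddness of `k` the second
term is the contribution of the negative half-line to the first. -/
lemma setIntegral_div_sq_sub (hk : Continuous k) (hkc : HasCompactSupport k)
    (hko : ∀ y, k (-y) = -k y) (hε : 0 < ε) {F : ℝ → ℂ} (hF : ∀ y, 0 < y → F (y ^ 2) = k y)
    (hF0 : ∀ η, η < 0 → F η = 0) :
    ∫ η in {η : ℝ | ε < |x ^ 2 - η|}, F η / ((x ^ 2 - η : ℝ) : ℂ) =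
      ∫ y in {y : ℝ | ε < |x ^ 2 - y ^ 2|}, k y / ((x - y : ℝ) : ℂ) := by
  have hS : MeasurableSet {η : ℝ | ε < |x ^ 2 - η|} :=
    measurableSet_lt measurable_const (by fun_prop)
  have hA : MeasurableSet {y : ℝ | ε < |x ^ 2 - y ^ 2|} :=
    measurableSet_lt measurable_const (by fun_prop)
  rw [← integral_indicator hS, ← integral_indicator hA,
    integral_eq_integral_Ioi_add_comp_neg
      ((integrable_indicator_iff hA).2 (integrableOn_div_of_lt_abs_sq_sub hk hkc hε)),
    ← setIntegral_eq_integral_of_ae_compl_eq_zero (s := Ioi 0), integral_Ioi_comp_sq]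
  · apply setIntegral_congr_fun measurableSet_Ioi
    intro y hy
    have hy0 : (0 : ℝ) < y := hy
    simp only [indicator, mem_ofPred_eq, neg_sq, hF y hy0, hko, sub_neg_eq_add]
    split_ifs with h
    · have hne : (x + y) * (x - y) ≠ 0 := by
        intro h0
        rw [show x ^ 2 - y ^ 2 = (x + y) * (x - y) by ring, h0, abs_zero] at h
        linarith
      have h1 : (x : ℂ) + y ≠ 0 := by exact_mod_cast left_ne_zero_of_mul hne
      have h2 : (x : ℂ) - y ≠ 0 := by exact_mod_cast right_ne_zero_of_mul hne
      push_cast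
      rw [show (x : ℂ) ^ 2 - (y : ℂ) ^ 2 = (x + y) * (x - y) by ring]
      field_simp
      ring
    · simp
  · filter_upwards [Measure.ae_ne volume (0 : ℝ)] with η hη h
    have : F η = 0 := hF0 η (lt_of_le_of_ne (not_lt.1 h) hη)
    simp [indicator, this]

lemma setIntegral_div_sub_eq_Ioi (hk : Continuous k) (hkc : HasCompactSupport k) (hε : 0 < ε) :
    ∫ y in {y : ℝ | ε < |x - y|}, k y / ((x - y : ℝ) : ℂ) =
      ∫ u in Ioi (0 : ℝ), (Ioi ε).indicator (fun u : ℝ => (k (x - u) - k (x + u)) / u) u := by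
  have hB : MeasurableSet {y : ℝ | ε < |x - y|} :=
    measurableSet_lt measurable_const (by fun_prop)
  have hint := (integrable_indicator_iff hB).2
    (integrableOn_div_of_lt_abs_sub (x := x) hk hkc hε)
  rw [← integral_indicator hB, ← integral_sub_left_eq_self _ _ x,
    integral_eq_integral_Ioi_add_comp_neg (hint.comp_sub_left x)]
  apply setIntegral_congr_fun measurableSet_Ioi
  intro u hu
  have hu0 : (0 : ℝ) < u := hu
  simp only [indicator, mem_ofPred_eq, sub_sub_cancel, abs_neg, abs_of_pos hu0, sub_neg_eq_add,
    mem_Ioi, sub_add_cancel_left]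
  split_ifs with h
  · push_cast; rw [div_neg, ← sub_eq_add_neg, sub_div]
  · simp

/-- With `α, β = √(x² ∓ ε)`, excising `|x²-y²| ≤ ε` removes more than the interval of radius `β - x`
about `x`. The excess near `x` has length at most `(β-x)(β-α)/(x+α)`, which absorbs the kernel bound
`1/(β-x)`; the rest lies in `[-β,-α]`, where the kernel is at most `1/x`. -/
lemma norm_setIntegral_sdiff_le (hx : 0 < x) (hε : 0 < ε) (hεx : ε < x ^ 2) {C : ℝ}
    (hC : ∀ y, ‖k y‖ ≤ C) :
    ‖∫ y in {y : ℝ | √(x ^ 2 + ε) - x < |x - y|} \ {y : ℝ | ε < |x ^ 2 - y ^ 2|},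
      k y / ((x - y : ℝ) : ℂ)‖ ≤ 2 * (C / x * (√(x ^ 2 + ε) - √(x ^ 2 - ε))) := by
  set α := √(x ^ 2 - ε)
  set β := √(x ^ 2 + ε)
  have hC0 : 0 ≤ C := (norm_nonneg _).trans (hC 0)
  have hα2 : α ^ 2 = x ^ 2 - ε := Real.sq_sqrt (by linarith)
  have hβ2 : β ^ 2 = x ^ 2 + ε := Real.sq_sqrt (by positivity)
  have hα0 : 0 ≤ α := Real.sqrt_nonneg _
  have hβ0 : 0 ≤ β := Real.sqrt_nonneg _
  have hxβ : x < β := by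
    by_contra hcon
    nlinarith
  have hαx : α < x := by
    by_contra hcon
    nlinarith
  have hlen : x - (β - x) - α = (β - x) * ((β - α) / (x + α)) := by
    have : x + α ≠ 0 := by positivity
    field_simp
    nlinarith
  have hlen0 : 0 ≤ x - (β - x) - α := by
    rw [hlen]
    have : 0 < x + α := by positivity
    have h1 : 0 ≤ β - x := by linarith
    have h2 : 0 ≤ β - α := by linarith
    positivity
  have hBA : MeasurableSet ({y : ℝ | β - x < |x - y|} \ {y : ℝ | ε < |x ^ 2 - y ^ 2|}) :=
    (measurableSet_lt measurable_const (by fun_prop)).diff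
      (measurableSet_lt measurable_const (by fun_prop))
  have hdom : ∀ (a b c : ℝ), Integrable ((Icc a b).indicator fun _ : ℝ => c) := fun a b c =>
    (integrable_indicator_iff measurableSet_Icc).2 (integrableOn_const (by simp))
  rw [← integral_indicator hBA]
  refine (norm_integral_le_of_norm_le ((hdom α (x - (β - x)) (C / (β - x))).add
    (hdom (-β) (-α) (C / x))) (Eventually.of_forall fun y => ?_)).trans ?_
  · have hn1 : 0 ≤ (Icc α (x - (β - x))).indicator (fun _ : ℝ => C / (β - x)) y :=
      indicator_nonneg (fun _ _ => div_nonneg hC0 (by linarith)) _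
    have hn2 : 0 ≤ (Icc (-β) (-α)).indicator (fun _ : ℝ => C / x) y :=
      indicator_nonneg (fun _ _ => div_nonneg hC0 hx.le) _
    by_cases hy : y ∈ {y : ℝ | β - x < |x - y|} \ {y : ℝ | ε < |x ^ 2 - y ^ 2|}
    swap
    · rw [indicator_of_notMem hy, norm_zero]
      exact add_nonneg hn1 hn2
    rw [indicator_of_mem hy, norm_div, Complex.norm_real, Real.norm_eq_abs]
    obtain ⟨h1, h2⟩ := hy
    simp only [mem_ofPred_eq, not_lt] at h1 h2
    rw [abs_le] at h2
    have hyα : α ≤ |y| := by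
      rw [← abs_of_nonneg hα0]; exact sq_le_sq.1 (by linarith)
    have hyβ : |y| ≤ β := by
      rw [← abs_of_nonneg hβ0]; exact sq_le_sq.1 (by linarith)
    rcases le_or_gt 0 y with hy0 | hy0
    · rw [abs_of_nonneg hy0] at hyα hyβ
      have h3 : β - x < x - y := by
        rcases lt_abs.1 h1 with h | h
        · exact h
        · linarith
      refine le_trans ?_ (le_add_of_nonneg_right hn2)
      rw [indicator_of_mem (show y ∈ Icc α (x - (β - x)) from ⟨hyα, by linarith⟩)]
      have : 0 < β - x := by linarith
      exact div_le_div₀ hC0 (hC y) this h1.le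
    · rw [abs_of_neg hy0] at hyα hyβ
      refine le_trans ?_ (le_add_of_nonneg_left hn1)
      rw [indicator_of_mem (show y ∈ Icc (-β) (-α) from ⟨by linarith, by linarith⟩)]
      exact div_le_div₀ hC0 (hC y) hx (by rw [abs_of_pos (by linarith)]; linarith)
  · simp only [Pi.add_apply]
    rw [integral_add (hdom _ _ _) (hdom _ _ _), integral_indicator measurableSet_Icc,
      integral_indicator measurableSet_Icc, setIntegral_const, setIntegral_const,
      Real.volume_real_Icc_of_le (by linarith), Real.volume_real_Icc_of_le (by linarith), hlen,
      smul_eq_mul, smul_eq_mul]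
    have h1 : (β - x) * ((β - α) / (x + α)) * (C / (β - x)) = C / (x + α) * (β - α) := by
      have : β - x ≠ 0 := by linarith
      have : x + α ≠ 0 := by positivity
      field_simp
    have h2 : C / (x + α) * (β - α) ≤ C / x * (β - α) := by
      have : 0 ≤ β - α := by linarith
      gcongr
      linarith
    rw [h1]
    nlinarith

/-- Principal values on the half-line `η > 0` in terms of the variable `√η`. -/
theorem hasPrincipalValue_sq {L : NNReal} (hk : LipschitzWith L k) (hkc : HasCompactSupport k)
    (hko : ∀ y, k (-y) = -k y) (hx : 0 < x) {F : ℝ → ℂ} (hF : ∀ y, 0 < y → F (y ^ 2) = k y)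
    (hF0 : ∀ η, η < 0 → F η = 0) :
    HasPrincipalValue F (x ^ 2)
      ((Real.pi : ℂ)⁻¹ * ∫ u in Ioi (0 : ℝ), (k (x - u) - k (x + u)) / u) := by
  have hkcont := hk.continuous
  obtain ⟨C, hC⟩ := hkcont.bounded_above_of_compact_support hkc
  have hint := integrableOn_symm_diff_div hk hkc x
  have hx2 : 0 < x ^ 2 := by positivity
  -- `√(x²+ε) - x` is the radius of the largest interval centred at `x` inside the excised set.
  have hβx : ∀ ε : ℝ, 0 < ε → 0 < √(x ^ 2 + ε) - x := fun ε hε =>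
    sub_pos.2 (Real.lt_sqrt_of_sq_lt (by linarith))
  have hβlim : Tendsto (fun ε : ℝ => √(x ^ 2 + ε) - x) (𝓝[>] 0) (𝓝 0) := by
    have : Continuous fun ε : ℝ => √(x ^ 2 + ε) - x := by fun_prop
    have := (this.tendsto 0).mono_left (nhdsWithin_le_nhds (s := Ioi 0))
    simpa [Real.sqrt_sq hx.le] using this
  have h1 : Tendsto (fun ε : ℝ => ∫ u in Ioi (0 : ℝ), (Ioi (√(x ^ 2 + ε) - x)).indicator
      (fun u : ℝ => (k (x - u) - k (x + u)) / u) u) (𝓝[>] 0)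
      (𝓝 (∫ u in Ioi (0 : ℝ), (k (x - u) - k (x + u)) / u)) := by
    apply tendsto_integral_filter_of_dominated_convergence
      (fun u : ℝ => ‖(k (x - u) - k (x + u)) / u‖)
    · exact Eventually.of_forall fun ε => hint.1.indicator measurableSet_Ioi
    · exact Eventually.of_forall fun ε => Eventually.of_forall fun u =>
        norm_indicator_le_norm_self _ _
    · exact hint.norm
    · refine (ae_restrict_iff' measurableSet_Ioi).2 (Eventually.of_forall fun u hu => ?_)
      refine tendsto_const_nhds.congr' ?_
      filter_upwards [hβlim.eventually_lt_const hu] with ε hε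
      rw [indicator_of_mem (mem_Ioi.2 hε)]
  have h2 : Tendsto (fun ε : ℝ => ∫ y in {y : ℝ | √(x ^ 2 + ε) - x < |x - y|} \
      {y : ℝ | ε < |x ^ 2 - y ^ 2|}, k y / ((x - y : ℝ) : ℂ)) (𝓝[>] 0) (𝓝 0) := by
    have hb : Tendsto (fun ε : ℝ => 2 * (C / x * (√(x ^ 2 + ε) - √(x ^ 2 - ε)))) (𝓝[>] 0)
        (𝓝 0) := by
      have : Continuous fun ε : ℝ => 2 * (C / x * (√(x ^ 2 + ε) - √(x ^ 2 - ε))) := by fun_prop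
      have := (this.tendsto 0).mono_left (nhdsWithin_le_nhds (s := Ioi 0))
      simpa using this
    refine squeeze_zero_norm' ?_ hb
    filter_upwards [Ioo_mem_nhdsGT hx2] with ε hε
    exact norm_setIntegral_sdiff_le hx hε.1 hε.2 hC
  have h3 := (h1.sub h2).const_mul (Real.pi : ℂ)⁻¹
  rw [sub_zero] at h3
  refine h3.congr' ?_
  filter_upwards [Ioo_mem_nhdsGT hx2] with ε hε
  congr 1
  rw [setIntegral_div_sq_sub hkcont hkc hko hε.1 hF hF0,
    ← setIntegral_div_sub_eq_Ioi hkcont hkc (hβx ε hε.1), setIntegral_sdiff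
    (measurableSet_lt measurable_const (by fun_prop))
    (integrableOn_div_of_lt_abs_sub hkcont hkc (hβx ε hε.1)), sub_sub_cancel]
  intro y hy
  simp only [mem_ofPred_eq] at hy ⊢
  by_contra hcon
  have hβ2 : √(x ^ 2 + ε) ^ 2 = x ^ 2 + ε := Real.sq_sqrt (by linarith [hε.1])
  set β := √(x ^ 2 + ε)
  have hxβ := hβx ε hε.1
  rw [not_lt, abs_le] at hcon
  rcases lt_abs.1 hy with h | h <;> nlinarith [hε.1]

end

/-! ### The Hilbert transform -/

section
variable {G : ℝ → ℂ} {m : Measure ℝ} {w : ℝ → ℂ}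

/-- The superposition lemmas at `s = 0`; this supplies the Lipschitz bound needed for principal
values. -/
lemma HasSpectralDensity.contDiff (hG : HasSpectralDensity G m w) : ContDiff ℝ 1 G := by
  have e : G = fun x => ∫ ζ, erfWave 0 ζ (-1) x * w ζ ∂m := by
    ext x
    rw [hG.eq_integral]
    congr 1; ext ζ
    rw [erfWave]; simp [gaussErf_zero_left]
  have hd : ∀ x, HasDerivAt G (∫ ζ, erfWave 0 ζ (-1) x * (Complex.I * (ζ * w ζ)) ∂m) x := by
    intro x
    rw [e]
    exact hasDerivAt_integral_erfWave_mul measurable_id measurable_const hG.integrable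
      hG.integrable_mul (fun x => by simp) x
  refine contDiff_one_iff_deriv.2 ⟨fun x => (hd x).differentiableAt, ?_⟩
  rw [funext fun x => (hd x).deriv]
  exact continuous_integral_erfWave_mul measurable_id measurable_const
    (hG.integrable_mul.const_mul _) 0

/-- The cutoff is itself a superposition of waves, so the truncated function is still a
superposition of chirps, with frequencies `ζ + rk`, and the principal value formula applies to it
directly. -/
lemma HasSpectralDensity.eq_integral_prod [SFinite m] (hG : HasSpectralDensity G m w) {g γ : ℝ → ℂ}
    (hg : IsFourierPair g γ) (s r y : ℝ) :
    g (r * y) * chirp (-s) 0 y * G y =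
      ∫ p, chirp (-s) (p.1 + r * p.2) y * (w p.1 * γ p.2) ∂(m.prod volume) := by
  have e : ∀ p : ℝ × ℝ, chirp (-s) (p.1 + r * p.2) y * (w p.1 * γ p.2) =
      chirp (-s) 0 y * ((chirp 0 p.1 y * w p.1) * (γ p.2 * chirp 0 p.2 (r * y))) := fun p => by
    have : chirp (-s) (p.1 + r * p.2) y =
        chirp (-s) 0 y * chirp 0 p.1 y * chirp 0 p.2 (r * y) := by
      simp only [chirp]
      rw [← Complex.exp_add, ← Complex.exp_add]
      congr 1; push_cast; ring
    rw [this]; ring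
  simp only [e]
  rw [integral_const_mul, integral_prod_mul (fun ζ => chirp 0 ζ y * w ζ)
    (fun k => γ k * chirp 0 k (r * y)), ← hG.eq_integral, ← hg.eq_integral]
  ring

lemma HasSpectralDensity.integrable_prod_mul (hG : HasSpectralDensity G m w) {γ : ℝ → ℂ}
    (hγ : Integrable γ) (hkγ : Integrable fun k : ℝ => (k : ℂ) * γ k) (r : ℝ) :
    Integrable (fun p : ℝ × ℝ => ((p.1 + r * p.2 : ℝ) : ℂ) * (w p.1 * γ p.2))
      (m.prod volume) := by
  have h1 := hG.integrable_mul.mul_prod hγ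
  have h2 := (hG.integrable.mul_prod hkγ).const_mul (r : ℂ)
  refine (h1.add h2).congr (Eventually.of_forall fun p => ?_)
  simp only [Pi.add_apply]; push_cast; ring

/-- The frequencies `ζ + rk` collapse to `ζ`. Evenness of `γ` covers the jump of the error function
at `ζ = 0` when `s = 0`. -/
lemma tendsto_integral_prod_erfWave [SFinite m] (hw : Integrable w m) {γ : ℝ → ℂ}
    (hγ : Integrable γ) (hγe : ∀ k, γ (-k) = γ k) (s x : ℝ) :
    Tendsto (fun r : ℝ => ∫ p, erfWave s (p.1 + r * p.2) (p.1 + r * p.2) x * (w p.1 * γ p.2)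
      ∂(m.prod volume)) (𝓝 0) (𝓝 ((∫ k, γ k) * ∫ ζ, erfWave s ζ ζ x * w ζ ∂m)) := by
  have hmeas : Measurable fun a : ℝ => erfWave s a a x :=
    (by unfold chirp; fun_prop : Measurable fun a : ℝ => chirp 0 a x).mul
      ((measurable_gaussErf _).comp (measurable_const.sub measurable_id))
  have hint : ∀ r : ℝ, Integrable (fun p : ℝ × ℝ =>
      erfWave s (p.1 + r * p.2) (p.1 + r * p.2) x * (w p.1 * γ p.2)) (m.prod volume) := by
    intro r
    have hm : Measurable fun p : ℝ × ℝ => erfWave s (p.1 + r * p.2) (p.1 + r * p.2) x :=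
      hmeas.comp (by fun_prop : Measurable fun p : ℝ × ℝ => p.1 + r * p.2)
    exact (hw.mul_prod hγ).bdd_mul (c := 6) hm.aestronglyMeasurable
      (Eventually.of_forall fun p => norm_erfWave_le _ _ _ _)
  have hin : ∀ r ζ : ℝ, ∫ k, erfWave s (ζ + r * k) (ζ + r * k) x * (w ζ * γ k) =
      w ζ * ∫ k, γ k * erfWave s (ζ + r * k) (ζ + r * k) x := fun r ζ => by
    rw [← integral_const_mul]; congr 1; ext k; ring
  have hprod : ∀ r : ℝ, ∫ p, erfWave s (p.1 + r * p.2) (p.1 + r * p.2) x * (w p.1 * γ p.2)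
      ∂(m.prod volume) =
        ∫ ζ, w ζ * (∫ k, γ k * erfWave s (ζ + r * k) (ζ + r * k) x) ∂m := fun r => by
    rw [integral_prod _ (hint r)]
    simp only [hin]
  simp only [hprod]
  rw [← integral_const_mul]
  apply tendsto_integral_filter_of_dominated_convergence (fun ζ => ‖w ζ‖ * ∫ k, ‖γ k‖ * 6)
  · refine Eventually.of_forall fun r => ?_
    have := (hint r).integral_prod_left.1
    simpa only [hin] using this
  · refine Eventually.of_forall fun r => Eventually.of_forall fun ζ => ?_
    rw [norm_mul]
    gcongr
    refine norm_integral_le_of_norm_le (hγ.norm.mul_const 6) (Eventually.of_forall fun k => ?_)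
    rw [norm_mul]
    gcongr
    exact norm_erfWave_le _ _ _ _
  · exact hw.norm.mul_const _
  · refine Eventually.of_forall fun ζ => ?_
    have hJ : Measurable fun h : ℝ => erfWave s (ζ + h) (ζ + h) x :=
      hmeas.comp (by fun_prop : Measurable fun h : ℝ => ζ + h)
    have := tendsto_integral_even_mul hγ hγe hJ (fun u => norm_erfWave_le _ _ _ _) (by
      have hA : Continuous fun h : ℝ => chirp 0 (ζ + h) x := by unfold chirp; fun_prop
      have := tendsto_symm_mul_gaussErf hA (Complex.I * s) (2 * s * x - ζ) (-1)
      refine (this.congr fun u => ?_).trans (le_of_eq ?_)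
      · simp only [erfWave]; congr 3 <;> ring
      · simp only [erfWave, add_zero])
    refine ((this.const_mul (w ζ))).trans (le_of_eq ?_)
    rw [add_zero]; congr 1; ring

theorem HasSpectralDensity.hasHilbertTransformAt [SFinite m] (hG : HasSpectralDensity G m w)
    (hGo : Function.Odd G) (s : ℝ) {l : ℝ} (hl : 0 < l) :
    HasHilbertTransformAt ((Ici (0 : ℝ)).indicator
      (fun η : ℝ => Complex.exp (-Complex.I * ((s * η : ℝ) : ℂ)) * G (√η))) l
      (Complex.exp (-Complex.I * ((s * l : ℝ) : ℂ)) * erfSuperposition s m w (√l)) := by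
  have hGc := hG.contDiff.continuous
  refine ⟨?_, fun χ hχ => ?_⟩
  · apply LocallyIntegrable.indicator _ measurableSet_Ici
    exact (by fun_prop : Continuous fun η : ℝ =>
      Complex.exp (-Complex.I * ((s * η : ℝ) : ℂ)) * G (√η)).locallyIntegrable
  set x := √l
  have hx : 0 < x := Real.sqrt_pos.2 hl
  have hxl : x ^ 2 = l := Real.sq_sqrt hl.le
  set g : ℝ → ℂ := fun u => (χ (u ^ 2) : ℂ) with hg
  have hgs : ContDiff ℝ ∞ g := hχ.contDiff_comp_sq
  have hgc : HasCompactSupport g := hχ.hasCompactSupport_comp_sq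
  have hge : ∀ u, g (-u) = g u := fun u => by simp [hg]
  obtain ⟨γ₀, hγ₀, hkγ₀⟩ := exists_isFourierPair hgs hgc
  set γ : ℝ → ℂ := fun k => 2⁻¹ * (γ₀ k + γ₀ (-k)) with hγdef
  have hγ : IsFourierPair g γ := hγ₀.even_average hge
  have hγe : ∀ k, γ (-k) = γ k := fun k => by simp [hγdef, add_comm]
  have hkγ : Integrable fun k : ℝ => (k : ℂ) * γ k := by
    refine ((hkγ₀.sub hkγ₀.comp_neg).const_mul (2⁻¹ : ℂ)).congr (Eventually.of_forall fun k => ?_)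
    simp only [Pi.sub_apply, hγdef]; push_cast; ring
  have hγ1 : ∫ k, γ k = 1 := by
    rw [hγ.integral_density]; simp [hg, hχ.eq_one 0 (by simp)]
  set T : ℝ → ℂ := fun r => ∫ p, erfWave s (p.1 + r * p.2) (p.1 + r * p.2) x *
    (w p.1 * γ p.2) ∂(m.prod volume)
  -- The principal value at cutoff `R` is explicit: the formula for superpositions of chirps at `r =
  -- R^{-1/2}`, its `π` cancelled by the normalization of the transform.
  refine ⟨fun R => Complex.I * chirp (-s) 0 x * T (√R)⁻¹, fun R hR => ?_, ?_⟩
  · set r := (√R)⁻¹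
    have hr : r ≠ 0 := inv_ne_zero (Real.sqrt_pos.2 hR).ne'
    set k : ℝ → ℂ := fun y => g (r * y) * chirp (-s) 0 y * G y with hk
    have hks : ContDiff ℝ 1 k := by
      have h1 : ContDiff ℝ 1 fun y : ℝ => g (r * y) :=
        (hgs.of_le (by simp)).comp (contDiff_const.mul contDiff_id)
      have h2 : ContDiff ℝ 1 (chirp (-s) 0) := by
        unfold chirp
        exact (contDiff_const.mul (Complex.ofRealCLM.contDiff.comp
          ((contDiff_const.mul (contDiff_id.pow 2)).add (contDiff_const.mul contDiff_id)))).cexp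
      exact (h1.mul h2).mul hG.contDiff
    have hkc : HasCompactSupport k := (hgc.comp_const_mul hr).mul_right.mul_right
    obtain ⟨L, hL⟩ := hks.lipschitzWith_of_hasCompactSupport hkc (by simp)
    have hko : ∀ y, k (-y) = -k y := fun y => by
      simp only [hk, mul_neg, hge, hGo y]
      congr 3
      simp only [chirp]; congr 3; ring
    have hpv := hasPrincipalValue_sq hL hkc hko hx
      (F := fun η : ℝ => (χ (η / R) : ℂ) * (Ici (0 : ℝ)).indicator
        (fun η : ℝ => Complex.exp (-Complex.I * ((s * η : ℝ) : ℂ)) * G (√η)) η)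
      (fun y hy => by
        rw [indicator_of_mem (mem_Ici.2 (sq_nonneg y)), Real.sqrt_sq hy.le]
        have hph : Complex.exp (-Complex.I * ((s * y ^ 2 : ℝ) : ℂ)) = chirp (-s) 0 y := by
          rw [chirp]; congr 1; push_cast; ring
        simp only [hk, hg]
        rw [hph, mul_assoc, mul_pow, inv_pow, Real.sq_sqrt hR.le, div_eq_inv_mul])
      (fun η hη => by rw [indicator_of_notMem (by simpa using hη), mul_zero])
    rw [integral_Ioi_symm_diff (M := m.prod volume) (b := fun p : ℝ × ℝ => p.1 + r * p.2)
      (by fun_prop) (hG.integrable.mul_prod hγ.integrable_density)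
      (hG.integrable_prod_mul hγ.integrable_density hkγ r) s x
      (fun y => hG.eq_integral_prod hγ s r y) (integrableOn_symm_diff_div hL hkc x), hxl] at hpv
    convert! hpv using 1
    have hpi : (Real.pi : ℂ) ≠ 0 := by exact_mod_cast Real.pi_ne_zero
    have key : ∀ c A : ℂ, Complex.I * c * A = (Real.pi : ℂ)⁻¹ * (Real.pi * Complex.I * c * A) :=
      fun c A => by field_simp
    exact key _ _
  · have h1 := ((tendsto_integral_prod_erfWave hG.integrable hγ.integrable_density hγe s x).comp
      (tendsto_inv_sqrt_atTop.mono_right nhdsWithin_le_nhds)).const_mul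
        (Complex.I * chirp (-s) 0 x)
    refine h1.trans (le_of_eq ?_)
    rw [hγ1, one_mul, erfSuperposition]
    congr 1
    have e : ∀ ζ, erfWave s ζ ζ x * (Complex.I * w ζ) = Complex.I * (erfWave s ζ ζ x * w ζ) :=
      fun ζ => by ring
    simp only [e]
    rw [integral_const_mul, ← hxl, chirp]
    have : Complex.I * ((-s * x ^ 2 + 0 * x : ℝ) : ℂ) = -Complex.I * ((s * x ^ 2 : ℝ) : ℂ) := by
      push_cast; ring
    rw [this]; ring

end

/-! ### Assembly of the two estimates -/

theorem mainTheorem7 :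
    ∃ C : ℝ, ∀ (Fs Fa Ga : ℝ → ℂ) (μs μs' μa μa' ν ν' : ComplexMeasure ℝ),
      Function.Even Fs → Function.Odd Fa → Function.Odd Ga →
      Differentiable ℝ Fs → Differentiable ℝ Fa → Differentiable ℝ Ga →
      HasFourierMeasure Fs μs → HasFourierMeasure (deriv Fs) μs' →
      HasFourierMeasure Fa μa → HasFourierMeasure (deriv Fa) μa' →
      HasFourierMeasure Ga ν → HasFourierMeasure (deriv Ga) ν' →
      ∀ t s : ℝ, t ≠ s →
        (∃ I : ℂ,
          HasImproperIntegral
            (fun l : ℝ => Complex.exp (Complex.I * (((t - s) * l : ℝ) : ℂ)) *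
              Fs (Real.sqrt l) * Ga (Real.sqrt l)) I ∧
          ‖I‖ ≤ C * |t - s| ^ (-(3 / 2) : ℝ) *
            (totalVariationNorm μs * totalVariationNorm ν' +
              totalVariationNorm μs' * totalVariationNorm ν)) ∧
        (∃ (h : ℝ → ℂ) (I : ℂ),
          (∀ l : ℝ, 0 < l →
            HasHilbertTransformAt
              ((Ici (0 : ℝ)).indicator
                (fun η : ℝ => Complex.exp (-Complex.I * ((s * η : ℝ) : ℂ)) * Ga (Real.sqrt η)))
              l (h l)) ∧
          HasImproperIntegral
            (fun l : ℝ => Complex.exp (Complex.I * ((t * l : ℝ) : ℂ)) *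
              Fa (Real.sqrt l) * h l) I ∧
          ‖I‖ ≤ C * |t - s| ^ (-(3 / 2) : ℝ) *
            (totalVariationNorm μa * totalVariationNorm ν' +
              totalVariationNorm μa' * totalVariationNorm ν)) := by
  -- Each term is a product of two density norms, and each norm is `(2π)⁻¹` times a total variation.
  refine ⟨3 * √Real.pi * ((2 * Real.pi)⁻¹ * (2 * Real.pi)⁻¹), ?_⟩
  intro Fs Fa Ga μs μs' μa μa' ν ν' hFs hFa hGa dFs dFa dGa hμs hμs' hμa hμa' hν hν' t s hts
  have hτ : t - s ≠ 0 := sub_ne_zero.2 hts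
  obtain ⟨m, hm, hmn, w, hw, hwn, hwn'⟩ := hν.exists_symmetric_hasSpectralDensity dGa hν'
  obtain ⟨n₁, hn₁, -, v₁, hv₁, hvn₁, hvn₁'⟩ := hμs.exists_symmetric_hasSpectralDensity dFs hμs'
  obtain ⟨n₂, hn₂, -, v₂, hv₂, hvn₂, hvn₂'⟩ := hμa.exists_symmetric_hasSpectralDensity dFa hμa'
  constructor
  · obtain ⟨I, hI, hIn⟩ := hv₁.exists_hasImproperIntegral_even_mul_odd hw hFs hGa hτ
    refine ⟨I, ?_, hIn.trans (le_of_eq ?_)⟩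
    · simpa only [mul_assoc] using hI
    · rw [hwn, hwn', hvn₁, hvn₁']; ring
  · obtain ⟨I, hI, hIn⟩ := hv₂.exists_hasImproperIntegral_odd_mul_erfSuperposition hw hFa hGa s hτ
    refine ⟨fun l => Complex.exp (-Complex.I * ((s * l : ℝ) : ℂ)) * erfSuperposition s m w (√l), I,
      fun l hl => hw.hasHilbertTransformAt hGa s hl, ?_, hIn.trans (le_of_eq ?_)⟩
    · convert! hI using 2 with l
      have : Complex.exp (Complex.I * (((t - s) * l : ℝ) : ℂ)) =
          Complex.exp (Complex.I * ((t * l : ℝ) : ℂ)) *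
            Complex.exp (-Complex.I * ((s * l : ℝ) : ℂ)) := by
        rw [← Complex.exp_add]; congr 1; push_cast; ring
      rw [this]; ring
    · rw [hwn, hwn', hvn₂, hvn₂']; ring
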